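/- For every $n\ge 1$ there is a real number $\lambda=\lambda(n)<1$ such that the following holds for every number field $K$ of degree $n$. Write $\mathcal{O}_K$ for its ring of integers and $\mathbf{N}$ for the absolute norm of ideals. For nonzero $d\in\mathcal{O}_K$ let $\chi_d$ be the quadratic character of $K$ that cuts out $K(\sqrt d)$ (trivial if $d$ is a square), and for real $X>1$ put $$C(K,X)=\{\chi_d : d\in\mathcal{O}_K\setminus\{0\},\ |\mathbf{N}_{K/\mathbb{Q}}\,d|<X\}.$$ This set is finite and nonempty. For $\chi=\chi_d$ let $D_\chi$ be the squarefree part of the ideal $(d)$; it does not depend on the choice of $d$. Let $f$ be a real-valued function on the nonzero ideals of $\mathcal{O}_K$ that is additive, i.e. $f(\mathfrak{a}\mathfrak{a}')=f(\mathfrak{a})+f(\mathfrak{a}')$ for relatively prime $\mathfrak{a},\mathfrak{a}'$, and satisfies $|f(\mathfrak{p})|\le 1$ for every prime $\mathfrak{p}$. For a nonzero prime ideal $\mathfrak{p}$ put $$g_{\mathfrak{p}}(\chi)=\begin{cases} f(\mathfrak{p})\left(1-\frac{1}{\mathbf{N}\mathfrak{p}+1}\right) & \text{if } \mathfrak{p}\mid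 D_\chi,\\ f(\mathfrak{p})\left(-\frac{1}{\mathbf{N}\mathfrak{p}+1}\right) & \text{if } \mathfrak{p}\nmid D_\chi,\end{cases}$$ and for real $z$ put $$\sigma_f(z)=\Big(\sum_{\mathbf{N}\mathfrak{p}<z}\frac{f(\mathfrak{p})^2}{\mathbf{N}\mathfrak{p}}\Big)^{1/2},\qquad \pi_K(z)=\#\{\mathfrak{p}:\mathbf{N}\mathfrak{p}<z\},\qquad c_k=\frac{\Gamma(k+1)}{2^{k/2}\,\Gamma(\frac k2+1)}.$$ Then, uniformly for all such $f$, all real $X>1$, all real $z$ and all integers $0\le k\le\sigma_f(z)^{2/3}$, we have $$\frac{1}{|C(K,X)|}\sum_{\chi\in C(K,X)}\Big(\sum_{\mathbf{N}\mathfrak{p}<z}g_{\mathfrak{p}}(\chi)\Big)^k=c_k\,\sigma_f(z)^k\Big(1+O\Big(\frac{k^3}{\sigma_f(z)^2}\Big)\Big)+O\big(X^{\lambda-1}3^k\pi_K(z)^k\big)$$ if $k$ is even, and $$\frac{1}{|C(K,X)|}\sum_{\chi\in C(K,X)}\Big(\sum_{\mathbf{N}\mathfrak{p}<z}g_{\mathfrak{p}}(\chi)\Big)^k\ll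 c_k\,\sigma_f(z)^{k-1}k^{3/2}+X^{\lambda-1}3^k\pi_K(z)^k$$ if $k$ is odd. The implied constants depend only on $K$. (For $k=0$ the quotient $k^3/\sigma_f(z)^2$ is read as $0$.) -/

import Mathlib

open NumberField

namespace QuadMoments

noncomputable section

open scoped Classical in
/-- For a square root `s` of a nonzero element of `K`: the sign `σ(s) / s`, as a unit of `ℤ`. -/
def signAt {K : Type*} [Field K] (s : AlgebraicClosure K)
    (σ : AlgebraicClosure K ≃ₐ[K] AlgebraicClosure K) : ℤˣ :=
  if σ s = s then 1 else -1

/-- A square root of `d` in the algebraic closure of `K`. -/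
def sqrtOf {K : Type*} [Field K] (d : K) : AlgebraicClosure K :=
  (IsAlgClosed.exists_pow_nat_eq (algebraMap K (AlgebraicClosure K) d) two_pos).choose

theorem sqrtOf_sq {K : Type*} [Field K] (d : K) :
    sqrtOf d ^ 2 = algebraMap K (AlgebraicClosure K) d :=
  (IsAlgClosed.exists_pow_nat_eq (algebraMap K (AlgebraicClosure K) d) two_pos).choose_spec

theorem apply_sqrtOf {K : Type*} [Field K] (d : K)
    (σ : AlgebraicClosure K ≃ₐ[K] AlgebraicClosure K) :
    σ (sqrtOf d) = sqrtOf d ∨ σ (sqrtOf d) = -sqrtOf d := by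
  rw [← sq_eq_sq_iff_eq_or_eq_neg, ← map_pow, sqrtOf_sq]
  exact AlgEquiv.commutes σ d

/-- The homomorphism `σ ↦ σ(√d) / √d`. -/
def signHom {K : Type*} [Field K] [CharZero K] (d : K) :
    (AlgebraicClosure K ≃ₐ[K] AlgebraicClosure K) →* ℤˣ where
  toFun := signAt (sqrtOf d)
  map_one' := by simp [signAt]
  map_mul' σ τ := by
    have hm : (σ * τ) (sqrtOf d) = σ (τ (sqrtOf d)) := rfl
    have : CharZero (AlgebraicClosure K) := algebraRat.charZero _
    by_cases h0 : sqrtOf d = 0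
    · simp [signAt, h0]
    have hne : ¬ (-sqrtOf d = sqrtOf d) := by
      intro h
      exact h0 (neg_eq_self.mp h)
    unfold signAt
    rw [hm]
    rcases apply_sqrtOf d σ with h1 | h1 <;> rcases apply_sqrtOf d τ with h2 | h2 <;>
      simp [h1, h2, hne]

theorem continuous_signHom {K : Type*} [Field K] [CharZero K] (d : K) :
    Continuous (signHom d) := by
  refine continuous_of_continuousAt_one (signHom d) ?_
  have hfin : FiniteDimensional K (IntermediateField.adjoin K {sqrtOf d}) :=
    IntermediateField.adjoin.finiteDimensional (Algebra.IsIntegral.isIntegral _)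
  have hopen := IntermediateField.fixingSubgroup_isOpen (IntermediateField.adjoin K {sqrtOf d})
  have hev : ∀ᶠ σ in nhds (1 : AlgebraicClosure K ≃ₐ[K] AlgebraicClosure K),
      signHom d 1 = signHom d σ := by
    filter_upwards [hopen.mem_nhds (one_mem _)] with σ hσ
    have h : σ (sqrtOf d) = sqrtOf d :=
      (IntermediateField.mem_fixingSubgroup_iff _ σ).mp hσ _
        (IntermediateField.mem_adjoin_simple_self K (sqrtOf d))
    rw [map_one]
    simp [signHom, signAt, h]
  exact (continuousAt_const (y := signHom d 1)).congr hev

/-- Quadratic characters of `K`: continuous homomorphisms from the absolute Galois group of `K`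
(with the Krull topology) to `{1, -1}`; the trivial one is included. -/
abbrev QuadChar (K : Type*) [Field K] : Type _ :=
  (AlgebraicClosure K ≃ₐ[K] AlgebraicClosure K) →ₜ* ℤˣ

/-- The quadratic character `χ_d` that cuts out `K(√d)`: it satisfies `σ(√d) = χ_d(σ) √d`. -/
def chi {K : Type*} [Field K] [CharZero K] (d : K) : QuadChar K where
  toMonoidHom := signHom d
  continuous_toFun := continuous_signHom d

/-- Characters of two nonzero elements agree only if the elements agree up to a square. -/
theorem exists_sq_of_chi_eq {K : Type*} [Field K] [CharZero K] {d e : K} (he : e ≠ 0)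
    (h : chi d = chi e) : ∃ t : K, d = t ^ 2 * e := by
  have : CharZero (AlgebraicClosure K) := algebraRat.charZero _
  have he' : sqrtOf e ≠ 0 := by
    intro h0
    have := sqrtOf_sq e
    rw [h0] at this
    apply he
    simpa using this.symm
  have hfix : ∀ σ : AlgebraicClosure K ≃ₐ[K] AlgebraicClosure K,
      σ (sqrtOf d / sqrtOf e) = sqrtOf d / sqrtOf e := by
    intro σ
    have hs : signAt (sqrtOf d) σ = signAt (sqrtOf e) σ :=
      congrArg (fun χ : QuadChar K => χ σ) h
    have hne : ¬ (-sqrtOf e = sqrtOf e) := fun h => he' (neg_eq_self.mp h)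
    rw [map_div₀]
    unfold signAt at hs
    rcases apply_sqrtOf d σ with h1 | h1 <;> rcases apply_sqrtOf e σ with h2 | h2
    · rw [h1, h2]
    · simp [h1, h2, hne] at hs
    · have : -sqrtOf d = sqrtOf d := by
        by_contra hc
        simp [h1, h2, hc] at hs
      rw [h1, h2, this]
    · rw [h1, h2, neg_div_neg_eq]
  obtain ⟨t, ht⟩ := IntermediateField.mem_bot.mp
    ((InfiniteGalois.mem_bot_iff_fixed (k := K) (sqrtOf d / sqrtOf e)).mpr hfix)
  refine ⟨t, (algebraMap K (AlgebraicClosure K)).injective ?_⟩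
  rw [map_mul, map_pow, ht, ← sqrtOf_sq, ← sqrtOf_sq, div_pow, div_mul_cancel₀]
  exact pow_ne_zero 2 he'

/-- `C(K, X)`: the characters `χ_d` with `d` a nonzero integer of `K` and `|N d| < X`. -/
def C (K : Type*) [Field K] [NumberField K] (X : ℝ) : Set (QuadChar K) :=
  {χ | ∃ d : 𝓞 K, d ≠ 0 ∧ |((Algebra.norm ℚ (d : K) : ℚ) : ℝ)| < X ∧ χ = chi (d : K)}

open scoped Classical in
/-- The squarefree part of a nonzero ideal `I`: the product of the primes that divide `I` to an
odd power, so that `I = squarefreePart I * J ^ 2`. -/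
def squarefreePart {K : Type*} [Field K] [NumberField K] (I : Ideal (𝓞 K)) : Ideal (𝓞 K) :=
  ∏ p ∈ (UniqueFactorizationMonoid.normalizedFactors I).toFinset with
    Odd ((UniqueFactorizationMonoid.normalizedFactors I).count p), p

open scoped Classical in
/-- The squarefree ideal `D_χ`: the squarefree part of `(d)` for any nonzero integer `d` with
`χ_d = χ` (see `D_chi` for the independence of `d`). -/
def D {K : Type*} [Field K] [NumberField K] (χ : QuadChar K) : Ideal (𝓞 K) :=
  if h : ∃ d : 𝓞 K, d ≠ 0 ∧ χ = chi (d : K) then squarefreePart (Ideal.span {h.choose}) else ⊤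

theorem squarefreePart_eq_of_sq {K : Type*} [Field K] [NumberField K] {I J A B : Ideal (𝓞 K)}
    (hI : I ≠ 0) (hJ : J ≠ 0) (hA : A ≠ 0) (hB : B ≠ 0) (h : A ^ 2 * I = B ^ 2 * J) :
    squarefreePart I = squarefreePart J := by
  classical
  have hc : ∀ p : Ideal (𝓞 K), Odd ((UniqueFactorizationMonoid.normalizedFactors I).count p) ↔
      Odd ((UniqueFactorizationMonoid.normalizedFactors J).count p) := by
    intro p
    have := congrArg (fun L => (UniqueFactorizationMonoid.normalizedFactors L).count p) h
    simp only [UniqueFactorizationMonoid.normalizedFactors_mul (pow_ne_zero 2 hA) hI,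
      UniqueFactorizationMonoid.normalizedFactors_mul (pow_ne_zero 2 hB) hJ,
      UniqueFactorizationMonoid.normalizedFactors_pow, Multiset.count_add,
      Multiset.count_nsmul] at this
    rw [Nat.odd_iff, Nat.odd_iff]
    omega
  unfold squarefreePart
  refine Finset.prod_congr ?_ fun _ _ => rfl
  ext p
  simp only [Finset.mem_filter, Multiset.mem_toFinset]
  have hm : ∀ s : Multiset (Ideal (𝓞 K)), Odd (s.count p) → p ∈ s := fun s hs =>
    Multiset.count_pos.mp hs.pos
  constructor
  · rintro ⟨_, h2⟩
    exact ⟨hm _ ((hc p).mp h2), (hc p).mp h2⟩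
  · rintro ⟨_, h2⟩
    exact ⟨hm _ ((hc p).mpr h2), (hc p).mpr h2⟩

theorem D_chi {K : Type*} [Field K] [NumberField K] (d : 𝓞 K) (hd : d ≠ 0) :
    D (chi (d : K)) = squarefreePart (Ideal.span {d}) := by
  have hex : ∃ e : 𝓞 K, e ≠ 0 ∧ chi (d : K) = chi (e : K) := ⟨d, hd, rfl⟩
  rw [D, dif_pos hex]
  obtain ⟨he, hχ⟩ := hex.choose_spec
  set e := hex.choose
  have he' : (e : K) ≠ 0 := by simpa using he
  obtain ⟨t, ht⟩ := exists_sq_of_chi_eq he' hχ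
  obtain ⟨a, b, hb, rfl⟩ := IsFractionRing.div_surjective (A := 𝓞 K) t
  have hb0 : b ≠ 0 := nonZeroDivisors.ne_zero hb
  have hbK : algebraMap (𝓞 K) K b ≠ 0 := by simpa using hb0
  have hab : b ^ 2 * d = a ^ 2 * e := by
    apply FaithfulSMul.algebraMap_injective (𝓞 K) K
    rw [map_mul, map_mul, map_pow, map_pow]
    change _ * (d : K) = _ * (e : K)
    rw [ht]
    field_simp
  have ha0 : a ≠ 0 := by
    rintro rfl
    rw [zero_pow two_ne_zero, zero_mul] at hab
    exact mul_ne_zero (pow_ne_zero 2 hb0) hd hab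
  refine squarefreePart_eq_of_sq (A := Ideal.span {a}) (B := Ideal.span {b}) ?_ ?_ ?_ ?_ ?_
  any_goals simpa [Ideal.span_singleton_eq_bot]
  simp only [Ideal.span_singleton_pow, Ideal.span_singleton_mul_span_singleton, hab]

theorem finite_primes (K : Type*) [Field K] [NumberField K] (z : ℝ) :
    {p : Ideal (𝓞 K) | p.IsPrime ∧ p ≠ ⊥ ∧ (Ideal.absNorm p : ℝ) < z}.Finite := by
  refine (Ideal.finite_setOfPred_absNorm_le (S := 𝓞 K) ⌈z⌉₊).subset ?_
  rintro p ⟨_, _, hp⟩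
  have : (Ideal.absNorm p : ℝ) ≤ ⌈z⌉₊ := hp.le.trans (Nat.le_ceil z)
  exact_mod_cast this

/-- The nonzero prime ideals of norm less than `z`. -/
def primesBelow (K : Type*) [Field K] [NumberField K] (z : ℝ) : Finset (Ideal (𝓞 K)) :=
  (finite_primes K z).toFinset

/-- `π_K(z)`, the number of prime ideals of norm less than `z`. -/
def primePi (K : Type*) [Field K] [NumberField K] (z : ℝ) : ℕ := (primesBelow K z).card

/-- Additive functions on the nonzero ideals. -/
def IsAdditive {K : Type*} [Field K] [NumberField K] (f : Ideal (𝓞 K) → ℝ) : Prop :=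
  ∀ a b : Ideal (𝓞 K), a ≠ ⊥ → b ≠ ⊥ → IsCoprime a b → f (a * b) = f a + f b

/-- `σ_f(z) = (∑_{N p < z} f(p)² / N p)^(1/2)`. -/
def sigma {K : Type*} [Field K] [NumberField K] (f : Ideal (𝓞 K) → ℝ) (z : ℝ) : ℝ :=
  √(∑ p ∈ primesBelow K z, f p ^ 2 / (Ideal.absNorm p : ℝ))

open scoped Classical in
/-- The centred function `g_p(χ)`. -/
def g {K : Type*} [Field K] [NumberField K] (f : Ideal (𝓞 K) → ℝ) (p : Ideal (𝓞 K))
    (χ : QuadChar K) : ℝ :=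
  if p ∣ D χ then f p * (1 - 1 / ((Ideal.absNorm p : ℝ) + 1))
  else f p * (-(1 / ((Ideal.absNorm p : ℝ) + 1)))

/-- The average over `χ ∈ C(K, X)` of `(∑_{N p < z} g_p(χ))^k`. -/
def moment {K : Type*} [Field K] [NumberField K] (f : Ideal (𝓞 K) → ℝ) (X z : ℝ) (k : ℕ) : ℝ :=
  1 / ((C K X).ncard : ℝ) * ∑ᶠ χ ∈ C K X, (∑ p ∈ primesBelow K z, g f p χ) ^ k

/-- `c_k = Γ(k + 1) / (2^(k/2) Γ(k/2 + 1))`. -/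
def c (k : ℕ) : ℝ :=
  Real.Gamma ((k : ℝ) + 1) / ((2 : ℝ) ^ ((k : ℝ) / 2) * Real.Gamma ((k : ℝ) / 2 + 1))

end

end QuadMoments

/-!
Quadratic characters are parametrized by squarefree ideals: if `(d) = I * J ^ 2` with `I`
squarefree, then `D χ_d = I`, the class of `J` depends only on `χ_d`, and what remains of `d` modulo
squares is a unit modulo squares, of which there are finitely many. Replacing `J` by an ideal of
least norm in its class `κ`, the set `C(K, X)` becomes the set of triples of a unit modulo squares,
a class `κ` and a squarefree ideal `I` in the class `κ⁻²` with `N I < X / N (minIdeal κ) ^ 2`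
(`image_paramFinset`).

So the joint distribution of the events `p ∣ D χ` is a matter of counting squarefree ideals in a
class that are divisible by given primes. Ideals in a class are counted with a power saving by
counting lattice points in dilates of `normLeOne K`: its boundary has neighbourhoods of radius `ε`
and volume `O(√ε)`, since the set is a box in logarithmic coordinates and these are Lipschitz away
from the points with a small coordinate (`exists_volume_boundary_normLeOne_le`,
`exists_abs_ncard_classSet_sub_le`). A sieve over `p ^ 2` and a recursion on the primes that are
required to divide show that the proportion of `χ` with all `p ∈ Q` dividing `D χ` is
`∏ 1 / (N p + 1)` up to `O(2 ^ #Q * X ^ (λ - 1))`, uniformly in `Q`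
(`exists_abs_frequency_sub_le`).

Expanding the `k`-th power multinomially, the moment is that of a sum of independent centred
Bernoulli variables of expectations `1 / (N p + 1)`, up to `O(X ^ (λ - 1) * 3 ^ k * π_K(z) ^ k)`
(`abs_average_pow_sub_le`). The moments of the independent model are `k! G_k` for
`∑ G_k t ^ k = ∏ bernoulliEGF`. The logarithmic derivative `Λ` of this product begins with `V t`,
where `V = σ_f(z) ^ 2 + O(1)` is the variance, and all its coefficients are `O(V)`
(`exists_derivative_prod_eq`). Hence `(n + 1) G_{n + 1} = ∑ Λ_j G_{n - j}` is a perturbation of the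
recursion `(n + 2) G_{n + 2} = V G_n` of the Gaussian moments. An induction on `n` shows that the
perturbation changes even coefficients by a relative error `O(n ^ 3 / V)` and makes odd ones at most
`O(n ^ (3/2) / V ^ (1/2))` times the interpolated Gaussian ones (`MomentRecursion.exists_bound`).
When `V` is bounded only finitely many `k` occur, and a crude bound suffices.
-/

/-! ### Moments of sums of Bernoulli variables and their generating functions -/

namespace QuadMoments

open PowerSeries Finset

/-- Coefficientwise domination of a real power series by another one. -/
def Dominated (F G : ℝ⟦X⟧) : Prop := ∀ n, |coeff n F| ≤ coeff n G

theorem Dominated.coeff_nonneg {F G : ℝ⟦X⟧} (h : Dominated F G) (n : ℕ) : 0 ≤ coeff n G :=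
  (abs_nonneg _).trans (h n)

theorem dominated_one : Dominated 1 1 := by
  intro n
  rw [coeff_one]
  split_ifs <;> simp

theorem Dominated.mul {F G F' G' : ℝ⟦X⟧} (h : Dominated F G) (h' : Dominated F' G') :
    Dominated (F * F') (G * G') := by
  intro n
  rw [coeff_mul, coeff_mul]
  refine (abs_sum_le_sum_abs _ _).trans (sum_le_sum fun x _ => ?_)
  rw [abs_mul]
  exact mul_le_mul (h _) (h' _) (abs_nonneg _) (h.coeff_nonneg _)

theorem Dominated.prod {ι : Type*} {s : Finset ι} {F G : ι → ℝ⟦X⟧}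
    (h : ∀ i ∈ s, Dominated (F i) (G i)) : Dominated (∏ i ∈ s, F i) (∏ i ∈ s, G i) := by
  classical
  induction s using Finset.induction_on with
  | empty => simpa using dominated_one
  | insert a s ha ih =>
    rw [prod_insert ha, prod_insert ha]
    exact (h a (mem_insert_self _ _)).mul (ih fun i hi => h i (mem_insert_of_mem hi))

/-- The power series of `exp (a t)`. -/
noncomputable def expS (a : ℝ) : ℝ⟦X⟧ := rescale a (PowerSeries.exp ℝ)

theorem coeff_expS (a : ℝ) (n : ℕ) : coeff n (expS a) = a ^ n / (n.factorial : ℝ) := by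
  simp [expS, coeff_rescale, coeff_exp, div_eq_mul_inv]

theorem prod_expS {ι : Type*} (s : Finset ι) (a : ι → ℝ) :
    ∏ i ∈ s, expS (a i) = expS (∑ i ∈ s, a i) := by
  classical
  induction s using Finset.induction_on with
  | empty =>
    ext n
    rw [coeff_expS, prod_empty, sum_empty, coeff_one]
    rcases eq_or_ne n 0 with rfl | hn <;> simp [*]
  | insert a s ha ih =>
    rw [prod_insert ha, sum_insert ha, ih]
    exact exp_mul_exp_eq_exp_add _ _

/-- Powers of a sum are read off from a product of exponentials, which factors over the summands. -/
theorem pow_eq_coeff_prod_expS {ι : Type*} (s : Finset ι) (a : ι → ℝ) (k : ℕ) :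
    (∑ i ∈ s, a i) ^ k = k.factorial * coeff k (∏ i ∈ s, expS (a i)) := by
  rw [prod_expS, coeff_expS]
  field_simp

/-- The exponential generating function of `f (ξ - α)` for a Bernoulli variable `ξ` of expectation
`α`. -/
noncomputable def bernoulliEGF (f α : ℝ) : ℝ⟦X⟧ :=
  expS (-(α * f)) + PowerSeries.C α * (expS (f * (1 - α)) - expS (-(α * f)))

/-- Both exponents lie in `[-1, 1]`, one on each side of `0`; the powers of `1 - α` and `-α` differ
by at most `(1 - α) + α = 1`. -/
theorem dominated_expS_sub {f α : ℝ} (hf : |f| ≤ 1) (h0 : 0 ≤ α) (h1 : α ≤ 1) :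
    Dominated (expS (f * (1 - α)) - expS (-(α * f))) (expS 1 - 1) := by
  intro n
  rw [map_sub, map_sub, coeff_expS, coeff_expS, coeff_expS, coeff_one]
  rcases Nat.eq_zero_or_pos n with rfl | hn
  · simp
  rw [if_neg hn.ne', one_pow, ← sub_div, sub_zero, abs_div, Nat.abs_cast]
  gcongr
  rw [show -(α * f) = f * (-α) by ring, mul_pow, mul_pow, ← mul_sub, abs_mul, abs_pow]
  have h2 : |f| ^ n ≤ 1 := pow_le_one₀ (abs_nonneg _) hf
  have h3 : |(1 - α) ^ n - (-α) ^ n| ≤ 1 := by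
    refine (abs_sub _ _).trans ?_
    rw [abs_pow, abs_pow, abs_neg, abs_of_nonneg h0, abs_of_nonneg (sub_nonneg.2 h1)]
    have := pow_le_of_le_one h0 h1 hn.ne'
    have := pow_le_of_le_one (sub_nonneg.2 h1) (by linarith : 1 - α ≤ 1) hn.ne'
    linarith
  calc _ ≤ (1 : ℝ) * 1 := mul_le_mul h2 h3 (abs_nonneg _) zero_le_one
    _ = 1 := one_mul 1

theorem dominated_expS {a b : ℝ} (h : |a| ≤ b) : Dominated (expS a) (expS b) := by
  intro n
  rw [coeff_expS, coeff_expS, abs_div, abs_pow, Nat.abs_cast]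
  gcongr

/-- The series `exp (α t) + 2 (exp t - 1)` is the factor that one index contributes to the error:
the `2` is the growth of the error per index in the joint probabilities. -/
theorem dominated_expS_three {α : ℝ} (h0 : 0 ≤ α) (h1 : α ≤ 1 / 3) :
    Dominated (expS α + 2 • (expS 1 - 1)) (expS 3) := by
  intro n
  rw [map_add, map_nsmul, map_sub, coeff_expS, coeff_expS, coeff_expS, coeff_one]
  rcases Nat.eq_zero_or_pos n with rfl | hn
  · simp
  have h2 : α ^ n ≤ α := pow_le_of_le_one h0 (by linarith) hn.ne'
  have h3 : (3 : ℝ) ≤ 3 ^ n := le_self_pow₀ (by norm_num) hn.ne'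
  rw [if_neg hn.ne', sub_zero, one_pow, nsmul_eq_mul, abs_of_nonneg (by positivity)]
  push_cast
  rw [← mul_div_assoc, ← add_div]
  gcongr
  linarith

/-- Averages of `k`-th powers of centred sums of indicator functions are those of the independent
model, up to an error controlled by the deviation of the joint probabilities from products.

Expanding the product of `A i + 1_{ev i} B i` over subsets `Q` of `P`, the average only sees the
joint probabilities of the `Q`; the weights that they carry are dominated by a product of
exponentials. -/
theorem abs_average_pow_sub_le {Ω ι : Type*} (W : Finset Ω) (P : Finset ι)
    (ev : ι → Ω → Prop) [∀ i ω, Decidable (ev i ω)] (f α : ι → ℝ) {R : ℝ}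
    (hf : ∀ i ∈ P, |f i| ≤ 1) (h0 : ∀ i ∈ P, 0 ≤ α i) (h1 : ∀ i ∈ P, α i ≤ 1 / 3)
    (hR : ∀ Q ⊆ P, |1 / (#W : ℝ) * #{ω ∈ W | ∀ i ∈ Q, ev i ω} - ∏ i ∈ Q, α i| ≤ R * 2 ^ #Q)
    (k : ℕ) :
    |1 / (#W : ℝ) * ∑ ω ∈ W,
        (∑ i ∈ P, if ev i ω then f i * (1 - α i) else -(α i * f i)) ^ k
      - k.factorial * coeff k (∏ i ∈ P, bernoulliEGF (f i) (α i))| ≤ R * 3 ^ k * (#P : ℝ) ^ k := by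
  classical
  set A : ι → ℝ⟦X⟧ := fun i => expS (-(α i * f i)) with hA
  set B : ι → ℝ⟦X⟧ := fun i => expS (f i * (1 - α i)) - expS (-(α i * f i)) with hB
  have e1 : ∀ ω, (∑ i ∈ P, if ev i ω then f i * (1 - α i) else -(α i * f i)) ^ k
      = k.factorial * ∑ Q ∈ P.powerset, (if ∀ i ∈ Q, ev i ω then 1 else 0) *
        coeff k ((∏ i ∈ Q, B i) * ∏ i ∈ P \ Q, A i) := by
    intro ω
    rw [pow_eq_coeff_prod_expS]
    congr 1
    have : ∀ i ∈ P, expS (if ev i ω then f i * (1 - α i) else -(α i * f i))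
        = (if ev i ω then B i else 0) + A i := by
      intro i _
      split_ifs <;> simp [hA, hB]
    rw [prod_congr rfl this, prod_add, map_sum]
    refine sum_congr rfl fun Q _ => ?_
    by_cases h : ∀ i ∈ Q, ev i ω
    · rw [if_pos h, one_mul, prod_congr rfl fun i hi => if_pos (h i hi)]
    · rw [if_neg h, zero_mul]
      push Not at h
      obtain ⟨i, hi, hi'⟩ := h
      rw [prod_eq_zero hi (if_neg hi'), zero_mul, map_zero]
  have e2 : coeff k (∏ i ∈ P, bernoulliEGF (f i) (α i)) = ∑ Q ∈ P.powerset, (∏ i ∈ Q, α i) *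
        coeff k ((∏ i ∈ Q, B i) * ∏ i ∈ P \ Q, A i) := by
    have : ∀ i ∈ P, bernoulliEGF (f i) (α i) = PowerSeries.C (α i) * B i + A i := by
      intro i _
      rw [bernoulliEGF, add_comm]
    rw [prod_congr rfl this, prod_add, map_sum]
    refine sum_congr rfl fun Q _ => ?_
    rw [prod_mul_distrib, ← map_prod, mul_assoc, coeff_C_mul]
  have e3 : 1 / (#W : ℝ) * ∑ ω ∈ W,
        (∑ i ∈ P, if ev i ω then f i * (1 - α i) else -(α i * f i)) ^ k
      = k.factorial * ∑ Q ∈ P.powerset, (1 / (#W : ℝ) * #{ω ∈ W | ∀ i ∈ Q, ev i ω}) *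
        coeff k ((∏ i ∈ Q, B i) * ∏ i ∈ P \ Q, A i) := by
    rw [sum_congr rfl fun ω _ => e1 ω, ← mul_sum, sum_comm, ← mul_assoc, mul_comm (1 / _),
      mul_assoc, mul_sum]
    congr 1
    refine sum_congr rfl fun Q _ => ?_
    rw [← sum_mul, sum_boole]
    ring
  rw [e3, e2, ← mul_sub, ← sum_sub_distrib]
  have e4 : |∑ Q ∈ P.powerset, ((1 / (#W : ℝ) * #{ω ∈ W | ∀ i ∈ Q, ev i ω}) *
        coeff k ((∏ i ∈ Q, B i) * ∏ i ∈ P \ Q, A i) - (∏ i ∈ Q, α i) *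
        coeff k ((∏ i ∈ Q, B i) * ∏ i ∈ P \ Q, A i))|
      ≤ R * coeff k (∏ i ∈ P, expS 3) := by
    have e5 : ∑ Q ∈ P.powerset, R * 2 ^ #Q *
        coeff k ((∏ i ∈ Q, (expS 1 - 1)) * ∏ i ∈ P \ Q, expS (α i))
        = R * coeff k (∏ i ∈ P, (expS (α i) + 2 • (expS 1 - 1))) := by
      simp_rw [add_comm (expS (α _)), prod_add, map_sum, mul_sum]
      refine sum_congr rfl fun Q _ => ?_
      rw [prod_const, prod_const, smul_pow, smul_mul_assoc, map_nsmul, nsmul_eq_mul]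
      push_cast
      ring
    have hR0 : 0 ≤ R := by simpa using (abs_nonneg _).trans (hR ∅ (empty_subset _))
    calc _ ≤ ∑ Q ∈ P.powerset, R * 2 ^ #Q *
        coeff k ((∏ i ∈ Q, (expS 1 - 1)) * ∏ i ∈ P \ Q, expS (α i)) := by
          refine (abs_sum_le_sum_abs _ _).trans (sum_le_sum fun Q hQ => ?_)
          have hQ := mem_powerset.1 hQ
          rw [← sub_mul, abs_mul]
          refine mul_le_mul (hR Q hQ) ?_ (abs_nonneg _) (by positivity)
          refine Dominated.mul (Dominated.prod fun i hi => ?_) (Dominated.prod fun i hi => ?_) k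
          · exact dominated_expS_sub (hf i (hQ hi)) (h0 i (hQ hi))
              ((h1 i (hQ hi)).trans (by norm_num))
          · have hi := (mem_sdiff.1 hi).1
            refine dominated_expS ?_
            rw [abs_neg, abs_mul, abs_of_nonneg (h0 i hi)]
            exact mul_le_of_le_one_right (h0 i hi) (hf i hi)
      _ = _ := e5
      _ ≤ _ := by
          refine mul_le_mul_of_nonneg_left ((le_abs_self _).trans ?_) hR0
          exact Dominated.prod (fun i hi => dominated_expS_three (h0 i hi) (h1 i hi)) k
  rw [abs_mul, Nat.abs_cast]
  calc _ ≤ (k.factorial : ℝ) * (R * coeff k (∏ i ∈ P, expS 3)) := by gcongr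
    _ = R * (k.factorial * coeff k (∏ i ∈ P, expS 3)) := by ring
    _ = R * (∑ i ∈ P, (3 : ℝ)) ^ k := by rw [pow_eq_coeff_prod_expS]
    _ = _ := by rw [sum_const, nsmul_eq_mul, mul_comm (#P : ℝ), mul_pow, mul_assoc]

/-- The `n`-th coefficient is the `n`-th central moment over `n!`. -/
theorem coeff_bernoulliEGF (f α : ℝ) (n : ℕ) : coeff n (bernoulliEGF f α) =
    f ^ n * ((1 - α) * (-α) ^ n + α * (1 - α) ^ n) / n.factorial := by
  rw [bernoulliEGF, map_add, coeff_C_mul, map_sub, coeff_expS, coeff_expS, mul_pow,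
    show -(α * f) = f * (-α) by ring, mul_pow]
  ring

theorem abs_coeff_bernoulliEGF_le {f α : ℝ} (hf : |f| ≤ 1) (h0 : 0 ≤ α) (h1 : α ≤ 1) {n : ℕ}
    (hn : 2 ≤ n) :
    |coeff n (bernoulliEGF f α)| ≤ f ^ 2 * (α * (1 - α)) / n.factorial := by
  rw [coeff_bernoulliEGF, abs_div, Nat.abs_cast, abs_mul, abs_pow]
  have h1' : 0 ≤ 1 - α := sub_nonneg.2 h1
  gcongr
  · rw [← sq_abs f]
    exact pow_le_pow_of_le_one (abs_nonneg _) hf hn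
  · obtain ⟨m, rfl⟩ : ∃ m, n = m + 1 := ⟨n - 1, by omega⟩
    have hm : m ≠ 0 := by omega
    refine (abs_add_le _ _).trans ?_
    rw [abs_mul, abs_mul, abs_pow, abs_pow, abs_neg, abs_of_nonneg h0, abs_of_nonneg h1', pow_succ,
      pow_succ]
    have := pow_le_of_le_one h0 h1 hm
    have := pow_le_of_le_one h1' (by linarith : 1 - α ≤ 1) hm
    nlinarith [mul_nonneg h0 h1']

theorem two_pow_pred_le_factorial (j : ℕ) : (2 : ℝ) ^ (j - 1) ≤ j.factorial := by
  rcases Nat.eq_zero_or_pos j with rfl | hj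
  · simp
  obtain ⟨m, rfl⟩ : ∃ m, j = m + 1 := ⟨j - 1, by omega⟩
  have := Nat.factorial_mul_pow_le_factorial (m := 1) (n := m)
  rw [Nat.factorial_one, one_mul, one_add_one_eq_two, add_comm] at this
  exact_mod_cast this

/-- For a series with constant term `1`, no linear term and coefficients at most `v / n!`, the
coefficients of the inverse are at most `1` when `v ≤ 1`. -/
theorem abs_coeff_inv_le {a : ℝ⟦X⟧} {v : ℝ} (hv1 : v ≤ 1) (ha0 : coeff 0 a = 1)
    (ha1 : coeff 1 a = 0) (ha : ∀ n, 2 ≤ n → |coeff n a| ≤ v / n.factorial) (n : ℕ) :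
    |coeff n a⁻¹| ≤ 1 := by
  have hc : constantCoeff a = 1 := by rw [← coeff_zero_eq_constantCoeff_apply, ha0]
  induction n using Nat.strong_induction_on with
  | _ n ih =>
  rcases Nat.eq_zero_or_pos n with rfl | hn
  · simp [coeff_zero_eq_constantCoeff_apply, constantCoeff_inv, hc]
  rw [coeff_inv, if_neg hn.ne', hc, inv_one, neg_mul, one_mul, abs_neg]
  refine (abs_sum_le_sum_abs _ _).trans ?_
  rw [Nat.sum_antidiagonal_eq_sum_range_succ_mk]
  dsimp only
  calc _ ≤ ∑ j ∈ range (n + 1), (if 2 ≤ j then 1 / (j.factorial : ℝ) else 0) := by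
        refine sum_le_sum fun j hj => ?_
        have hj := mem_range.1 hj
        split_ifs with h1 h2 h2
        · rw [abs_mul]
          calc _ ≤ v / j.factorial * 1 := mul_le_mul (ha j h2) (ih _ h1) (abs_nonneg _)
                ((abs_nonneg _).trans (ha j h2))
            _ ≤ _ := by rw [mul_one]; gcongr
        · have : j = 0 ∨ j = 1 := by omega
          rcases this with rfl | rfl
          · omega
          · simp [ha1]
        · simp
        · simp
    _ ≤ ∑ j ∈ range (n + 1), (if 2 ≤ j then (1 / 2 : ℝ) ^ (j - 1) else 0) := by
        refine sum_le_sum fun j hj => ?_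
        split_ifs with h
        · rw [one_div_pow]
          refine one_div_le_one_div_of_le (by positivity) ?_
          exact two_pow_pred_le_factorial j
        · exact le_rfl
    _ ≤ 1 := by
        have : ∀ m : ℕ, ∑ j ∈ range (m + 1), (if 2 ≤ j then (1 / 2 : ℝ) ^ (j - 1) else 0)
            ≤ 1 - (if 1 ≤ m then (1 / 2 : ℝ) ^ (m - 1) else 0) := by
          intro m
          induction m with
          | zero => simp
          | succ m ih =>
            rw [sum_range_succ]
            rcases Nat.eq_zero_or_pos m with rfl | hm
            · simp
            · obtain ⟨l, rfl⟩ : ∃ l, m = l + 1 := ⟨m - 1, by omega⟩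
              rw [if_pos (by omega)] at ih
              rw [if_pos (by omega), if_pos (by omega)]
              simp only [Nat.add_sub_cancel] at ih ⊢
              rw [pow_succ]
              linarith
        refine (this n).trans ?_
        rw [if_pos (by omega)]
        have : (0 : ℝ) ≤ (1 / 2) ^ (n - 1) := by positivity
        linarith

/-- The product of generating functions satisfies a linear differential equation `G' = Λ G` whose
coefficient `Λ` has size governed by the total variance. -/
theorem exists_derivative_prod_eq {ι : Type*} (P : Finset ι) (a : ι → ℝ⟦X⟧) (v : ι → ℝ)
    (hv1 : ∀ i ∈ P, v i ≤ 1) (ha0 : ∀ i ∈ P, coeff 0 (a i) = 1)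
    (ha1 : ∀ i ∈ P, coeff 1 (a i) = 0) (ha2 : ∀ i ∈ P, coeff 2 (a i) = v i / 2)
    (ha : ∀ i ∈ P, ∀ n, 2 ≤ n → |coeff n (a i)| ≤ v i / n.factorial) :
    ∃ Λ : ℝ⟦X⟧, d⁄dX ℝ (∏ i ∈ P, a i) = Λ * ∏ i ∈ P, a i ∧ coeff 0 Λ = 0 ∧
      coeff 1 Λ = ∑ i ∈ P, v i ∧ ∀ n, |coeff n Λ| ≤ 2 * ∑ i ∈ P, v i := by
  classical
  induction P using Finset.induction_on with
  | empty => exact ⟨0, by simp⟩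
  | insert p P hp ih =>
    obtain ⟨Λ, h1, h2, h3, h4⟩ := ih (fun i hi => hv1 i (mem_insert_of_mem hi))
      (fun i hi => ha0 i (mem_insert_of_mem hi)) (fun i hi => ha1 i (mem_insert_of_mem hi))
      (fun i hi => ha2 i (mem_insert_of_mem hi)) (fun i hi => ha i (mem_insert_of_mem hi))
    have hp' := mem_insert_self p P
    have hc : constantCoeff (a p) = 1 := by
      rw [← coeff_zero_eq_constantCoeff_apply, ha0 p hp']
    have hd0 : coeff 0 (d⁄dX ℝ (a p)) = 0 := by rw [coeff_derivative]; simp [ha1 p hp']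
    have hd1 : coeff 1 (d⁄dX ℝ (a p)) = v p := by rw [coeff_derivative]; simp [ha2 p hp']; ring
    have hv0 : 0 ≤ v p := by
      have := (abs_nonneg _).trans (ha p hp' 2 le_rfl)
      simp at this
      linarith
    -- The logarithmic derivative of the product is the sum of the logarithmic derivatives.
    refine ⟨d⁄dX ℝ (a p) * (a p)⁻¹ + Λ, ?_, ?_, ?_, fun n => ?_⟩
    · rw [prod_insert hp, Derivation.leibniz, h1, smul_eq_mul, smul_eq_mul, add_mul]
      have : (a p)⁻¹ * a p = 1 := PowerSeries.inv_mul_cancel _ (by simp [hc])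
      linear_combination (-(d⁄dX ℝ (a p)) * ∏ i ∈ P, a i) * this
    · rw [map_add, h2, coeff_mul]
      simp [coeff_zero_eq_constantCoeff_apply] at hd0 ⊢
      simp [hd0]
    · rw [map_add, h3, sum_insert hp, coeff_mul, Nat.sum_antidiagonal_eq_sum_range_succ_mk]
      simp only [sum_range_succ, range_zero, sum_empty, hd0, hd1]
      simp [coeff_zero_eq_constantCoeff_apply, constantCoeff_inv, hc]
    · rw [map_add, sum_insert hp, mul_add]
      refine (abs_add_le _ _).trans (add_le_add ?_ (h4 n))
      rw [coeff_mul, Nat.sum_antidiagonal_eq_sum_range_succ_mk]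
      refine (abs_sum_le_sum_abs _ _).trans ?_
      calc _ ≤ ∑ j ∈ range (n + 1), (if 1 ≤ j then v p * (1 / 2 : ℝ) ^ (j - 1) else 0) := by
            refine sum_le_sum fun j _ => ?_
            dsimp only
            split_ifs with hj
            · rw [abs_mul]
              refine (mul_le_of_le_one_right (abs_nonneg _)
                (abs_coeff_inv_le (hv1 p hp') (ha0 p hp') (ha1 p hp') (ha p hp') _)).trans ?_
              rw [coeff_derivative, abs_mul, abs_of_nonneg (by positivity : (0 : ℝ) ≤ j + 1)]
              calc _ ≤ v p / (j + 1).factorial * (j + 1) := by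
                    gcongr
                    exact ha p hp' _ (by omega)
                _ = v p * (1 / (j.factorial : ℝ)) := by
                    rw [Nat.factorial_succ]; push_cast; field_simp
                _ ≤ _ := by
                    gcongr
                    rw [one_div_pow]
                    refine one_div_le_one_div_of_le (by positivity) ?_
                    exact two_pow_pred_le_factorial j
            · have : j = 0 := by omega
              subst this
              rw [hd0]; simp
        _ ≤ 2 * v p := by
            have : ∀ m : ℕ, ∑ j ∈ range (m + 1), (if 1 ≤ j then v p * (1 / 2 : ℝ) ^ (j - 1) else 0)
                = 2 * v p - 2 * v p * (1 / 2) ^ m := by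
              intro m
              induction m with
              | zero => simp
              | succ m ih =>
                rw [sum_range_succ, ih, if_pos (by omega)]
                simp only [Nat.add_sub_cancel, pow_succ]
                ring
            rw [this]
            have : 0 ≤ 2 * v p * (1 / 2) ^ n := by positivity
            linarith

end QuadMoments

/-! ### Recursions for nearly Gaussian moments -/

namespace QuadMoments

open Finset

/-- The `n`-th coefficient of the moment generating function of a centred Gaussian of variance `V`
for even `n`, interpolated to odd `n` by the Gamma function. -/
noncomputable def gaussCoeff (V : ℝ) (n : ℕ) : ℝ :=
  (V / 2) ^ ((n : ℝ) / 2) / Real.Gamma ((n : ℝ) / 2 + 1)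

theorem gaussCoeff_pos {V : ℝ} (hV : 0 < V) (n : ℕ) : 0 < gaussCoeff V n :=
  div_pos (Real.rpow_pos_of_pos (by positivity) _) (Real.Gamma_pos_of_pos (by positivity))

theorem gaussCoeff_zero (V : ℝ) : gaussCoeff V 0 = 1 := by simp [gaussCoeff]

theorem gaussCoeff_rec {V : ℝ} (hV : 0 < V) (n : ℕ) :
    ((n : ℝ) + 2) * gaussCoeff V (n + 2) = V * gaussCoeff V n := by
  unfold gaussCoeff
  have h : ((n + 2 : ℕ) : ℝ) / 2 = (n : ℝ) / 2 + 1 := by push_cast; ring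
  have hg : Real.Gamma ((n : ℝ) / 2 + 1) ≠ 0 := (Real.Gamma_pos_of_pos (by positivity)).ne'
  rw [h, Real.rpow_add_one (by positivity), Real.Gamma_add_one (by positivity)]
  field_simp

/-- Log-convexity of the Gamma function between `y` and `y + 1`. -/
theorem Gamma_add_half_le {y : ℝ} (hy : 0 < y) :
    Real.Gamma (y + 1 / 2) ≤ √y * Real.Gamma y := by
  have h := Real.Gamma_mul_add_mul_le_rpow_Gamma_mul_rpow_Gamma (s := y) (t := y + 1)
    (a := 1 / 2) (b := 1 / 2) hy (by linarith) (by norm_num) (by norm_num) (by norm_num)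
  rw [show 1 / 2 * y + 1 / 2 * (y + 1) = y + 1 / 2 by ring, Real.Gamma_add_one hy.ne',
    ← Real.sqrt_eq_rpow, ← Real.sqrt_eq_rpow, Real.sqrt_mul hy.le] at h
  have hg := (Real.Gamma_pos_of_pos hy).le
  calc _ ≤ _ := h
    _ = √y * (√(Real.Gamma y) * √(Real.Gamma y)) := by ring
    _ = _ := by rw [Real.mul_self_sqrt hg]

theorem gaussCoeff_le_succ {V : ℝ} (hV : 0 < V) (n : ℕ) :
    gaussCoeff V n ≤ √(2 * (n + 1) / V) * gaussCoeff V (n + 1) := by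
  unfold gaussCoeff
  have hg : 0 < Real.Gamma ((n : ℝ) / 2 + 1) := Real.Gamma_pos_of_pos (by positivity)
  have hg' : 0 < Real.Gamma (((n : ℝ) / 2 + 1) + 1 / 2) := Real.Gamma_pos_of_pos (by positivity)
  have h1 : ((n + 1 : ℕ) : ℝ) / 2 + 1 = ((n : ℝ) / 2 + 1) + 1 / 2 := by push_cast; ring
  have h2 : ((n + 1 : ℕ) : ℝ) / 2 = (n : ℝ) / 2 + 1 / 2 := by push_cast; ring
  rw [h1, h2, Real.rpow_add (by positivity : 0 < V / 2), ← Real.sqrt_eq_rpow]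
  have hs : √((n : ℝ) / 2 + 1) ≤ √(2 * (n + 1) / V) * √(V / 2) := by
    rw [← Real.sqrt_mul (by positivity)]
    refine Real.sqrt_le_sqrt ?_
    field_simp
    have : (0 : ℝ) ≤ n := by positivity
    linarith
  have hp : 0 < (V / 2) ^ ((n : ℝ) / 2) := Real.rpow_pos_of_pos (by positivity) _
  rw [← mul_div_assoc, div_le_div_iff₀ hg hg']
  calc _ ≤ (V / 2) ^ ((n : ℝ) / 2) * (√((n : ℝ) / 2 + 1) * Real.Gamma ((n : ℝ) / 2 + 1)) := by
        gcongr
        exact Gamma_add_half_le (by positivity)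
    _ ≤ (V / 2) ^ ((n : ℝ) / 2) *
        (√(2 * (n + 1) / V) * √(V / 2) * Real.Gamma ((n : ℝ) / 2 + 1)) := by gcongr
    _ = _ := by ring

/-- Lower Gaussian coefficients are smaller, by a factor of at most `√(2 (n + s) / V)` per index. -/
theorem gaussCoeff_le_pow {V : ℝ} (hV : 0 < V) (n s : ℕ) :
    gaussCoeff V n ≤ √(2 * (n + s : ℕ) / V) ^ s * gaussCoeff V (n + s) := by
  induction s with
  | zero => simp
  | succ s ih =>
    have hp := gaussCoeff_pos hV (n + (s + 1))
    have hm : √(2 * (n + s : ℕ) / V) ≤ √(2 * (n + (s + 1) : ℕ) / V) := by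
      refine Real.sqrt_le_sqrt ?_
      gcongr
      omega
    calc _ ≤ √(2 * (n + s : ℕ) / V) ^ s * gaussCoeff V (n + s) := ih
      _ ≤ √(2 * (n + (s + 1) : ℕ) / V) ^ s *
          (√(2 * (n + (s + 1) : ℕ) / V) * gaussCoeff V (n + (s + 1))) := by
        gcongr
        · exact (gaussCoeff_pos hV _).le
        · have := gaussCoeff_le_succ hV (n + s)
          push_cast [← add_assoc] at this ⊢
          exact this
      _ = _ := by ring

/-- The tail of the recursion `(n + 1) G_{n+1} = ∑ Λ_j G_{n-j}` is small compared with the Gaussian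
coefficient. -/
theorem abs_sum_tail_le {V D : ℝ} (hV : 0 < V) (hD : 0 ≤ D) {G Λ : ℕ → ℝ}
    (hΛ : ∀ j, |Λ j| ≤ 2 * V) {n : ℕ} (hn : 8 * ((n : ℝ) + 1) ≤ V)
    (hG : ∀ i ≤ n, |G i| ≤ D * gaussCoeff V i) (m : ℕ) :
    |∑ j ∈ Ico m (n + 1), Λ j * G (n - j)|
      ≤ 4 * V * D * √(2 * ((n : ℝ) + 1) / V) ^ (m + 1) * gaussCoeff V (n + 1) := by
  set r := √(2 * ((n : ℝ) + 1) / V) with hr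
  have hr0 : 0 ≤ r := Real.sqrt_nonneg _
  have hr1 : r ≤ 1 / 2 := by
    rw [hr, Real.sqrt_le_left (by norm_num), div_le_iff₀ hV]
    linarith
  have he := gaussCoeff_pos hV (n + 1)
  calc _ ≤ ∑ j ∈ Ico m (n + 1), 2 * V * D * gaussCoeff V (n + 1) * r ^ (j + 1) := by
        refine (abs_sum_le_sum_abs _ _).trans (sum_le_sum fun j hj => ?_)
        have hj := mem_Ico.1 hj
        have h1 := gaussCoeff_le_pow hV (n - j) (j + 1)
        rw [show n - j + (j + 1) = n + 1 by omega] at h1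
        push_cast at h1
        rw [abs_mul]
        calc _ ≤ 2 * V * (D * gaussCoeff V (n - j)) :=
              mul_le_mul (hΛ j) (hG _ (by omega)) (abs_nonneg _) (by positivity)
          _ ≤ 2 * V * (D * (r ^ (j + 1) * gaussCoeff V (n + 1))) := by gcongr
          _ = _ := by ring
    _ = 2 * V * D * gaussCoeff V (n + 1) * ∑ j ∈ Ico m (n + 1), r ^ (j + 1) := by rw [mul_sum]
    _ ≤ 2 * V * D * gaussCoeff V (n + 1) * (2 * r ^ (m + 1)) := by
        gcongr
        rcases le_or_gt (n + 1) m with h | h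
        · rw [Ico_eq_empty_of_le h, sum_empty]
          positivity
        rw [sum_congr rfl fun j _ => pow_succ r j, ← sum_mul, pow_succ, ← mul_assoc]
        gcongr
        have := geom_sum_Ico_le_of_lt_one (m := m) (n := n + 1) hr0 (by linarith : r < 1)
        refine this.trans ?_
        rw [div_le_iff₀ (by linarith)]
        nlinarith [pow_nonneg hr0 m]
    _ = _ := by ring

theorem mul_sqrt_sub_two_le {N : ℝ} (hN : 2 ≤ N) :
    (N - 2) * √(N - 2) + 2 * √N ≤ N * √N := by
  have : √(N - 2) ≤ √N := Real.sqrt_le_sqrt (by linarith)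
  nlinarith [mul_le_mul_of_nonneg_left this (by linarith : 0 ≤ N - 2)]

section recursion

variable {V : ℝ} {G Λ : ℕ → ℝ}

/-- The recursion satisfied by the coefficients `G n` of a power series with constant term `1` whose
logarithmic derivative has coefficients `Λ n`, together with the size of the `Λ n`. -/
structure MomentRecursion (V : ℝ) (G Λ : ℕ → ℝ) : Prop where
  nonneg : 0 ≤ V
  zero : G 0 = 1
  succ : ∀ n : ℕ, ((n : ℝ) + 1) * G (n + 1) = ∑ j ∈ range (n + 1), Λ j * G (n - j)
  coeff_zero : Λ 0 = 0
  coeff_one : Λ 1 = V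
  abs_coeff_le : ∀ j, |Λ j| ≤ 2 * V

/-- The recursion with the main term `V G_n` split off; it is the recursion of the Gaussian
coefficients, perturbed by the terms with `j ≥ 2`. -/
theorem MomentRecursion.split (h : MomentRecursion V G Λ) (n : ℕ) :
    ((n : ℝ) + 2) * G (n + 2) = V * G n + ∑ j ∈ Ico 2 (n + 2), Λ j * G (n + 1 - j) := by
  have := h.succ (n + 1)
  rw [range_eq_Ico, sum_eq_sum_Ico_succ_bot (by omega), sum_eq_sum_Ico_succ_bot (by omega),
    h.coeff_zero, zero_mul, zero_add, zero_add, h.coeff_one, Nat.add_sub_cancel] at this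
  push_cast at this
  rw [← this]
  ring

theorem MomentRecursion.one (h : MomentRecursion V G Λ) : G 1 = 0 := by
  simpa [h.coeff_zero] using h.succ 0

theorem mul_sqrt_two_mul_div_sq (hV : 0 < V) {N : ℝ} (hN : 0 ≤ N) :
    V * √(2 * N / V) ^ 2 = 2 * N := by
  rw [Real.sq_sqrt (by positivity)]
  field_simp

theorem sqrt_two_mul_div_le (hV : 0 < V) {N : ℝ} (hN : 0 ≤ N) :
    √(2 * N / V) ≤ 3 / 2 * (√N / √V) := by
  rw [mul_div_assoc, Real.sqrt_mul (by norm_num), Real.sqrt_div hN]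
  gcongr
  rw [Real.sqrt_le_left (by norm_num)]
  norm_num

/-- A first bound for the solution of the recursion, with a constant that grows with `n³ / V`. -/
theorem MomentRecursion.abs_le_exp_mul_gaussCoeff (h : MomentRecursion V G Λ) (hV : 0 < V)
    (n : ℕ) (hn : 8 * (n : ℝ) ≤ V) :
    |G n| ≤ Real.exp (12 * (n * √n / √V)) * gaussCoeff V n := by
  have hΛ := h.abs_coeff_le
  induction n using Nat.strong_induction_on with
  | _ n ih =>
  rcases n with _ | _ | n
  · simp [h.zero, gaussCoeff_zero]
  · rw [zero_add, h.one, abs_zero]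
    exact mul_nonneg (Real.exp_nonneg _) (gaussCoeff_pos hV _).le
  push_cast at hn
  set D := Real.exp (12 * (((n : ℝ) + 1) * √(n + 1) / √V)) with hD
  have hG : ∀ i ≤ n + 1, |G i| ≤ D * gaussCoeff V i := by
    intro i hi
    have hi' : (i : ℝ) ≤ n + 1 := by exact_mod_cast hi
    refine (ih i (by omega) (by linarith)).trans ?_
    have := (gaussCoeff_pos hV i).le
    rw [hD]
    gcongr
  have ht := abs_sum_tail_le hV (Real.exp_nonneg _) hΛ (n := n + 1) (by push_cast; linarith) hG 2
  push_cast at ht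
  have hs := h.split n
  set N : ℝ := (n : ℝ) + 2 with hN
  rw [show (n : ℝ) + 1 + 1 = N by rw [hN]; ring] at ht
  have hN0 : 0 < N := by positivity
  set r := √(2 * N / V)
  have hr : V * r ^ 2 = 2 * N := mul_sqrt_two_mul_div_sq hV (by linarith)
  have hr2 : r ≤ 3 / 2 * (√N / √V) := sqrt_two_mul_div_le hV hN0.le
  have he := gaussCoeff_rec hV n
  have hep := gaussCoeff_pos hV (n + 2)
  rw [← hN] at he
  have key : N * |G (n + 2)| ≤ N * (D * (1 + 12 * (√N / √V)) * gaussCoeff V (n + 2)) := by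
    rw [← abs_of_pos hN0, ← abs_mul, hs, abs_of_pos hN0]
    calc _ ≤ V * |G n| + _ := by
          refine (abs_add_le _ _).trans ?_
          rw [abs_mul, abs_of_pos hV]
      _ ≤ V * (D * gaussCoeff V n) + 4 * V * D * r ^ 3 * gaussCoeff V (n + 2) :=
          add_le_add (mul_le_mul_of_nonneg_left (hG n (by omega)) hV.le) ht
      _ = N * (D * (1 + 8 * r) * gaussCoeff V (n + 2)) := by
          linear_combination (-D) * he + 4 * D * r * gaussCoeff V (n + 2) * hr
      _ ≤ _ := by
          have hD0 : 0 ≤ D := Real.exp_nonneg _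
          have : 8 * r ≤ 12 * (√N / √V) := by linarith
          gcongr
  refine (le_of_mul_le_mul_left key hN0).trans ?_
  gcongr
  calc _ ≤ D * Real.exp (12 * (√N / √V)) := by
        gcongr
        linarith [Real.add_one_le_exp (12 * (√N / √V))]
    _ = Real.exp (12 * (((n : ℝ) + 1) * √(n + 1) / √V) + 12 * (√N / √V)) := by
        rw [hD, Real.exp_add]
    _ ≤ _ := by
        push_cast
        rw [show (n : ℝ) + 1 + 1 = N by rw [hN]; ring, ← mul_add, ← add_div]
        gcongr
        have : √((n : ℝ) + 1) ≤ √N := Real.sqrt_le_sqrt (by linarith)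
        nlinarith [mul_le_mul_of_nonneg_left this (by positivity : 0 ≤ (n : ℝ) + 1)]

/-- In the range `k³ ≤ 2V` all coefficients are at most a constant times the Gaussian ones. -/
theorem MomentRecursion.abs_le_const_mul_gaussCoeff (h : MomentRecursion V G Λ) (hV : 0 < V)
    {k : ℕ} (hk : 8 * (k : ℝ) ≤ V) (hk3 : (k : ℝ) ^ 3 ≤ 2 * V)
    (n : ℕ) (hn : n ≤ k) : |G n| ≤ Real.exp 24 * gaussCoeff V n := by
  have hn' : (n : ℝ) ≤ k := by exact_mod_cast hn
  refine (h.abs_le_exp_mul_gaussCoeff hV n (by linarith)).trans ?_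
  have := (gaussCoeff_pos hV n).le
  gcongr
  have : (n : ℝ) * √n / √V ≤ 2 := by
    rw [div_le_iff₀ (by positivity)]
    calc (n : ℝ) * √n ≤ k * √k := by gcongr
      _ = √((k : ℝ) ^ 3) := by
        rw [show (k : ℝ) ^ 3 = k ^ 2 * k by ring, Real.sqrt_mul (by positivity),
          Real.sqrt_sq (by positivity)]
      _ ≤ √(2 ^ 2 * V) := Real.sqrt_le_sqrt (by linarith)
      _ = 2 * √V := by rw [Real.sqrt_mul (by positivity), Real.sqrt_sq (by norm_num)]
  linarith

/-- Odd coefficients are smaller than the interpolated Gaussian ones by `n^{3/2} / V^{1/2}`. -/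
theorem MomentRecursion.abs_le_of_odd (h : MomentRecursion V G Λ) (hV : 0 < V)
    {k : ℕ} (hk : 8 * (k : ℝ) ≤ V) (hk3 : (k : ℝ) ^ 3 ≤ 2 * V)
    (n : ℕ) (hn : n ≤ k) (ho : Odd n) :
    |G n| ≤ 6 * Real.exp 24 * (n * √n / √V) * gaussCoeff V n := by
  have hΛ := h.abs_coeff_le
  induction n using Nat.strong_induction_on with
  | _ n ih =>
  rcases n with _ | _ | n
  · simp at ho
  · rw [zero_add, h.one, abs_zero]
    have := (gaussCoeff_pos hV 1).le
    positivity
  have hk' : ((n + 2 : ℕ) : ℝ) ≤ k := by exact_mod_cast hn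
  push_cast at hk'
  set D := Real.exp 24
  have hD0 : 0 ≤ D := Real.exp_nonneg _
  have hG : ∀ i ≤ n + 1, |G i| ≤ D * gaussCoeff V i := fun i hi =>
    h.abs_le_const_mul_gaussCoeff hV hk hk3 i (by omega)
  have ht := abs_sum_tail_le hV hD0 hΛ (n := n + 1) (by push_cast; linarith) hG 2
  push_cast at ht
  have hs := h.split n
  have hi := ih n (by omega) (by omega) (by
    rw [Nat.odd_iff] at ho ⊢
    omega)
  push_cast
  rw [show (n : ℝ) + 1 + 1 = n + 2 by ring] at ht ⊢
  set N : ℝ := (n : ℝ) + 2 with hN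
  have hnN : (n : ℝ) = N - 2 := by rw [hN]; ring
  have hN0 : 2 ≤ N := by rw [hN]; linarith [Nat.cast_nonneg (α := ℝ) n]
  set r := √(2 * N / V)
  have hr : V * r ^ 2 = 2 * N := mul_sqrt_two_mul_div_sq hV (by linarith)
  have hr2 : r ≤ 3 / 2 * (√N / √V) := sqrt_two_mul_div_le hV (by linarith)
  have he := gaussCoeff_rec hV n
  have hep := gaussCoeff_pos hV (n + 2)
  rw [← hN] at he
  have hm := mul_sqrt_sub_two_le hN0
  have key : N * |G (n + 2)| ≤ N * (6 * D * (N * √N / √V) * gaussCoeff V (n + 2)) := by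
    rw [← abs_of_pos (by linarith : 0 < N), ← abs_mul, hs, abs_of_pos (by linarith : 0 < N)]
    calc _ ≤ V * |G n| + _ := by
          refine (abs_add_le _ _).trans ?_
          rw [abs_mul, abs_of_pos hV]
      _ ≤ V * (6 * D * (n * √n / √V) * gaussCoeff V n) + 4 * V * D * r ^ 3 * gaussCoeff V (n + 2) :=
          add_le_add (mul_le_mul_of_nonneg_left hi hV.le) ht
      _ = N * ((6 * D * (n * √n / √V) + D * (8 * r)) * gaussCoeff V (n + 2)) := by
          linear_combination (-(6 * D * (n * √n / √V))) * he + 4 * D * r * gaussCoeff V (n + 2) * hr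
      _ ≤ N * ((6 * D * (n * √n / √V) + D * (8 * (3 / 2 * (√N / √V)))) * gaussCoeff V (n + 2)) := by
          gcongr
      _ = N * ((6 * D * (((N - 2) * √(N - 2) + 2 * √N) / √V)) * gaussCoeff V (n + 2)) := by
          rw [hnN]; ring
      _ ≤ _ := by gcongr
  exact le_of_mul_le_mul_left key (by linarith)

/-- Even coefficients agree with the Gaussian ones up to a relative error `O(n³ / V)`. -/
theorem MomentRecursion.abs_sub_le_of_even (h : MomentRecursion V G Λ) (hV : 0 < V)
    {k : ℕ} (hk : 8 * (k : ℝ) ≤ V) (hk3 : (k : ℝ) ^ 3 ≤ 2 * V)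
    (n : ℕ) (hn : n ≤ k) (ho : Even n) :
    |G n - gaussCoeff V n| ≤ 28 * Real.exp 24 * ((n : ℝ) ^ 3 / V) * gaussCoeff V n := by
  have hΛ := h.abs_coeff_le
  induction n using Nat.strong_induction_on with
  | _ n ih =>
  rcases n with _ | _ | n
  · simp [h.zero, gaussCoeff_zero]
  · simp at ho
  have hk' : ((n + 2 : ℕ) : ℝ) ≤ k := by exact_mod_cast hn
  push_cast at hk'
  set D := Real.exp 24
  have hD0 : 0 ≤ D := Real.exp_nonneg _
  have hG : ∀ i ≤ n + 1, |G i| ≤ D * gaussCoeff V i := fun i hi =>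
    h.abs_le_const_mul_gaussCoeff hV hk hk3 i (by omega)
  have ht := abs_sum_tail_le hV hD0 hΛ (n := n + 1) (by push_cast; linarith) hG 3
  push_cast at ht
  have hs := h.split n
  have hi := ih n (by omega) (by omega) (by
    rw [Nat.even_iff] at ho ⊢
    omega)
  have he := gaussCoeff_rec hV n
  have hep := gaussCoeff_pos hV (n + 2)
  have hepn := gaussCoeff_pos hV n
  push_cast
  rw [show (n : ℝ) + 1 + 1 = n + 2 by ring] at ht ⊢
  set N : ℝ := (n : ℝ) + 2 with hN
  have hnN : (n : ℝ) = N - 2 := by rw [hN]; ring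
  have hN0 : 2 ≤ N := by rw [hN]; linarith [Nat.cast_nonneg (α := ℝ) n]
  have hNp : 0 < N := by linarith
  set r := √(2 * N / V)
  have hr0 : 0 ≤ r := Real.sqrt_nonneg _
  have hr : V * r ^ 2 = 2 * N := mul_sqrt_two_mul_div_sq hV (by linarith)
  have hr2 : r ≤ 3 / 2 * (√N / √V) := sqrt_two_mul_div_le hV hNp.le
  have hsN : √N ^ 2 = N := Real.sq_sqrt hNp.le
  have hsV : √V ^ 2 = V := Real.sq_sqrt hV.le
  have hsV0 : 0 < √V := Real.sqrt_pos.2 hV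
  -- The term with `Λ 2` involves an odd coefficient, hence gains a factor `n^{3/2} / V^{1/2}`; the
  -- terms with `j ≥ 3` are bounded trivially.
  have htwo : |∑ j ∈ Ico 2 (n + 2), Λ j * G (n + 1 - j)| ≤
      N * ((36 + 16) * D * (N ^ 2 / V) * gaussCoeff V (n + 2)) + 0 := by
    rw [add_zero]
    rcases Nat.eq_zero_or_pos n with rfl | hnpos
    · simp only [zero_add, Ico_self, sum_empty, abs_zero]
      positivity
    rw [sum_eq_sum_Ico_succ_bot (by omega)]
    refine (abs_add_le _ _).trans ?_
    have hoddb := h.abs_le_of_odd hV hk hk3 (n + 1 - 2) (by omega) (by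
      rw [Nat.even_iff] at ho
      rw [Nat.odd_iff]
      omega)
    have hle := gaussCoeff_le_pow hV (n + 1 - 2) 3
    rw [show n + 1 - 2 + 3 = n + 2 by omega] at hle
    replace hle : gaussCoeff V (n + 1 - 2) ≤ r ^ 3 * gaussCoeff V (n + 2) := by
      simpa only [Nat.cast_add, Nat.cast_ofNat] using hle
    have hep' := (gaussCoeff_pos hV (n + 1 - 2)).le
    have hm : ((n + 1 - 2 : ℕ) : ℝ) ≤ N := by
      rw [hN]
      have : (n + 1 - 2 : ℕ) ≤ n + 2 := by omega
      exact_mod_cast this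
    have hfirst : |Λ 2 * G (n + 1 - 2)| ≤ N * (36 * D * (N ^ 2 / V) * gaussCoeff V (n + 2)) := by
      rw [abs_mul]
      calc _ ≤ (2 * V) * (6 * D * (N * √N / √V) * (r ^ 3 * gaussCoeff V (n + 2))) := by
            refine mul_le_mul (hΛ 2) (hoddb.trans ?_) (abs_nonneg _) (by positivity)
            gcongr
        _ = 24 * D * N * (N * √N / √V) * r * gaussCoeff V (n + 2) := by
            linear_combination 12 * D * (N * √N / √V) * r * gaussCoeff V (n + 2) * hr
        _ ≤ 24 * D * N * (N * √N / √V) * (3 / 2 * (√N / √V)) * gaussCoeff V (n + 2) := by gcongr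
        _ = 36 * D * N * (N * √N ^ 2 / √V ^ 2) * gaussCoeff V (n + 2) := by
            field_simp; ring
        _ = _ := by rw [hsN, hsV]; ring
    have hrest : |∑ j ∈ Ico (2 + 1) (n + 2), Λ j * G (n + 1 - j)| ≤
        N * (16 * D * (N ^ 2 / V) * gaussCoeff V (n + 2)) := by
      refine ht.trans ?_
      have hr4 : V * r ^ (3 + 1) = 2 * N * (2 * N / V) := by
        have h' : r ^ 2 = 2 * N / V := by rw [eq_div_iff hV.ne']; linarith
        rw [show V * r ^ (3 + 1) = (V * r ^ 2) * r ^ 2 by ring, hr, h']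
      calc _ = 4 * D * (V * r ^ (3 + 1)) * gaussCoeff V (n + 2) := by ring
        _ = N * (16 * D * (N / V) * gaussCoeff V (n + 2)) := by rw [hr4]; ring
        _ ≤ _ := by
            gcongr
            nlinarith
    linarith
  have hcub : 28 * (N - 2) ^ 3 + 52 * N ^ 2 ≤ 28 * N ^ 3 := by nlinarith
  have key : N * |G (n + 2) - gaussCoeff V (n + 2)| ≤
      N * (28 * D * (N ^ 3 / V) * gaussCoeff V (n + 2)) := by
    rw [← abs_of_pos hNp, ← abs_mul, abs_of_pos hNp, mul_sub, hs, he]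
    calc _ = |V * (G n - gaussCoeff V n) + ∑ j ∈ Ico 2 (n + 2), Λ j * G (n + 1 - j)| := by
          congr 1; ring
      _ ≤ V * |G n - gaussCoeff V n| + _ := by
          refine (abs_add_le _ _).trans ?_
          rw [abs_mul, abs_of_pos hV]
      _ ≤ V * (28 * D * ((n : ℝ) ^ 3 / V) * gaussCoeff V n) +
          (N * ((36 + 16) * D * (N ^ 2 / V) * gaussCoeff V (n + 2)) + 0) :=
          add_le_add (mul_le_mul_of_nonneg_left hi hV.le) htwo
      _ = N * (D * ((28 * (N - 2) ^ 3 + 52 * N ^ 2) / V) * gaussCoeff V (n + 2)) := by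
          rw [← hnN]
          linear_combination (-(28 * D * ((n : ℝ) ^ 3 / V))) * he
      _ ≤ N * (D * ((28 * N ^ 3) / V) * gaussCoeff V (n + 2)) := by gcongr
      _ = _ := by ring
  exact le_of_mul_le_mul_left key hNp

/-- A crude bound, used when `V` is bounded. -/
theorem MomentRecursion.abs_le_pow (h : MomentRecursion V G Λ) (n : ℕ) :
    |G n| ≤ (2 * V + 1) ^ n := by
  induction n using Nat.strong_induction_on with
  | _ n ih =>
  rcases n with _ | n
  · simp [h.zero]
  have hn : (1 : ℝ) ≤ (n : ℝ) + 1 := by linarith [Nat.cast_nonneg (α := ℝ) n]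
  have hV := h.nonneg
  have hΛ := h.abs_coeff_le
  have h2 : |G (n + 1)| ≤ |((n : ℝ) + 1) * G (n + 1)| := by
    rw [abs_mul, abs_of_pos (by linarith : (0 : ℝ) < n + 1)]
    exact le_mul_of_one_le_left (abs_nonneg _) hn
  refine h2.trans ?_
  rw [h.succ]
  refine (abs_sum_le_sum_abs _ _).trans ?_
  calc _ ≤ ∑ j ∈ range (n + 1), 2 * V * (2 * V + 1) ^ (n - j) := by
        refine sum_le_sum fun j hj => ?_
        rw [abs_mul]
        exact mul_le_mul (hΛ j) (ih _ (by omega)) (abs_nonneg _) (by positivity)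
    _ = 2 * V * ∑ j ∈ range (n + 1), (2 * V + 1) ^ j := by
        rw [← mul_sum, ← sum_range_reflect]
        congr 1
        refine sum_congr rfl fun j hj => ?_
        have := mem_range.1 hj
        congr 1
        omega
    _ = (2 * V + 1) ^ (n + 1) - 1 := by
        have := mul_geom_sum (2 * V + 1) (n + 1)
        rwa [add_sub_cancel_right] at this
    _ ≤ _ := by linarith

end recursion

end QuadMoments

/-! ### The moment bounds in terms of `c k` -/

namespace QuadMoments

open Finset

theorem c_pos (k : ℕ) : 0 < c k :=
  div_pos (Real.Gamma_pos_of_pos (by positivity))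
    (mul_pos (by positivity) (Real.Gamma_pos_of_pos (by positivity)))

theorem c_zero : c 0 = 1 := by simp [c]

theorem factorial_mul_gaussCoeff {V : ℝ} (hV : 0 ≤ V) (k : ℕ) :
    k.factorial * gaussCoeff V k = c k * V ^ ((k : ℝ) / 2) := by
  rw [gaussCoeff, c, Real.Gamma_nat_eq_factorial, Real.div_rpow hV (by norm_num)]
  field_simp

/-- A solution of the moment recursion has moments close to those of a Gaussian of variance `σ²`, as
soon as `V` and `σ²` differ by a bounded amount. -/
theorem MomentRecursion.exists_bound {B : ℝ} (hB : 0 ≤ B) :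
    ∃ A : ℝ, 0 < A ∧ ∀ (V σ : ℝ) (G Λ : ℕ → ℝ), MomentRecursion V G Λ → 0 ≤ σ → V ≤ σ ^ 2 →
      σ ^ 2 ≤ V + B → ∀ k : ℕ, (k : ℝ) ≤ σ ^ (2 / 3 : ℝ) →
        (Even k → |k.factorial * G k - c k * σ ^ k| ≤ A * (c k * σ ^ k * ((k : ℝ) ^ 3 / σ ^ 2))) ∧
        (Odd k → |k.factorial * G k| ≤ A * (c k * σ ^ (k - 1) * (k : ℝ) ^ (3 / 2 : ℝ))) := by
  -- For `σ² ≥ S` the numbers `V` and `σ²` are comparable and `V ≥ 24`, so that `8 k ≤ V` follows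
  -- from `k³ ≤ σ²`. For `σ² < S` only finitely many `k` occur, and crude bounds suffice.
  set S : ℝ := 2 * B + 24 with hS
  set M : ℕ := ⌈S⌉₊
  set T : ℝ := M.factorial * (2 * S + 1) ^ M with hT
  set R : ℝ := ∑ j ∈ range (M + 1), 1 / c j with hR
  have hS0 : 0 < S := by positivity
  have hT0 : 0 < T := by positivity
  have hR0 : 0 ≤ R := sum_nonneg fun j _ => (one_div_pos.2 (c_pos j)).le
  refine ⟨56 * Real.exp 24 + B + S * (1 + T * R) + T * R, by positivity, ?_⟩
  intro V σ G Λ h hσ hVσ hσV k hk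
  rcases Nat.eq_zero_or_pos k with rfl | hkpos
  · simp [h.zero, c_zero]
  have hk1 : (1 : ℝ) ≤ k := by exact_mod_cast hkpos
  have hk3 : (k : ℝ) ^ 3 ≤ σ ^ 2 := by
    calc (k : ℝ) ^ 3 ≤ (σ ^ (2 / 3 : ℝ)) ^ 3 := by gcongr
      _ = σ ^ 2 := by
        rw [← Real.rpow_natCast, ← Real.rpow_mul hσ, ← Real.rpow_natCast]
        norm_num
  have hσ1 : 1 ≤ σ := by
    have : (1 : ℝ) ≤ k ^ 3 := one_le_pow₀ hk1
    nlinarith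
  have hσ2 : 0 < σ ^ 2 := by positivity
  have hV0 := h.nonneg
  have hc := c_pos k
  have hk32 : (k : ℝ) ^ (3 / 2 : ℝ) = k * √k := by
    rw [show (3 / 2 : ℝ) = 1 + 1 / 2 by norm_num, Real.rpow_add (by linarith), Real.rpow_one,
      Real.sqrt_eq_rpow]
  have hmain : 0 ≤ c k * σ ^ k * ((k : ℝ) ^ 3 / σ ^ 2) := by positivity
  have hmain' : 0 ≤ c k * σ ^ (k - 1) * (k : ℝ) ^ (3 / 2 : ℝ) := by positivity
  rcases le_or_gt S (σ ^ 2) with hlarge | hsmall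
  · have hV24 : 24 ≤ V := by linarith
    have hV : 0 < V := by linarith
    have hV2 : σ ^ 2 ≤ 2 * V := by linarith
    have h3 : (k : ℝ) ^ 3 ≤ 2 * V := by linarith
    have h8 : 8 * (k : ℝ) ≤ V := by
      rcases le_or_gt k 3 with h | h
      · have : (k : ℝ) ≤ 3 := by exact_mod_cast h
        linarith
      · have : (4 : ℝ) ≤ k := by exact_mod_cast h
        nlinarith [mul_le_mul this this (by norm_num) (by linarith)]
    constructor
    · intro he
      -- Compare with a Gaussian of variance `V`, then replace `V` by `σ²` using Bernoulli's
      -- inequality.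
      have hb := h.abs_sub_le_of_even hV h8 h3 k le_rfl he
      obtain ⟨m, hm⟩ := he
      have hkm : (k : ℝ) / 2 = m := by rw [hm]; push_cast; ring
      have hσk : σ ^ k = (σ ^ 2) ^ m := by rw [← pow_mul, hm, two_mul]
      have hg := factorial_mul_gaussCoeff hV0 k
      rw [hkm, Real.rpow_natCast] at hg
      have hVm : V ^ m ≤ (σ ^ 2) ^ m := by gcongr
      have h1 : |k.factorial * G k - c k * V ^ m| ≤
          56 * Real.exp 24 * (c k * σ ^ k * ((k : ℝ) ^ 3 / σ ^ 2)) := by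
        rw [← hg, ← mul_sub, abs_mul, Nat.abs_cast]
        calc _ ≤ (k.factorial : ℝ) * (28 * Real.exp 24 * ((k : ℝ) ^ 3 / V) * gaussCoeff V k) := by
              gcongr
          _ = 28 * Real.exp 24 * ((k : ℝ) ^ 3 / V) * (c k * V ^ m) := by rw [← hg]; ring
          _ ≤ 28 * Real.exp 24 * ((k : ℝ) ^ 3 / (σ ^ 2 / 2)) * (c k * σ ^ k) := by
              rw [hσk]
              gcongr
              linarith
          _ = _ := by field_simp; ring
      have h2 : |c k * V ^ m - c k * σ ^ k| ≤ B * (c k * σ ^ k * ((k : ℝ) ^ 3 / σ ^ 2)) := by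
        rw [← mul_sub, abs_mul, abs_of_pos hc, hσk, abs_sub_comm, abs_of_nonneg (by linarith)]
        have hbern := one_add_mul_le_pow (a := V / σ ^ 2 - 1) (by
          have : 0 ≤ V / σ ^ 2 := by positivity
          linarith) m
        rw [add_sub_cancel, div_pow] at hbern
        have hq : 1 - V / σ ^ 2 ≤ B / σ ^ 2 := by
          rw [one_sub_div hσ2.ne']
          gcongr
          linarith
        have hq0 : 0 ≤ 1 - V / σ ^ 2 := by
          rw [sub_nonneg, div_le_one hσ2]
          exact hVσ
        have hmk : (m : ℝ) ≤ (k : ℝ) ^ 3 := by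
          have : (m : ℝ) ≤ k := by rw [← hkm]; linarith
          have : (k : ℝ) ≤ k ^ 3 := le_self_pow₀ hk1 (by norm_num)
          linarith
        have h5 : (σ ^ 2) ^ m - V ^ m ≤ (σ ^ 2) ^ m * ((k : ℝ) ^ 3 * (B / σ ^ 2)) := by
          have hp : 0 < (σ ^ 2) ^ m := by positivity
          have e : (σ ^ 2) ^ m - V ^ m = (σ ^ 2) ^ m * (1 - V ^ m / (σ ^ 2) ^ m) := by
            field_simp
          rw [e]
          gcongr
          calc _ ≤ (m : ℝ) * (1 - V / σ ^ 2) := by linarith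
            _ ≤ _ := by gcongr
        calc _ ≤ c k * ((σ ^ 2) ^ m * ((k : ℝ) ^ 3 * (B / σ ^ 2))) := by gcongr
          _ = _ := by ring
      calc _ = |(k.factorial * G k - c k * V ^ m) + (c k * V ^ m - c k * σ ^ k)| := by congr 1; ring
        _ ≤ _ := abs_add_le _ _
        _ ≤ _ := add_le_add h1 h2
        _ = (56 * Real.exp 24 + B) * (c k * σ ^ k * ((k : ℝ) ^ 3 / σ ^ 2)) := by ring
        _ ≤ _ := by
          refine mul_le_mul_of_nonneg_right ?_ hmain
          have : 0 ≤ S * (1 + T * R) + T * R := by positivity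
          linarith
    · intro ho
      have hb := h.abs_le_of_odd hV h8 h3 k le_rfl ho
      obtain ⟨m, hm⟩ := ho
      have hkm : (k : ℝ) / 2 = m + 1 / 2 := by rw [hm]; push_cast; ring
      have hg := factorial_mul_gaussCoeff hV0 k
      rw [hkm, Real.rpow_add hV, Real.rpow_natCast, ← Real.sqrt_eq_rpow] at hg
      have hσk : σ ^ (k - 1) = (σ ^ 2) ^ m := by rw [← pow_mul, hm, Nat.add_sub_cancel]
      have hVm : V ^ m ≤ (σ ^ 2) ^ m := by gcongr
      have hsV : 0 < √V := Real.sqrt_pos.2 hV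
      rw [abs_mul, Nat.abs_cast]
      calc _ ≤ (k.factorial : ℝ) * (6 * Real.exp 24 * (k * √k / √V) * gaussCoeff V k) := by
            gcongr
        _ = 6 * Real.exp 24 * (k * √k / √V) * (c k * (V ^ m * √V)) := by rw [← hg]; ring
        _ = 6 * Real.exp 24 * (c k * V ^ m * (k * √k)) := by field_simp
        _ ≤ 6 * Real.exp 24 * (c k * σ ^ (k - 1) * (k : ℝ) ^ (3 / 2 : ℝ)) := by
            rw [hσk, hk32]
            gcongr
        _ ≤ _ := by
            gcongr
            have : 0 ≤ S * (1 + T * R) + T * R := by positivity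
            have := Real.exp_nonneg 24
            linarith
  · have hkM : k ≤ M := by
      have : (k : ℝ) ≤ k ^ 3 := le_self_pow₀ hk1 (by norm_num)
      have : (k : ℝ) ≤ M := by
        linarith [Nat.le_ceil S]
      exact_mod_cast this
    have hTb : |k.factorial * G k| ≤ T := by
      rw [abs_mul, Nat.abs_cast, hT]
      have h1 : (1 : ℝ) ≤ 2 * V + 1 := by linarith
      have h2 : 2 * V + 1 ≤ 2 * S + 1 := by linarith
      have h4 : |G k| ≤ (2 * S + 1) ^ M := by
        calc _ ≤ (2 * V + 1) ^ k := h.abs_le_pow k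
          _ ≤ (2 * V + 1) ^ M := pow_le_pow_right₀ h1 hkM
          _ ≤ _ := by gcongr
      have h5 : (k.factorial : ℝ) ≤ M.factorial := by exact_mod_cast Nat.factorial_le hkM
      gcongr
    have hcR : 1 ≤ c k * R := by
      have : 1 / c k ≤ R := single_le_sum (f := fun j => 1 / c j)
        (fun j _ => (one_div_pos.2 (c_pos j)).le) (mem_range.2 (by omega))
      rwa [div_le_iff₀ hc, mul_comm] at this
    have hk31 : (1 : ℝ) ≤ k ^ 3 := one_le_pow₀ hk1
    constructor
    · intro _
      have h1 : c k * σ ^ k ≤ S * (c k * σ ^ k * ((k : ℝ) ^ 3 / σ ^ 2)) := by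
        have : 1 ≤ S * ((k : ℝ) ^ 3 / σ ^ 2) := by
          rw [← mul_div_assoc, le_div_iff₀ hσ2]
          nlinarith
        calc _ = c k * σ ^ k * 1 := (mul_one _).symm
          _ ≤ c k * σ ^ k * (S * ((k : ℝ) ^ 3 / σ ^ 2)) := by gcongr
          _ = _ := by ring
      have h2 : T ≤ T * R * (c k * σ ^ k) := by
        have : (1 : ℝ) ≤ σ ^ k := one_le_pow₀ hσ1
        calc T = T * (1 * 1) := by ring
          _ ≤ T * ((c k * R) * σ ^ k) := by gcongr
          _ = _ := by ring
      calc _ ≤ |k.factorial * G k| + |c k * σ ^ k| := abs_sub _ _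
        _ ≤ T + c k * σ ^ k := add_le_add hTb (abs_of_pos (by positivity)).le
        _ ≤ (1 + T * R) * (c k * σ ^ k) := by linarith
        _ ≤ (1 + T * R) * (S * (c k * σ ^ k * ((k : ℝ) ^ 3 / σ ^ 2))) := by gcongr
        _ = (S * (1 + T * R)) * (c k * σ ^ k * ((k : ℝ) ^ 3 / σ ^ 2)) := by ring
        _ ≤ _ := by
          gcongr
          have : 0 ≤ T * R := by positivity
          have := Real.exp_nonneg 24
          linarith
    · intro _
      have h1 : (1 : ℝ) ≤ σ ^ (k - 1) := one_le_pow₀ hσ1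
      have h2 : (1 : ℝ) ≤ (k : ℝ) ^ (3 / 2 : ℝ) := Real.one_le_rpow hk1 (by norm_num)
      calc _ ≤ T := hTb
        _ = T * (1 * 1 * 1) := by ring
        _ ≤ T * ((c k * R) * σ ^ (k - 1) * (k : ℝ) ^ (3 / 2 : ℝ)) := by gcongr
        _ = T * R * (c k * σ ^ (k - 1) * (k : ℝ) ^ (3 / 2 : ℝ)) := by ring
        _ ≤ _ := by
          gcongr
          have : 0 ≤ S * (1 + T * R) := by positivity
          have := Real.exp_nonneg 24
          linarith

end QuadMoments

/-! ### Lattice points in dilates of a bounded set -/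

namespace QuadMoments

open MeasureTheory Bornology Submodule ZLattice Module

section lattice

variable {E : Type*} [NormedAddCommGroup E] [NormedSpace ℝ E] [FiniteDimensional ℝ E]
  [MeasurableSpace E] [BorelSpace E] (μ : Measure E) [μ.IsAddHaarMeasure]
  (L : Submodule ℤ E) [DiscreteTopology L] [IsZLattice ℝ L]

/-- The number of lattice points of a bounded set `T` is its volume over the covolume, up to the
volume of any set `N` containing all points near the boundary of `T`: the translates of a
fundamental domain by the lattice points of `T` cover `T` and are covered by `T`, up to `N`. -/
theorem exists_abs_covolume_mul_ncard_sub_le :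
    ∃ R : ℝ, 0 < R ∧ ∀ T N : Set E, IsBounded T → MeasurableSet T → MeasurableSet N → μ N ≠ ⊤ →
      (∀ x y, ‖x - y‖ ≤ R → x ∈ T → y ∉ T → x ∈ N ∧ y ∈ N) →
      |covolume L μ * (T ∩ L).ncard - μ.real T| ≤ μ.real N := by
  classical
  have : Module.Free ℤ L := ZLattice.module_free ℝ L
  have : Module.Finite ℤ L := ZLattice.module_finite ℝ L
  let b := (Module.Free.chooseBasis ℤ L).ofZLatticeBasis ℝ L
  have hspan : span ℤ (Set.range b) = L := Basis.ofZLatticeBasis_span ..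
  set D := ZSpan.fundamentalDomain b with hD
  have hDm : MeasurableSet D := ZSpan.fundamentalDomain_measurableSet b
  have hDc : covolume L μ = μ.real D := covolume_eq_measure_fundamentalDomain L μ
    (ZLattice.isAddFundamentalDomain _ μ)
  obtain ⟨R, hR0, hR⟩ : ∃ R : ℝ, 0 < R ∧ ∀ x ∈ D, ‖x‖ ≤ R := by
    obtain ⟨R, hR⟩ := (ZSpan.fundamentalDomain_isBounded b).exists_norm_le
    exact ⟨max R 1, by positivity, fun x hx => (hR x hx).trans (le_max_left _ _)⟩
  refine ⟨R, hR0, fun T N hTb hT hN hNfin hTN => ?_⟩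
  have hfin : (T ∩ L).Finite := by
    have := ZSpan.setFinite_inter b hTb
    rw [hspan] at this
    exact this
  set U : Set E := ⋃ l ∈ hfin.toFinset, (fun x => l + x) '' D with hU
  have hdecomp : ∀ x : E, ∃ l ∈ L, ∃ d ∈ D, x = l + d := fun x =>
    ⟨ZSpan.floor b x, hspan.le (ZSpan.floor b x).2, ZSpan.fract b x,
      ZSpan.fract_mem_fundamentalDomain b x, by rw [ZSpan.fract_apply]; abel⟩
  have huniq : ∀ l ∈ L, ∀ l' ∈ L, ∀ d ∈ D, ∀ d' ∈ D, l + d = l' + d' → l = l' := by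
    intro l hl l' hl' d hd d' hd' h
    have h1 := ZSpan.fract_zSpan_add b d (v := l) (by rwa [hspan])
    have h2 := ZSpan.fract_zSpan_add b d' (v := l') (by rwa [hspan])
    rw [h, h2, ZSpan.fract_eq_self.2 hd, ZSpan.fract_eq_self.2 hd'] at h1
    rw [h1] at h
    exact add_right_cancel h
  have hmemU : ∀ x, x ∈ U ↔ ∃ l, (l ∈ T ∧ l ∈ L) ∧ ∃ d ∈ D, l + d = x := by
    intro x
    simp only [hU, Set.mem_iUnion, Set.Finite.mem_toFinset, Set.mem_inter_iff, SetLike.mem_coe,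
      Set.mem_image, exists_prop]
  have hmeas : ∀ l : E, MeasurableSet ((fun x => l + x) '' D) := fun l =>
    (MeasurableEquiv.addLeft l).measurableSet_image.2 hDm
  have hDfin : μ D ≠ ⊤ := (ZSpan.fundamentalDomain_isBounded b).measure_lt_top.ne
  have hTfin : μ T ≠ ⊤ := hTb.measure_lt_top.ne
  have hlfin : ∀ l : E, μ ((fun x => l + x) '' D) ≠ ⊤ := by
    intro l
    rw [Set.image_add_left, measure_preimage_add]
    exact hDfin
  have hUvol : μ.real U = covolume L μ * (T ∩ L).ncard := by
    rw [hU, measureReal_biUnion_finset (h := fun l _ => hlfin l)]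
    · have : ∀ l : E, μ.real ((fun x => l + x) '' D) = μ.real D := by
        intro l
        rw [Set.image_add_left, measureReal_def, measure_preimage_add, measureReal_def]
      simp_rw [this]
      rw [Finset.sum_const, nsmul_eq_mul, Set.ncard_eq_toFinset_card _ hfin, hDc, mul_comm]
    · intro l hl l' hl' hne
      rw [Function.onFun, Set.disjoint_left]
      rintro _ ⟨d, hd, rfl⟩ ⟨d', hd', h⟩
      have hl := hfin.mem_toFinset.1 hl
      have hl' := hfin.mem_toFinset.1 hl'
      exact hne (huniq l hl.2 l' hl'.2 d hd d' hd' h.symm)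
    · exact fun l _ => hmeas l
  have hUfin : μ U ≠ ⊤ := by
    exact (measure_biUnion_lt_top hfin.toFinset.finite_toSet fun l _ => (hlfin l).lt_top).ne
  have h1 : U ⊆ T ∪ N := by
    intro x hx
    obtain ⟨l, ⟨hlT, _⟩, d, hd, rfl⟩ := (hmemU x).1 hx
    by_cases h : l + d ∈ T
    · exact Or.inl h
    · refine Or.inr (hTN l (l + d) ?_ hlT h).2
      rw [sub_add_cancel_left, norm_neg]
      exact hR d hd
  have h2 : T ⊆ U ∪ N := by
    intro x hx
    obtain ⟨l, hl, d, hd, rfl⟩ := hdecomp x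
    by_cases h : l ∈ T
    · exact Or.inl ((hmemU _).2 ⟨l, ⟨h, hl⟩, d, hd, rfl⟩)
    · refine Or.inr (hTN (l + d) l ?_ hx h).1
      rw [add_sub_cancel_left]
      exact hR d hd
  rw [← hUvol, abs_le]
  have e1 := (measureReal_mono h1 (measure_union_ne_top hTfin hNfin)).trans (measureReal_union_le T
      N)
  have e2 := (measureReal_mono h2 (measure_union_ne_top hUfin hNfin)).trans (measureReal_union_le U
      N)
  constructor <;> linarith

open scoped Pointwise in
/-- Lattice points in large dilates of a set whose boundary has small neighbourhoods, with a power
saving in the error term. -/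
theorem exists_abs_covolume_mul_ncard_smul_sub_le {F : Set E} (hF : IsBounded F)
    (hFm : MeasurableSet F) {B : ℝ}
    (hbd : ∀ ε : ℝ, 0 < ε → ε ≤ 1 → ∃ N : Set E, MeasurableSet N ∧ μ N ≠ ⊤ ∧ μ.real N ≤ B * √ε ∧
      ∀ x y, ‖x - y‖ ≤ ε → x ∈ F → y ∉ F → x ∈ N ∧ y ∈ N) :
    ∃ R : ℝ, 0 < R ∧ ∀ t : ℝ, R ≤ t →
      |covolume L μ * ((t • F) ∩ (L : Set E)).ncard - t ^ finrank ℝ E * μ.real F|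
        ≤ t ^ finrank ℝ E * (B * √(R / t)) := by
  obtain ⟨R, hR0, hR⟩ := exists_abs_covolume_mul_ncard_sub_le μ L
  refine ⟨R, hR0, fun t ht => ?_⟩
  have ht0 : 0 < t := hR0.trans_le ht
  obtain ⟨N, hNm, hNfin, hNB, hN⟩ := hbd (R / t) (by positivity) ((div_le_one ht0).2 ht)
  have hvol : ∀ S : Set E, μ.real (t • S) = t ^ finrank ℝ E * μ.real S := by
    intro S
    rw [measureReal_def, Measure.addHaar_smul, ENNReal.toReal_mul, ENNReal.toReal_ofReal (abs_nonneg
        _),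
      abs_of_nonneg (by positivity), measureReal_def]
  have h := hR (t • F) (t • N) (hF.smul₀ t) (hFm.const_smul₀ t) (hNm.const_smul₀ t) ?_ ?_
  · rw [hvol, hvol] at h
    exact h.trans (by gcongr)
  · rw [Measure.addHaar_smul]
    exact ENNReal.mul_ne_top ENNReal.ofReal_ne_top hNfin
  · intro x y hxy hx hy
    rw [Set.mem_smul_set_iff_inv_smul_mem₀ ht0.ne'] at hx hy ⊢
    rw [Set.mem_smul_set_iff_inv_smul_mem₀ ht0.ne']
    refine hN _ _ ?_ hx hy
    rw [← smul_sub, norm_smul, norm_inv, Real.norm_of_nonneg ht0.le, div_eq_inv_mul]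
    gcongr

end lattice

end QuadMoments

/-! ### The boundary of the norm-one body -/

namespace QuadMoments

open NumberField.InfinitePlace NumberField.mixedEmbedding NumberField.mixedEmbedding.fundamentalCone
  MeasureTheory Bornology
open NumberField.Units.dirichletUnitTheorem (w₀)

section boundary

open scoped Classical

variable {K : Type*} [Field K] [NumberField K]

theorem normAtPlace_le_norm (w : InfinitePlace K) (x : mixedSpace K) : normAtPlace w x ≤ ‖x‖ := by
  rw [norm_eq_sup'_normAtPlace]
  exact Finset.le_sup' (fun w => normAtPlace w x) (Finset.mem_univ w)

theorem abs_normAtPlace_sub_le (w : InfinitePlace K) (x y : mixedSpace K) :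
    |normAtPlace w x - normAtPlace w y| ≤ ‖x - y‖ := by
  have h1 := normAtPlace_add_le w (x - y) y
  have h2 := normAtPlace_add_le w (y - x) x
  rw [sub_add_cancel] at h1 h2
  have h3 := normAtPlace_le_norm w (x - y)
  have h4 := normAtPlace_le_norm w (y - x)
  rw [norm_sub_rev] at h4
  rw [abs_le]
  constructor <;> linarith

/-- Bounded points of the mixed space with a small coordinate. -/
def smallSet (w : InfinitePlace K) (R η : ℝ) : Set (mixedSpace K) :=
  {x | normAtPlace w x < η ∧ ∀ w', normAtPlace w' x < R}

theorem measurableSet_smallSet (w : InfinitePlace K) (R η : ℝ) :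
    MeasurableSet (smallSet w R η) := by
  have h : IsOpen (smallSet w R η) := by
    simp only [smallSet, Set.ofPred_and, Set.ofPred_forall]
    exact (isOpen_lt (continuous_normAtPlace w) continuous_const).inter
      (isOpen_iInter_of_finite fun w' => isOpen_lt (continuous_normAtPlace w') continuous_const)
  exact h.measurableSet

variable (K) in
theorem exists_volume_smallSet_le {R : ℝ} (hR : 1 ≤ R) : ∃ B : ℝ, 0 ≤ B ∧
    ∀ (w : InfinitePlace K) (η : ℝ), 0 < η → η ≤ R →
      volume (smallSet w R η) ≤ ENNReal.ofReal (B * η) := by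
  refine ⟨convexBodyLTFactor K * ∏ w : InfinitePlace K, R ^ w.mult, by positivity, ?_⟩
  intro w η hη hηR
  let f : InfinitePlace K → NNReal := fun w' => if w' = w then η.toNNReal else R.toNNReal
  have hsub : smallSet w R η ⊆ convexBodyLT K f := by
    rintro x ⟨h1, h2⟩
    have h3 : ∀ w', normAtPlace w' x < f w' := by
      intro w'
      by_cases h : w' = w
      · simp only [f, if_pos h, Real.coe_toNNReal _ hη.le]
        rwa [h]
      · simp only [f, if_neg h, Real.coe_toNNReal _ (by linarith : 0 ≤ R)]
        exact h2 w'
    refine ⟨fun w' _ => ?_, fun w' _ => ?_⟩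
    · have := h3 w'.1
      rw [normAtPlace_apply_of_isReal w'.2] at this
      rwa [mem_ball_zero_iff]
    · have := h3 w'.1
      rw [normAtPlace_apply_of_isComplex w'.2] at this
      rwa [mem_ball_zero_iff]
  refine (measure_mono hsub).trans ?_
  rw [convexBodyLT_volume]
  have hprod : ∏ w', ((f w' : NNReal) : ℝ) ^ (mult w') ≤ (∏ w : InfinitePlace K, R ^ w.mult) * η :=
      by
    calc _ ≤ ∏ w', (R ^ (mult w') * if w' = w then η else 1) := by
          refine Finset.prod_le_prod (fun _ _ => by positivity) fun w' _ => ?_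
          by_cases h : w' = w
          · simp only [f, if_pos h, Real.coe_toNNReal _ hη.le]
            obtain ⟨j, hj⟩ : ∃ j, mult w' = j + 1 :=
              ⟨mult w' - 1, by have := mult_pos (w := w'); omega⟩
            rw [hj, pow_succ]
            gcongr
            calc η ^ j ≤ R ^ j := by gcongr
              _ ≤ R ^ (j + 1) := pow_le_pow_right₀ hR (by omega)
          · simp only [f, if_neg h, Real.coe_toNNReal _ (by linarith : 0 ≤ R), mul_one]
            exact le_rfl
      _ = _ := by rw [Finset.prod_mul_distrib, Finset.prod_ite_eq' Finset.univ w, if_pos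
          (Finset.mem_univ w)]
  have hcast : ((convexBodyLTFactor K : NNReal) : ENNReal) * ∏ w', (f w' : ENNReal) ^ (mult w')
      = ENNReal.ofReal ((convexBodyLTFactor K : ℝ) * ∏ w', ((f w' : NNReal) : ℝ) ^ (mult w')) := by
    have : (convexBodyLTFactor K : ℝ) * ∏ w', ((f w' : NNReal) : ℝ) ^ (mult w')
        = ((convexBodyLTFactor K * ∏ w', (f w') ^ (mult w') : NNReal) : ℝ) := by
      push_cast
      rfl
    rw [this, ENNReal.ofReal_coe_nnreal]
    push_cast
    rfl
  have hcast' : (convexBodyLTFactor K : ENNReal) = ((convexBodyLTFactor K : NNReal) : ENNReal) :=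
      rfl
  refine le_trans (le_of_eq ?_) (ENNReal.ofReal_le_ofReal
    (mul_le_mul_of_nonneg_left hprod (convexBodyLTFactor K).coe_nonneg |>.trans_eq (mul_assoc _ _
        _).symm))
  rw [← hcast]
  push_cast
  rfl

/-- The part of a neighbourhood of the boundary of `paramSet K` where the coordinate at `w` is close
to `0` or `1`. The coordinate at `w₀` is bounded above only, like that of `paramSet K`. -/
def slab (w : InfinitePlace K) (M η : ℝ) : Set (realSpace K) :=
  Set.univ.pi fun w' => (if w' = w₀ then Set.Iic M else Set.Icc (-M) M) ∩
    (if w' = w then Set.Icc (-η) η ∪ Set.Icc (1 - η) (1 + η) else Set.univ)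

theorem measurableSet_slab (w : InfinitePlace K) (M η : ℝ) : MeasurableSet (slab w M η) := by
  refine MeasurableSet.univ_pi fun w' => MeasurableSet.inter ?_ ?_
  · split_ifs
    · exact measurableSet_Iic
    · exact measurableSet_Icc
  · split_ifs
    · exact measurableSet_Icc.union measurableSet_Icc
    · exact MeasurableSet.univ

variable (K) in
theorem exists_setLIntegral_slab_le {M : ℝ} (hM : 0 ≤ M) : ∃ B : ℝ, 0 ≤ B ∧
    ∀ (w : InfinitePlace K) (η : ℝ), 0 < η →
      ∫⁻ x in slab w M η, ENNReal.ofReal (Real.exp (x w₀ * Module.finrank ℚ K))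
        ≤ ENNReal.ofReal (B * η) := by
  set n := Module.finrank ℚ K
  have hn : (0 : ℝ) < n := Nat.cast_pos.2 Module.finrank_pos
  set A : ℝ := (∫ t in Set.Iic M, Real.exp (t * n)) + 2 * M + 4 * Real.exp (M * n) + 4 with hA
  have hI0 : 0 ≤ ∫ t in Set.Iic M, Real.exp (t * n) := integral_nonneg fun t => (Real.exp_pos _).le
  have hE0 := Real.exp_pos (M * n)
  have hA0 : 0 ≤ A := by positivity
  refine ⟨∏ _w : InfinitePlace K, A, Finset.prod_nonneg fun _ _ => hA0, ?_⟩
  intro w η hη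
  let φ : InfinitePlace K → ℝ → ℝ := fun w' t => if w' = w₀ then Real.exp (t * n) else 1
  have hφ0 : ∀ w' t, 0 ≤ φ w' t := by
    intro w' t
    simp only [φ]
    split_ifs <;> positivity
  set base : InfinitePlace K → Set ℝ := fun w' => if w' = w₀ then Set.Iic M else Set.Icc (-M) M
  set s : InfinitePlace K → Set ℝ := fun w' => base w' ∩
    (if w' = w then Set.Icc (-η) η ∪ Set.Icc (1 - η) (1 + η) else Set.univ) with hs
  have hexpint : IntegrableOn (fun t : ℝ => Real.exp (t * n)) (Set.Iic M) := by
    simp_rw [mul_comm _ (n : ℝ)]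
    exact integrableOn_exp_mul_Iic hn M
  have hbaseint : ∀ w', IntegrableOn (φ w') (base w') := by
    intro w'
    by_cases h : w' = w₀
    · simp only [φ, base, if_pos h]
      exact hexpint
    · simp only [φ, base, if_neg h]
      exact integrableOn_const (by simp)
  have hint : ∀ w', IntegrableOn (φ w') (s w') := fun w' => (hbaseint w').mono_set
      Set.inter_subset_left
  have hbase : ∀ w', ∫ t in base w', φ w' t ≤ A := by
    intro w'
    by_cases h : w' = w₀
    · simp only [φ, base, if_pos h]
      linarith
    · simp only [φ, base, if_neg h]
      simp only [integral_const, MeasurableSet.univ, measureReal_restrict_apply, Set.univ_inter,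
        Real.volume_real_Icc, smul_eq_mul, mul_one]
      rw [max_eq_left (by linarith)]
      linarith
  have hJ : volume (Set.Icc (-η) η ∪ Set.Icc (1 - η) (1 + η)) ≤ ENNReal.ofReal (4 * η) := by
    refine (measure_union_le _ _).trans ?_
    rw [Real.volume_Icc, Real.volume_Icc, ← ENNReal.ofReal_add (by linarith) (by linarith)]
    refine ENNReal.ofReal_le_ofReal (by linarith)
  have hfac : ∀ w', ∫ t in s w', φ w' t ≤ A * (if w' = w then η else 1) := by
    intro w'
    by_cases h : w' = w
    · rw [if_pos h]
      have hsb : ∀ t ∈ s w', φ w' t ≤ Real.exp (M * n) + 1 := by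
        intro t ht
        simp only [φ]
        split_ifs with h0
        · have := ht.1
          simp only [base, if_pos h0, Set.mem_Iic] at this
          have : Real.exp (t * n) ≤ Real.exp (M * n) := by gcongr
          linarith
        · linarith
      have hsv : volume (s w') ≤ ENNReal.ofReal (4 * η) := by
        refine (measure_mono ?_).trans hJ
        simp only [hs, if_pos h]
        exact Set.inter_subset_right
      have hsfin : volume (s w') < ⊤ := hsv.trans_lt ENNReal.ofReal_lt_top
      have hnorm := norm_setIntegral_le_of_norm_le_const (C := Real.exp (M * n) + 1) (f := φ w')
          hsfin
        (fun t ht => by rw [Real.norm_of_nonneg (hφ0 _ _)]; exact hsb t ht)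
      have hreal : volume.real (s w') ≤ 4 * η := ENNReal.toReal_le_of_le_ofReal (by linarith) hsv
      calc _ ≤ ‖∫ t in s w', φ w' t‖ := Real.le_norm_self _
        _ ≤ (Real.exp (M * n) + 1) * volume.real (s w') := hnorm
        _ ≤ (Real.exp (M * n) + 1) * (4 * η) := by gcongr
        _ ≤ A * η := by
          rw [hA]
          nlinarith
    · rw [if_neg h, mul_one]
      refine le_trans ?_ (hbase w')
      exact setIntegral_mono_set (hbaseint w') (Filter.Eventually.of_forall fun t => hφ0 _ _)
        (Filter.Eventually.of_forall Set.inter_subset_left)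
  have hslab : (volume : Measure (realSpace K)).restrict (slab w M η)
      = Measure.pi fun w' => volume.restrict (s w') := by
    rw [slab, volume_pi, Measure.restrict_pi_pi]
  have hprodφ : ∀ x : realSpace K, Real.exp (x w₀ * n) = ∏ w', φ w' (x w') := by
    intro x
    rw [Finset.prod_eq_single w₀]
    · simp [φ]
    · intro b _ hb
      simp [φ, hb]
    · simp
  rw [hslab]
  simp_rw [hprodφ]
  rw [← ofReal_integral_eq_lintegral_ofReal (Integrable.fintype_prod hint)
    (Filter.Eventually.of_forall fun x => Finset.prod_nonneg fun w' _ => hφ0 _ _),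
    integral_fintype_prod_eq_prod]
  refine ENNReal.ofReal_le_ofReal ?_
  calc _ ≤ ∏ w', (A * (if w' = w then η else 1)) :=
        Finset.prod_le_prod (fun w' _ => integral_nonneg fun t => hφ0 _ _) fun w' _ => hfac w'
    _ = _ := by
        rw [Finset.prod_mul_distrib, Finset.prod_ite_eq' Finset.univ w, if_pos (Finset.mem_univ w)]

theorem measurableSet_preimage_expMapBasis_image {s : Set (realSpace K)} (hs : MeasurableSet s) :
    MeasurableSet (normAtAllPlaces ⁻¹' (expMapBasis '' s) : Set (mixedSpace K)) := by
  refine MeasurableSet.preimage ?_ (continuous_normAtAllPlaces K).measurable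
  exact MeasurableSet.image_of_continuousOn_injOn hs (continuous_expMapBasis K).continuousOn
    (injective_expMapBasis K).injOn

/-- The volume of a set given in logarithmic coordinates, with density `exp (n x_{w₀})`. -/
theorem volume_preimage_expMapBasis_image {s : Set (realSpace K)} (hs : MeasurableSet s) :
    volume (normAtAllPlaces ⁻¹' (expMapBasis '' s) : Set (mixedSpace K)) =
      2 ^ nrRealPlaces K * ENNReal.ofReal (2 * Real.pi) ^ nrComplexPlaces K *
        ((2 : ENNReal)⁻¹ ^ nrComplexPlaces K * ENNReal.ofReal (Units.regulator K) *
          (Module.finrank ℚ K) *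
        ∫⁻ x in s, ENNReal.ofReal (Real.exp (x w₀ * Module.finrank ℚ K))) := by
  rw [volume_eq_two_pow_mul_two_pi_pow_mul_integral Set.preimage_image_preimage
    (measurableSet_preimage_expMapBasis_image hs), normAtAllPlaces_image_preimage_expMapBasis,
    setLIntegral_expMapBasis_image hs (by fun_prop)]
  simp_rw [ENNReal.inv_mul_cancel_right
    (Finset.prod_ne_zero_iff.mpr fun _ _ ↦ ENNReal.ofReal_ne_zero_iff.mpr (expMapBasis_pos _ _))
    (ENNReal.prod_ne_top fun _ _ ↦ ENNReal.ofReal_ne_top)]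

variable (K) in
theorem exists_volume_slab_le {M : ℝ} (hM : 0 ≤ M) : ∃ B : ℝ, 0 ≤ B ∧
    ∀ (w : InfinitePlace K) (η : ℝ), 0 < η →
      volume (normAtAllPlaces ⁻¹' (expMapBasis '' slab w M η) : Set (mixedSpace K))
        ≤ ENNReal.ofReal (B * η) := by
  obtain ⟨B, hB, h⟩ := exists_setLIntegral_slab_le K hM
  set c₁ : ENNReal := 2 ^ nrRealPlaces K * ENNReal.ofReal (2 * Real.pi) ^ nrComplexPlaces K *
        ((2 : ENNReal)⁻¹ ^ nrComplexPlaces K * ENNReal.ofReal (Units.regulator K) *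
          (Module.finrank ℚ K)) with hc₁
  have hfin : c₁ ≠ ⊤ := by
    refine ENNReal.mul_ne_top (ENNReal.mul_ne_top (by simp) (ENNReal.pow_ne_top
        ENNReal.ofReal_ne_top))
      (ENNReal.mul_ne_top (ENNReal.mul_ne_top (ENNReal.pow_ne_top (by simp)) ENNReal.ofReal_ne_top)
        (ENNReal.natCast_ne_top _))
  refine ⟨c₁.toReal * B, by positivity, fun w η hη => ?_⟩
  rw [volume_preimage_expMapBasis_image (measurableSet_slab w M η), ← mul_assoc, ← hc₁, mul_assoc
      c₁.toReal,
    ENNReal.ofReal_mul ENNReal.toReal_nonneg, ENNReal.ofReal_toReal hfin]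
  gcongr
  exact h w η hη

theorem abs_log_sub_log_le {a b δ : ℝ} (hδ : 0 < δ) (ha : δ ≤ a) (hb : δ ≤ b) :
    |Real.log a - Real.log b| ≤ |a - b| / δ := by
  wlog hab : b ≤ a generalizing a b
  · rw [abs_sub_comm, abs_sub_comm a]
    exact this hb ha (le_of_not_ge hab)
  have hb0 : 0 < b := hδ.trans_le hb
  have ha0 : 0 < a := hδ.trans_le ha
  rw [abs_of_nonneg (sub_nonneg.2 (Real.log_le_log hb0 hab)), abs_of_nonneg (sub_nonneg.2 hab),
    ← Real.log_div ha0.ne' hb0.ne']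
  calc _ ≤ a / b - 1 := Real.log_le_sub_one_of_pos (by positivity)
    _ = (a - b) / b := by rw [sub_div, div_self hb0.ne']
    _ ≤ _ := by gcongr

/-- Logarithmic coordinates: the inverse of `expMapBasis` on vectors with positive coordinates. -/
noncomputable def logCoord (X : realSpace K) : realSpace K :=
  (completeBasis K).equivFunL fun w => (mult w : ℝ) * Real.log (X w)

theorem expMapBasis_logCoord {X : realSpace K} (hX : ∀ w, 0 < X w) :
    expMapBasis (logCoord X) = X := by
  rw [expMapBasis_apply]
  have : (completeBasis K).equivFun.symm (logCoord X) = fun w => (mult w : ℝ) * Real.log (X w) :=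
    (completeBasis K).equivFunL.symm_apply_apply _
  rw [this]
  ext w
  rw [expMap_apply, inv_mul_cancel_left₀ mult_coe_ne_zero, Real.exp_log (hX w)]

theorem norm_logCoord_sub_le {X Y : realSpace K} {δ ε : ℝ} (hδ : 0 < δ) (hX : ∀ w, δ ≤ X w)
    (hY : ∀ w, δ ≤ Y w) (hXY : ∀ w, |X w - Y w| ≤ ε) :
    ‖logCoord X - logCoord Y‖ ≤
      ‖((completeBasis K).equivFunL : realSpace K →L[ℝ] realSpace K)‖ * (2 * (ε / δ)) := by
  rw [logCoord, logCoord, ← map_sub]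
  refine (((completeBasis K).equivFunL : realSpace K →L[ℝ] realSpace K).le_opNorm _).trans ?_
  gcongr
  obtain ⟨w₁⟩ := (inferInstance : Nonempty (InfinitePlace K))
  have hε : 0 ≤ ε := (abs_nonneg _).trans (hXY w₁)
  refine (pi_norm_le_iff_of_nonneg (by positivity)).2 fun w => ?_
  rw [Pi.sub_apply, ← mul_sub, Real.norm_eq_abs, abs_mul, Nat.abs_cast]
  have hmult : (mult w : ℝ) ≤ 2 := by
    have : mult w ≤ 2 := by
      rw [mult]
      split_ifs <;> norm_num
    exact_mod_cast this
  refine mul_le_mul hmult ((abs_log_sub_log_le hδ (hX w) (hY w)).trans ?_) (abs_nonneg _) (by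
      norm_num)
  gcongr
  exact hXY w

theorem mem_normLeOne_iff_logCoord {x : mixedSpace K} (hx : ∀ w, 0 < normAtAllPlaces x w) :
    x ∈ normLeOne K ↔ logCoord (normAtAllPlaces x) ∈ paramSet K := by
  rw [normLeOne_eq_preimage, Set.mem_preimage]
  nth_rw 1 [← expMapBasis_logCoord hx]
  exact (injective_expMapBasis K).mem_set_image

/-- Two nearby points, one inside `paramSet K` and one outside, lie in a common slab. -/
theorem exists_mem_slab {a b : realSpace K} {M η : ℝ} (hM : 1 + η ≤ M) (hη : 0 ≤ η)
    (hab : ‖a - b‖ ≤ η) (ha : a ∈ paramSet K) (hb : b ∉ paramSet K) :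
    ∃ w, a ∈ slab w M η ∧ b ∈ slab w M η := by
  have hab' : ∀ w, |a w - b w| ≤ η := fun w => (norm_le_pi_norm (a - b) w).trans hab
  have ha' : ∀ w, a w ∈ if w = w₀ then Set.Iic (0 : ℝ) else Set.Ico 0 1 := fun w => ha w
      (Set.mem_univ w)
  have hb' : ∃ w, b w ∉ if w = w₀ then Set.Iic (0 : ℝ) else Set.Ico 0 1 := by
    by_contra h
    push Not at h
    exact hb fun w _ => h w
  obtain ⟨w, hw⟩ := hb'
  have hA := ha' w
  have hAB := abs_le.1 (hab' w)
  have hnear : (a w ∈ Set.Icc (-η) η ∪ Set.Icc (1 - η) (1 + η)) ∧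
      (b w ∈ Set.Icc (-η) η ∪ Set.Icc (1 - η) (1 + η)) := by
    by_cases h : w = w₀
    · rw [if_pos h] at hA hw
      rw [Set.mem_Iic] at hA hw
      push Not at hw
      exact ⟨Or.inl ⟨by linarith, by linarith⟩, Or.inl ⟨by linarith, by linarith⟩⟩
    · rw [if_neg h] at hA hw
      rw [Set.mem_Ico, not_and_or] at hw
      push Not at hw
      obtain ⟨h1, h2⟩ := hA
      rcases hw with hw | hw
      · exact ⟨Or.inl ⟨by linarith, by linarith⟩, Or.inl ⟨by linarith, by linarith⟩⟩
      · exact ⟨Or.inr ⟨by linarith, by linarith⟩, Or.inr ⟨by linarith, by linarith⟩⟩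
  have hbox : ∀ w', (a w' ∈ if w' = w₀ then Set.Iic M else Set.Icc (-M) M) ∧
      (b w' ∈ if w' = w₀ then Set.Iic M else Set.Icc (-M) M) := by
    intro w'
    have h1 := ha' w'
    have h2 := abs_le.1 (hab' w')
    by_cases h : w' = w₀
    · rw [if_pos h] at h1 ⊢
      rw [Set.mem_Iic] at h1
      exact ⟨Set.mem_Iic.2 (by linarith), Set.mem_Iic.2 (by linarith)⟩
    · rw [if_neg h] at h1 ⊢
      obtain ⟨h3, h4⟩ := h1
      exact ⟨⟨by linarith, by linarith⟩, ⟨by linarith, by linarith⟩⟩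
  refine ⟨w, fun w' _ => ⟨(hbox w').1, ?_⟩, fun w' _ => ⟨(hbox w').2, ?_⟩⟩
  · by_cases h : w' = w
    · rw [if_pos h, h]; exact hnear.1
    · rw [if_neg h]; trivial
  · by_cases h : w' = w
    · rw [if_pos h, h]; exact hnear.2
    · rw [if_neg h]; trivial

variable (K) in
/-- The boundary of the set of elements of norm at most `1` in the fundamental cone has small
neighbourhoods: away from the points with a small coordinate, the logarithmic coordinates change by
`O(√ε)` when a point moves by `ε`, so that a boundary point lies in a thin slab. -/
theorem exists_volume_boundary_normLeOne_le : ∃ B : ℝ, ∀ ε : ℝ, 0 < ε → ε ≤ 1 →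
    ∃ N : Set (mixedSpace K), MeasurableSet N ∧ volume N ≠ ⊤ ∧ volume.real N ≤ B * √ε ∧
      ∀ x y, ‖x - y‖ ≤ ε → x ∈ normLeOne K → y ∉ normLeOne K → x ∈ N ∧ y ∈ N := by
  obtain ⟨R, hR1, hR⟩ : ∃ R : ℝ, 1 ≤ R ∧ ∀ x ∈ normLeOne K, ‖x‖ ≤ R := by
    obtain ⟨R, hR⟩ := (isBounded_normLeOne K).exists_norm_le
    exact ⟨max R 1, le_max_right _ _, fun x hx => (hR x hx).trans (le_max_left _ _)⟩
  set T : ℝ := max ‖((completeBasis K).equivFunL : realSpace K →L[ℝ] realSpace K)‖ 1 with hT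
  have hT1 : 1 ≤ T := le_max_right _ _
  obtain ⟨B₁, hB₁, h₁⟩ := exists_volume_smallSet_le K (R := R + 2) (by linarith)
  obtain ⟨B₂, hB₂, h₂⟩ := exists_volume_slab_le K (M := T + 1) (by linarith)
  set m : ℝ := ((Fintype.card (InfinitePlace K) : ℕ) : ℝ) with hm
  refine ⟨m * (3 * B₁ + B₂ * T), fun ε hε hε1 => ?_⟩
  set η := √ε with hη
  have hη0 : 0 < η := Real.sqrt_pos.2 hε
  have hη1 : η ≤ 1 := Real.sqrt_le_one.2 hε1
  have hηε : η * η = ε := Real.mul_self_sqrt hε.le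
  have hεη : ε ≤ η := by nlinarith
  set N : Set (mixedSpace K) := ⋃ w : InfinitePlace K, (smallSet w (R + 2) (3 * η) ∪
    normAtAllPlaces ⁻¹' (expMapBasis '' slab w (T + 1) (T * η))) with hN
  have hvol : volume N ≤ ENNReal.ofReal (m * (3 * B₁ + B₂ * T) * η) := by
    calc volume N ≤ ∑ _w : InfinitePlace K, ENNReal.ofReal ((3 * B₁ + B₂ * T) * η) := by
          refine (measure_iUnion_fintype_le _ _).trans (Finset.sum_le_sum fun w _ => ?_)
          refine (measure_union_le _ _).trans ?_
          refine (add_le_add (h₁ w (3 * η) (by positivity) (by linarith))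
            (h₂ w (T * η) (by positivity))).trans ?_
          rw [← ENNReal.ofReal_add (by positivity) (by positivity)]
          exact ENNReal.ofReal_le_ofReal (le_of_eq (by ring))
      _ = _ := by
          rw [Finset.sum_const, Finset.card_univ, nsmul_eq_mul, mul_assoc m,
            ENNReal.ofReal_mul (p := m) (by positivity), hm, ENNReal.ofReal_natCast]
  refine ⟨N, ?_, (hvol.trans_lt ENNReal.ofReal_lt_top).ne,
    ENNReal.toReal_le_of_le_ofReal (by positivity) hvol, ?_⟩
  · exact MeasurableSet.iUnion fun w => (measurableSet_smallSet _ _ _).union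
      (measurableSet_preimage_expMapBasis_image (measurableSet_slab _ _ _))
  intro x y hxy hx hy
  have hxy' : ∀ w, |normAtPlace w x - normAtPlace w y| ≤ ε := fun w =>
    (abs_normAtPlace_sub_le w x y).trans hxy
  have hxR : ∀ w, normAtPlace w x < R + 2 := fun w => by
    linarith [normAtPlace_le_norm w x, hR x hx]
  have hyR : ∀ w, normAtPlace w y < R + 2 := fun w => by
    linarith [normAtPlace_le_norm w x, hR x hx, (abs_le.1 (hxy' w)).1]
  -- With all coordinates at least `2 √ε`, the logarithms move by `O(ε / √ε)`.
  by_cases hsmall : ∃ w, normAtPlace w x < 2 * η ∨ normAtPlace w y < 2 * η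
  · obtain ⟨w, hw⟩ := hsmall
    have h := abs_le.1 (hxy' w)
    have h3 : normAtPlace w x < 3 * η ∧ normAtPlace w y < 3 * η := by
      rcases hw with hw | hw <;> constructor <;> linarith
    exact ⟨Set.mem_iUnion.2 ⟨w, Or.inl ⟨h3.1, hxR⟩⟩, Set.mem_iUnion.2 ⟨w, Or.inl ⟨h3.2, hyR⟩⟩⟩
  · push Not at hsmall
    have hxp : ∀ w, 0 < normAtAllPlaces x w := fun w =>
      (by linarith : 0 < 2 * η).trans_le (hsmall w).1
    have hyp : ∀ w, 0 < normAtAllPlaces y w := fun w =>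
      (by linarith : 0 < 2 * η).trans_le (hsmall w).2
    have hdist := norm_logCoord_sub_le (X := normAtAllPlaces x) (Y := normAtAllPlaces y)
      (by linarith : 0 < 2 * η) (fun w => (hsmall w).1) (fun w => (hsmall w).2) hxy'
    have hdist' : ‖logCoord (normAtAllPlaces x) - logCoord (normAtAllPlaces y)‖ ≤ T * η := by
      refine hdist.trans ?_
      have : 2 * (ε / (2 * η)) = η := by
        rw [← hηε]
        field_simp
      rw [this]
      gcongr
      exact le_max_left _ _
    obtain ⟨w, hw⟩ := exists_mem_slab (M := T + 1) (η := T * η) (by nlinarith) (by positivity)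
      hdist' ((mem_normLeOne_iff_logCoord hxp).1 hx) (fun h => hy ((mem_normLeOne_iff_logCoord
          hyp).2 h))
    exact ⟨Set.mem_iUnion.2 ⟨w, Or.inr ⟨_, hw.1, expMapBasis_logCoord hxp⟩⟩,
      Set.mem_iUnion.2 ⟨w, Or.inr ⟨_, hw.2, expMapBasis_logCoord hyp⟩⟩⟩

end boundary

end QuadMoments

/-! ### Counting ideals in a class -/

namespace QuadMoments

open NumberField.InfinitePlace NumberField.mixedEmbedding NumberField.mixedEmbedding.fundamentalCone
  MeasureTheory Module Filter Topology Ideal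
open scoped nonZeroDivisors Pointwise

section count

variable {K : Type*} [Field K] [NumberField K]

/-- Multiplying by an ideal `J` in the inverse class turns ideals of a given class into principal
multiples of `J`. -/
theorem card_class_eq_card_principal {κ : ClassGroup (𝓞 K)} {J : (Ideal (𝓞 K))⁰}
    (hJ : ClassGroup.mk0 J = κ⁻¹) (s : ℝ) :
    Nat.card {I : (Ideal (𝓞 K))⁰ // absNorm (I : Ideal (𝓞 K)) ≤ s ∧ ClassGroup.mk0 I = κ}
      = Nat.card {I : (Ideal (𝓞 K))⁰ // (J : Ideal (𝓞 K)) ∣ I ∧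
        Submodule.IsPrincipal (I : Ideal (𝓞 K)) ∧
        absNorm (I : Ideal (𝓞 K)) ≤ s * absNorm (J : Ideal (𝓞 K))} := by
  simp_rw [← nonZeroDivisors_dvd_iff_dvd_coe]
  refine Nat.card_congr ?_
  refine ((Equiv.dvd J).subtypeEquiv fun I ↦ ?_).trans
    (Equiv.subtypeSubtypeEquivSubtypeInter (fun I : (Ideal (𝓞 K))⁰ ↦ J ∣ I) _)
  rw [← ClassGroup.mk0_eq_one_iff (SetLike.coe_mem _)]
  simp_rw [Equiv.dvd_apply, Submonoid.coe_mul, ← Submonoid.mul_def, _root_.map_mul, hJ,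
    inv_mul_eq_one, Nat.cast_mul, mul_comm s, eq_comm, and_comm, and_congr_left_iff]
  exact fun _ ↦
    (mul_le_mul_iff_of_pos_left (Nat.cast_pos.mpr (absNorm_pos_of_nonZeroDivisors J))).symm

theorem mem_smul_normLeOne {t : ℝ} (ht : 0 < t) (x : mixedSpace K) :
    x ∈ t • normLeOne K ↔
      x ∈ fundamentalCone K ∧ mixedEmbedding.norm x ≤ t ^ finrank ℚ K := by
  have hp : 0 < t ^ finrank ℚ K := by positivity
  rw [Set.mem_smul_set_iff_inv_smul_mem₀ ht.ne', mem_normLeOne,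
    smul_mem_iff_mem (inv_ne_zero ht.ne'), mixedEmbedding.norm_smul, abs_of_pos (by positivity),
        inv_pow,
    inv_mul_le_one₀ hp]

/-- Ideals of bounded norm in a class correspond, up to roots of unity, to the points of an ideal
lattice in a dilate of `normLeOne K`. -/
theorem card_class_mul_torsionOrder {κ : ClassGroup (𝓞 K)} {J : (Ideal (𝓞 K))⁰}
    (hJ : ClassGroup.mk0 J = κ⁻¹) {s t : ℝ} (ht : 0 < t)
    (hst : t ^ finrank ℚ K = s * absNorm (J : Ideal (𝓞 K))) :
    Nat.card {I : (Ideal (𝓞 K))⁰ // absNorm (I : Ideal (𝓞 K)) ≤ s ∧ ClassGroup.mk0 I = κ} *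
      Units.torsionOrder K =
      ((t • normLeOne K) ∩ (idealLattice K (FractionalIdeal.mk0 K J) : Set (mixedSpace K))).ncard :=
          by
  rw [card_class_eq_card_principal hJ, card_isPrincipal_dvd_norm_le, ← hst, ← Nat.card_coe_set_eq]
  refine Nat.card_congr ((Equiv.subtypeSubtypeEquivSubtypeInter (· ∈ idealSet K J)
    (mixedEmbedding.norm · ≤ t ^ finrank ℚ K)).trans (Equiv.subtypeEquivRight fun x => ?_))
  rw [Set.mem_inter_iff, mem_smul_normLeOne ht, idealSet, Set.mem_inter_iff]
  tauto

open scoped Classical in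
/-- The asymptotic count in one class; the dilation factor is `(s N J)^{1/n}`, and the lattice point
count loses the square root of it. -/
theorem exists_card_class_le_eventually (κ : ClassGroup (𝓞 K)) :
    ∃ ρ B s₀ : ℝ, 1 ≤ s₀ ∧ 0 ≤ B ∧ ∀ s : ℝ, s₀ ≤ s →
      |Nat.card {I : (Ideal (𝓞 K))⁰ // absNorm (I : Ideal (𝓞 K)) ≤ s ∧ ClassGroup.mk0 I = κ} - ρ *
          s|
        ≤ B * s ^ (1 - 1 / (2 * (finrank ℚ K : ℝ))) := by
  obtain ⟨J, hJ⟩ := ClassGroup.mk0_surjective κ⁻¹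
  set L := idealLattice K (FractionalIdeal.mk0 K J)
  obtain ⟨B₀, hB₀⟩ := exists_volume_boundary_normLeOne_le K
  obtain ⟨R, hR, h⟩ := exists_abs_covolume_mul_ncard_smul_sub_le (volume : Measure (mixedSpace K)) L
    (isBounded_normLeOne K) (measurableSet_normLeOne K) hB₀
  rw [mixedEmbedding.finrank] at h
  set n := finrank ℚ K with hn
  have hn0 : n ≠ 0 := finrank_pos.ne'
  have hnR : (0 : ℝ) < n := Nat.cast_pos.2 finrank_pos
  set q : ℝ := ((absNorm (J : Ideal (𝓞 K)) : ℕ) : ℝ) with hq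
  have hq0 : 0 < q := Nat.cast_pos.2 (absNorm_pos_of_nonZeroDivisors J)
  set W : ℝ := ZLattice.covolume L * Units.torsionOrder K with hW
  have hW0 : 0 < W := mul_pos (ZLattice.covolume_pos L volume)
    (Nat.cast_pos.2 (Units.torsionOrder_pos K))
  set V : ℝ := (volume : Measure (mixedSpace K)).real (normLeOne K)
  have hB0 : 0 ≤ B₀ := by
    obtain ⟨N, _, _, hN, _⟩ := hB₀ 1 one_pos le_rfl
    rw [Real.sqrt_one, mul_one] at hN
    exact measureReal_nonneg.trans hN
  refine ⟨q * V / W, q * (B₀ * √R) * q ^ (-(1 / (2 * (n : ℝ)))) / W, max 1 (R ^ n / q), le_max_left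
      _ _,
    by positivity, fun s hs => ?_⟩
  have hs1 : 1 ≤ s := (le_max_left _ _).trans hs
  have hsR : R ^ n ≤ s * q := by
    have := (le_max_right _ _).trans hs
    rwa [div_le_iff₀ hq0] at this
  have hsq : 0 < s * q := by positivity
  set t : ℝ := (s * q) ^ (1 / (n : ℝ)) with ht
  have ht0 : 0 < t := by positivity
  have htn : t ^ n = s * q := by
    rw [ht, one_div, Real.rpow_inv_natCast_pow hsq.le hn0]
  have hRt : R ≤ t := by
    rw [← htn] at hsR
    exact le_of_pow_le_pow_left₀ hn0 ht0.le hsR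
  have hc := card_class_mul_torsionOrder hJ ht0 htn
  have hb := h t hRt
  rw [← hc, htn] at hb
  set c₀ := Nat.card {I : (Ideal (𝓞 K))⁰ // absNorm (I : Ideal (𝓞 K)) ≤ s ∧ ClassGroup.mk0 I = κ}
  push_cast at hb
  have e1 : (c₀ : ℝ) - q * V / W * s = (ZLattice.covolume L * (c₀ * Units.torsionOrder K) - s * q *
      V) / W := by
    rw [eq_div_iff hW0.ne', sub_mul, div_mul_eq_mul_div, div_mul_cancel₀ _ hW0.ne', hW]
    ring
  rw [e1, abs_div, abs_of_pos hW0, div_mul_eq_mul_div]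
  gcongr
  refine hb.trans (le_of_eq ?_)
  have e2 : √t = (s * q) ^ (1 / (2 * (n : ℝ))) := by
    rw [Real.sqrt_eq_rpow, ht, ← Real.rpow_mul hsq.le]
    congr 1
    field_simp
  rw [Real.sqrt_div hR.le, e2, Real.mul_rpow (by linarith) hq0.le, Real.rpow_neg hq0.le,
    Real.rpow_sub (by linarith), Real.rpow_one]
  have := Real.rpow_pos_of_pos (by linarith : 0 < s) (1 / (2 * (n : ℝ)))
  have := Real.rpow_pos_of_pos hq0 (1 / (2 * (n : ℝ)))
  field_simp

/-- The ideals of norm less than `Y` in a given class. -/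
def classSet (κ : ClassGroup (𝓞 K)) (Y : ℝ) : Set (Ideal (𝓞 K))⁰ :=
  {I | (absNorm (I : Ideal (𝓞 K)) : ℝ) < Y ∧ ClassGroup.mk0 I = κ}

theorem finite_absNorm_lt (Y : ℝ) : {I : (Ideal (𝓞 K))⁰ | (absNorm (I : Ideal (𝓞 K)) : ℝ) <
    Y}.Finite := by
  refine (finite_setOfPred_absNorm_le₀ (S := 𝓞 K) ⌈Y⌉₊).subset fun I hI => ?_
  have : (absNorm (I : Ideal (𝓞 K)) : ℝ) ≤ ⌈Y⌉₊ := (le_of_lt hI).trans (Nat.le_ceil Y)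
  exact_mod_cast this

theorem finite_classSet (κ : ClassGroup (𝓞 K)) (Y : ℝ) : (classSet κ Y).Finite :=
  (finite_absNorm_lt Y).subset fun _ hI => hI.1

theorem ncard_classSet_le {κ : ClassGroup (𝓞 K)} {Y s : ℝ} (h : Y ≤ s) :
    (classSet κ Y).ncard ≤
      Nat.card {I : (Ideal (𝓞 K))⁰ // absNorm (I : Ideal (𝓞 K)) ≤ s ∧ ClassGroup.mk0 I = κ} := by
  change _ ≤ Set.ncard {I : (Ideal (𝓞 K))⁰ | absNorm (I : Ideal (𝓞 K)) ≤ s ∧ ClassGroup.mk0 I = κ}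
  refine Set.ncard_le_ncard (fun I hI => ⟨hI.1.le.trans h, hI.2⟩) ?_
  exact (finite_absNorm_lt (s + 1)).subset fun I hI => lt_of_le_of_lt hI.1 (by linarith)

theorem card_le_ncard_classSet {κ : ClassGroup (𝓞 K)} {Y s : ℝ} (h : s < Y) :
    Nat.card {I : (Ideal (𝓞 K))⁰ // absNorm (I : Ideal (𝓞 K)) ≤ s ∧ ClassGroup.mk0 I = κ} ≤
      (classSet κ Y).ncard := by
  change Set.ncard {I : (Ideal (𝓞 K))⁰ | absNorm (I : Ideal (𝓞 K)) ≤ s ∧ ClassGroup.mk0 I = κ} ≤ _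
  exact Set.ncard_le_ncard (fun I hI => ⟨hI.1.trans_lt h, hI.2⟩) (finite_classSet κ Y)

theorem classSet_eq_empty {κ : ClassGroup (𝓞 K)} {Y : ℝ} (hY : Y ≤ 1) : classSet κ Y = ∅ := by
  rw [Set.eq_empty_iff_forall_notMem]
  rintro I ⟨hI, _⟩
  have : (1 : ℝ) ≤ absNorm (I : Ideal (𝓞 K)) := by
    exact_mod_cast absNorm_pos_of_nonZeroDivisors I
  linarith

variable (K) in
/-- The exponent in the error terms. It is chosen in `[3/4, 1)` and at least `1 - 1/(2n)`, the
exponent which the lattice point count gives. -/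
noncomputable def errorExponent : ℝ := 1 - 1 / (4 * ((finrank ℚ K : ℝ) + 1))

theorem errorExponent_lt_one : errorExponent K < 1 := by
  unfold errorExponent
  have : 0 < 1 / (4 * ((finrank ℚ K : ℝ) + 1)) := by positivity
  linarith

theorem three_quarters_le_errorExponent : 3 / 4 ≤ errorExponent K := by
  unfold errorExponent
  have : 1 / (4 * ((finrank ℚ K : ℝ) + 1)) ≤ 1 / 4 := by
    apply one_div_le_one_div_of_le (by norm_num)
    have : (0 : ℝ) ≤ finrank ℚ K := by positivity
    linarith
  linarith

theorem le_errorExponent : 1 - 1 / (2 * (finrank ℚ K : ℝ)) ≤ errorExponent K := by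
  unfold errorExponent
  have hn : (0 : ℝ) < finrank ℚ K := Nat.cast_pos.2 finrank_pos
  have : 1 / (4 * ((finrank ℚ K : ℝ) + 1)) ≤ 1 / (2 * (finrank ℚ K : ℝ)) := by
    apply one_div_le_one_div_of_le (by positivity)
    linarith
  linarith

variable (K) in
/-- The number of ideals of norm less than `Y` in an ideal class is `ρ Y` up to a power saving, with
the same `ρ` for all classes. -/
theorem exists_abs_ncard_classSet_sub_le : ∃ ρ B : ℝ, 0 < ρ ∧ 0 ≤ B ∧
    ∀ (κ : ClassGroup (𝓞 K)) (Y : ℝ), 0 < Y →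
      |(classSet κ Y).ncard - ρ * Y| ≤ B * Y ^ errorExponent K := by
  -- The main term is the one in Mathlib's asymptotic formula without error term.
  set ρ : ℝ := (2 ^ nrRealPlaces K * (2 * Real.pi) ^ nrComplexPlaces K * Units.regulator K) /
            (Units.torsionOrder K * Real.sqrt |(discr K : ℝ)|) with hρ
  have hρ0 : 0 < ρ := by
    have h1 : (0 : ℝ) < |(discr K : ℝ)| := abs_pos.2 (Int.cast_ne_zero.2 (discr_ne_zero K))
    have h2 : (0 : ℝ) < Units.torsionOrder K := Nat.cast_pos.2 (Units.torsionOrder_pos K)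
    have h3 := Units.regulator_pos K
    positivity
  set θ := errorExponent K with hθ
  have hθ1 : θ < 1 := errorExponent_lt_one
  have hθ0 : 3 / 4 ≤ θ := three_quarters_le_errorExponent
  have key : ∀ κ : ClassGroup (𝓞 K), ∃ B : ℝ, 0 ≤ B ∧ ∀ Y : ℝ, 0 < Y →
      |(classSet κ Y).ncard - ρ * Y| ≤ B * Y ^ θ := by
    intro κ
    obtain ⟨ρ', B, s₀, hs₀, hB, h⟩ := exists_card_class_le_eventually κ
    set cnt : ℝ → ℕ := fun s => Nat.card {I : (Ideal (𝓞 K))⁰ // absNorm (I : Ideal (𝓞 K)) ≤ s ∧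
      ClassGroup.mk0 I = κ} with hcnt
    have hρρ' : ρ' = ρ := by
      refine tendsto_nhds_unique ?_ (NumberField.Ideal.tendsto_norm_le_and_mk_eq_div_atTop K κ)
      have hlim : Tendsto (fun s : ℝ => B * s ^ (-(1 / (2 * (finrank ℚ K : ℝ))))) atTop (𝓝 0) := by
        have := (tendsto_rpow_neg_atTop (y := 1 / (2 * (finrank ℚ K : ℝ)))
          (by have : (0 : ℝ) < finrank ℚ K := Nat.cast_pos.2 finrank_pos
              positivity)).const_mul B
        simpa using this
      refine tendsto_iff_norm_sub_tendsto_zero.2 (squeeze_zero' (Eventually.of_forall fun _ =>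
          norm_nonneg _)
        ?_ hlim)
      filter_upwards [eventually_ge_atTop s₀] with s hs
      have hs0 : 0 < s := by linarith
      have := h s hs
      rw [Real.norm_eq_abs, div_sub' hs0.ne', abs_div, abs_of_pos hs0, div_le_iff₀ hs0, mul_comm s]
      refine this.trans (le_of_eq ?_)
      rw [mul_assoc, ← Real.rpow_add_one hs0.ne']
      congr 2
      ring
    rw [hρρ'] at h
    have hle : ∀ s : ℝ, 1 ≤ s → s ^ (1 - 1 / (2 * (finrank ℚ K : ℝ))) ≤ s ^ θ := fun s hs =>
      Real.rpow_le_rpow_of_exponent_le hs le_errorExponent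
    refine ⟨B + ρ * (s₀ + 1) + cnt (s₀ + 1), by positivity, fun Y hY => ?_⟩
    have hYθ : 0 < Y ^ θ := Real.rpow_pos_of_pos hY _
    have hc0 : (0 : ℝ) ≤ cnt (s₀ + 1) := Nat.cast_nonneg _
    rcases le_or_gt Y 1 with hY1 | hY1
    · rw [classSet_eq_empty hY1, Set.ncard_empty, Nat.cast_zero, zero_sub, abs_neg,
        abs_of_pos (by positivity)]
      have h1 : Y ≤ Y ^ θ := by
        simpa using Real.rpow_le_rpow_of_exponent_ge hY hY1 hθ1.le
      calc ρ * Y ≤ ρ * Y ^ θ := by gcongr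
        _ ≤ _ := by
          gcongr
          nlinarith
    have hYθ1 : 1 ≤ Y ^ θ := Real.one_le_rpow hY1.le (by linarith)
    rcases le_or_gt Y (s₀ + 1) with hYs | hYs
    · have h1 : ((classSet κ Y).ncard : ℝ) ≤ cnt (s₀ + 1) := by exact_mod_cast ncard_classSet_le hYs
      have h2 : |((classSet κ Y).ncard : ℝ) - ρ * Y| ≤ ρ * (s₀ + 1) + cnt (s₀ + 1) := by
        have h3 : (0 : ℝ) ≤ (classSet κ Y).ncard := Nat.cast_nonneg _
        have h4 : ρ * Y ≤ ρ * (s₀ + 1) := by gcongr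
        have h5 : 0 ≤ ρ * Y := by positivity
        rw [abs_le]
        constructor <;> linarith
      calc _ ≤ _ := h2
        _ ≤ (B + ρ * (s₀ + 1) + cnt (s₀ + 1)) * 1 := by linarith
        _ ≤ _ := by gcongr
    · have h1 : ((classSet κ Y).ncard : ℝ) ≤ cnt Y := by exact_mod_cast ncard_classSet_le le_rfl
      have h2 : (cnt (Y - 1) : ℝ) ≤ (classSet κ Y).ncard := by
        exact_mod_cast card_le_ncard_classSet (by linarith)
      have h3 := (abs_le.1 (h Y (by linarith))).2
      have h4 := (abs_le.1 (h (Y - 1) (by linarith))).1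
      have h5 : B * Y ^ (1 - 1 / (2 * (finrank ℚ K : ℝ))) ≤ B * Y ^ θ :=
        mul_le_mul_of_nonneg_left (hle Y hY1.le) hB
      have h6 : B * (Y - 1) ^ (1 - 1 / (2 * (finrank ℚ K : ℝ))) ≤ B * Y ^ θ := by
        refine mul_le_mul_of_nonneg_left ((hle _ (by linarith)).trans ?_) hB
        exact Real.rpow_le_rpow (by linarith) (by linarith) (by linarith)
      have h7 : ρ ≤ ρ * (s₀ + 1) * Y ^ θ := by
        calc ρ = ρ * 1 * 1 := by ring
          _ ≤ ρ * (s₀ + 1) * Y ^ θ := by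
            gcongr
            linarith
      have h8 : 0 ≤ cnt (s₀ + 1) * Y ^ θ := by positivity
      rw [abs_le]
      constructor
      · nlinarith
      · nlinarith
  choose B hB h using key
  refine ⟨ρ, ∑ κ, B κ, hρ0, Finset.sum_nonneg fun κ _ => hB κ, fun κ Y hY => (h κ Y hY).trans ?_⟩
  gcongr
  exact Finset.single_le_sum (fun κ _ => hB κ) (Finset.mem_univ κ)

end count

end QuadMoments

/-! ### Squarefree ideals divisible by given primes -/

namespace QuadMoments

open Ideal
open scoped nonZeroDivisors

section sieve

variable {K : Type*} [Field K] [NumberField K]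

/-- The norm of a nonzero ideal, as a real number. -/
noncomputable def normR (I : (Ideal (𝓞 K))⁰) : ℝ := (absNorm (I : Ideal (𝓞 K)) : ℝ)

theorem one_le_normR (I : (Ideal (𝓞 K))⁰) : 1 ≤ normR I := by
  unfold normR
  exact_mod_cast absNorm_pos_of_nonZeroDivisors I

theorem normR_pos (I : (Ideal (𝓞 K))⁰) : 0 < normR I := one_pos.trans_le (one_le_normR I)

theorem normR_mul (I J : (Ideal (𝓞 K))⁰) : normR (I * J) = normR I * normR J := by
  simp [normR]

theorem two_le_normR {p : (Ideal (𝓞 K))⁰} (hp : Prime (p : Ideal (𝓞 K))) : 2 ≤ normR p := by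
  have h1 : absNorm (p : Ideal (𝓞 K)) ≠ 1 := fun h =>
    hp.not_isUnit (by rw [absNorm_eq_one_iff.1 h, ← Ideal.one_eq_top]; exact isUnit_one)
  have h2 := absNorm_pos_of_nonZeroDivisors p
  unfold normR
  exact_mod_cast (by omega : 2 ≤ absNorm (p : Ideal (𝓞 K)))

theorem normR_le_of_dvd {I J : (Ideal (𝓞 K))⁰} (h : (I : Ideal (𝓞 K)) ∣ J) : normR I ≤ normR J := by
  obtain ⟨L, rfl⟩ := nonZeroDivisors_dvd_iff_dvd_coe.2 h
  rw [normR_mul]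
  exact le_mul_of_one_le_right (normR_pos I).le (one_le_normR L)

theorem mul_mem_classSet {κ : ClassGroup (𝓞 K)} {Y : ℝ} {a J : (Ideal (𝓞 K))⁰} :
    a * J ∈ classSet κ Y ↔ J ∈ classSet (κ * (ClassGroup.mk0 a)⁻¹) (Y / normR a) := by
  have h : ((absNorm ((a * J : (Ideal (𝓞 K))⁰) : Ideal (𝓞 K)) : ℕ) : ℝ) = normR (a * J) := rfl
  have h' : ((absNorm (J : Ideal (𝓞 K)) : ℕ) : ℝ) = normR J := rfl
  simp only [classSet, Set.mem_ofPred_eq, h, h', normR_mul, map_mul, lt_div_iff₀ (normR_pos a)]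
  rw [mul_comm (normR a), eq_mul_inv_iff_mul_eq, mul_comm (ClassGroup.mk0 a)]

/-- The sum of `N I ^ (-3/2)` over ideals converges: split dyadically and use the linear bound for
the number of ideals. -/
theorem exists_sum_normR_rpow_le : ∃ Z : ℝ, 0 ≤ Z ∧ ∀ P : Finset (Ideal (𝓞 K))⁰,
    ∑ I ∈ P, normR I ^ (-(3 / 2) : ℝ) ≤ Z := by
  classical
  obtain ⟨ρ, B, hρ, hB, h⟩ := exists_abs_ncard_classSet_sub_le K
  set θ := errorExponent K with hθ
  have hθ1 : θ < 1 := errorExponent_lt_one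
  set M : ℝ := ∑ _κ : ClassGroup (𝓞 K), (ρ + B) with hM
  have hM0 : 0 ≤ M := Finset.sum_nonneg fun _ _ => by positivity
  have hcount : ∀ (P : Finset (Ideal (𝓞 K))⁰) (Y : ℝ), 1 ≤ Y → (∀ I ∈ P, normR I < Y) →
      (P.card : ℝ) ≤ M * Y := by
    intro P Y hY hP
    have h1 : P.card ≤ ∑ κ : ClassGroup (𝓞 K), (classSet κ Y).ncard := by
      rw [Finset.card_eq_sum_card_fiberwise (f := ClassGroup.mk0) (t := Finset.univ)
        (fun _ _ => Finset.mem_coe.2 (Finset.mem_univ _))]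
      refine Finset.sum_le_sum fun κ _ => ?_
      rw [← Set.ncard_coe_finset]
      refine Set.ncard_le_ncard (fun I hI => ?_) (finite_classSet κ Y)
      rw [Finset.coe_filter] at hI
      exact ⟨hP I hI.1, hI.2⟩
    calc (P.card : ℝ) ≤ ∑ κ : ClassGroup (𝓞 K), ((classSet κ Y).ncard : ℝ) := by exact_mod_cast h1
      _ ≤ ∑ κ : ClassGroup (𝓞 K), (ρ + B) * Y := by
        refine Finset.sum_le_sum fun κ _ => ?_
        have h2 := (abs_le.1 (h κ Y (by linarith))).2
        have h3 : Y ^ θ ≤ Y := by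
          simpa using Real.rpow_le_rpow_of_exponent_le hY hθ1.le
        have h4 : B * Y ^ θ ≤ B * Y := mul_le_mul_of_nonneg_left h3 hB
        linarith
      _ = M * Y := by rw [hM, Finset.sum_mul]
  set r : ℝ := 2 ^ (-(1 / 2) : ℝ) with hr
  have hr0 : 0 ≤ r := by positivity
  have hr1 : r < 1 := Real.rpow_lt_one_of_one_lt_of_neg (by norm_num) (by norm_num)
  refine ⟨2 * M * (1 - r)⁻¹, by have : 0 < 1 - r := by linarith
                                positivity, fun P => ?_⟩
  set lg : (Ideal (𝓞 K))⁰ → ℕ := fun I => Nat.log 2 (absNorm (I : Ideal (𝓞 K))) with hlg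
  set m := P.sup lg + 1
  have hmaps : ∀ I ∈ P, lg I ∈ Finset.range m := fun I hI =>
    Finset.mem_range.2 (Nat.lt_succ_of_le (Finset.le_sup hI))
  rw [← Finset.sum_fiberwise_of_maps_to hmaps]
  have hlow : ∀ I : (Ideal (𝓞 K))⁰, (2 : ℝ) ^ lg I ≤ normR I := fun I => by
    have := Nat.pow_log_le_self 2 (absNorm_pos_of_nonZeroDivisors I).ne'
    unfold normR
    exact_mod_cast this
  have hup : ∀ I : (Ideal (𝓞 K))⁰, normR I < (2 : ℝ) ^ (lg I + 1) := fun I => by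
    have := Nat.lt_pow_succ_log_self (b := 2) (by norm_num) (absNorm (I : Ideal (𝓞 K)))
    unfold normR
    exact_mod_cast this
  calc ∑ j ∈ Finset.range m, ∑ I ∈ P with lg I = j, normR I ^ (-(3 / 2) : ℝ)
      ≤ ∑ j ∈ Finset.range m, 2 * M * r ^ j := by
        refine Finset.sum_le_sum fun j _ => ?_
        have h1 : ∀ I ∈ P.filter (fun I => lg I = j), normR I ^ (-(3 / 2) : ℝ)
            ≤ ((2 : ℝ) ^ j) ^ (-(3 / 2) : ℝ) := by
          intro I hI
          rw [← (Finset.mem_filter.1 hI).2]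
          exact Real.rpow_le_rpow_of_nonpos (by positivity) (hlow I) (by norm_num)
        refine (Finset.sum_le_card_nsmul _ _ _ h1).trans ?_
        rw [nsmul_eq_mul]
        have h2 := hcount (P.filter (fun I => lg I = j)) (2 ^ (j + 1)) (one_le_pow₀ (by norm_num))
          (fun I hI => by
            rw [← (Finset.mem_filter.1 hI).2]
            exact hup I)
        refine (mul_le_mul_of_nonneg_right h2 (by positivity)).trans (le_of_eq ?_)
        have h3 : r ^ j = 2 ^ j * ((2 : ℝ) ^ j) ^ (-(3 / 2) : ℝ) := by
          rw [hr, ← Real.rpow_natCast, ← Real.rpow_mul (by norm_num), ← Real.rpow_natCast,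
            ← Real.rpow_mul (by norm_num), ← Real.rpow_add (by norm_num)]
          congr 1
          ring
        rw [h3]
        ring
    _ = 2 * M * ∑ j ∈ Finset.range m, r ^ j := (Finset.mul_sum _ _ _).symm
    _ ≤ 2 * M * (1 - r)⁻¹ := by
        gcongr
        rw [← tsum_geometric_of_lt_one hr0 hr1]
        exact (summable_geometric_of_lt_one hr0 hr1).sum_le_tsum _ fun _ _ => by positivity

/-- The ideals of norm less than `Y` in the class `κ` that are divisible by no `p ^ 2`, `p ∈ P`. -/
def siftedSet (P : Finset (Ideal (𝓞 K))⁰) (κ : ClassGroup (𝓞 K)) (Y : ℝ) : Set (Ideal (𝓞 K))⁰ :=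
  {I | I ∈ classSet κ Y ∧ ∀ p ∈ P, ¬ (p : Ideal (𝓞 K)) ^ 2 ∣ I}

theorem not_dvd_of_prime_ne {p q : (Ideal (𝓞 K))⁰} (hp : Prime (p : Ideal (𝓞 K)))
    (hq : Prime (q : Ideal (𝓞 K))) (h : q ≠ p) : ¬ (q : Ideal (𝓞 K)) ∣ p := fun hd =>
  h (Subtype.ext (associated_iff_eq.1 ((hq.dvd_prime_iff_associated hp).1 hd)))

theorem sq_dvd_sq_mul_iff {p q : (Ideal (𝓞 K))⁰} (hp : Prime (p : Ideal (𝓞 K)))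
    (hq : Prime (q : Ideal (𝓞 K))) (h : q ≠ p) (J : Ideal (𝓞 K)) :
    (q : Ideal (𝓞 K)) ^ 2 ∣ (p : Ideal (𝓞 K)) ^ 2 * J ↔ (q : Ideal (𝓞 K)) ^ 2 ∣ J :=
  ⟨fun hd => hq.pow_dvd_of_dvd_mul_left 2 (fun h' => not_dvd_of_prime_ne hp hq h
    (hq.dvd_of_dvd_pow h')) hd, fun hd => hd.mul_left _⟩

/-- Sieving by one more prime: the ideals divisible by `p ^ 2` are the multiples `p ^ 2 * J`, and
multiplication by `p ^ 2` does not affect the conditions at the other primes. -/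
theorem ncard_siftedSet_insert [DecidableEq (Ideal (𝓞 K))⁰] {P : Finset (Ideal (𝓞 K))⁰}
    {p : (Ideal (𝓞 K))⁰} (hP : ∀ q ∈ P, Prime (q : Ideal (𝓞 K))) (hp : Prime (p : Ideal (𝓞 K)))
    (hpP : p ∉ P) (κ : ClassGroup (𝓞 K)) (Y : ℝ) :
    (siftedSet P (κ * (ClassGroup.mk0 (p ^ 2))⁻¹) (Y / normR (p ^ 2))).ncard +
      (siftedSet (insert p P) κ Y).ncard = (siftedSet P κ Y).ncard := by
  have hfin : (siftedSet P κ Y).Finite := (finite_classSet κ Y).subset fun _ h => h.1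
  rw [← Set.ncard_inter_add_ncard_sdiff_eq_ncard (siftedSet P κ Y)
    {I | (p : Ideal (𝓞 K)) ^ 2 ∣ I} hfin]
  congr 1
  · rw [← Set.ncard_image_of_injective _ (mul_right_injective (p ^ 2))]
    congr 1
    ext I
    constructor
    · rintro ⟨J, ⟨hJ, hJP⟩, rfl⟩
      refine ⟨⟨mul_mem_classSet.2 hJ, fun q hq => ?_⟩, ?_⟩
      · have := sq_dvd_sq_mul_iff hp (hP q hq) (by rintro rfl; exact hpP hq) (J : Ideal (𝓞 K))
        simpa [this] using hJP q hq
      · simp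
    · rintro ⟨⟨hI, hIP⟩, hd⟩
      have hd' : ((p ^ 2 : (Ideal (𝓞 K))⁰) : Ideal (𝓞 K)) ∣ I := by simpa using hd
      obtain ⟨J, rfl⟩ := nonZeroDivisors_dvd_iff_dvd_coe.2 hd'
      refine ⟨J, ⟨mul_mem_classSet.1 hI, fun q hq => ?_⟩, rfl⟩
      have := sq_dvd_sq_mul_iff hp (hP q hq) (by rintro rfl; exact hpP hq) (J : Ideal (𝓞 K))
      have h2 := hIP q hq
      simpa [this] using h2
  · congr 1
    ext I
    simp only [siftedSet, Finset.mem_insert, forall_eq_or_imp, Set.mem_ofPred_eq, Set.mem_sdiff]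
    tauto

theorem abs_ncard_siftedSet_sub_le {ρ B θ : ℝ}
    (h : ∀ (κ : ClassGroup (𝓞 K)) (Y : ℝ), 0 < Y → |(classSet κ Y).ncard - ρ * Y| ≤ B * Y ^ θ)
    (P : Finset (Ideal (𝓞 K))⁰) (hP : ∀ q ∈ P, Prime (q : Ideal (𝓞 K)))
    (κ : ClassGroup (𝓞 K)) {Y : ℝ} (hY : 0 < Y) :
    |(siftedSet P κ Y).ncard - ρ * Y * ∏ p ∈ P, (1 - 1 / normR p ^ 2)| ≤
      B * Y ^ θ * ∏ p ∈ P, (1 + (1 / normR p ^ 2) ^ θ) := by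
  classical
  induction P using Finset.induction_on generalizing κ Y with
  | empty => simpa [siftedSet] using h κ Y hY
  | insert p P hpP ih =>
    have hP' : ∀ q ∈ P, Prime (q : Ideal (𝓞 K)) := fun q hq => hP q (Finset.mem_insert_of_mem hq)
    have hp := hP p (Finset.mem_insert_self p P)
    have hrec := ncard_siftedSet_insert hP' hp hpP κ Y
    have hn : normR (p ^ 2) = normR p ^ 2 := by rw [sq, normR_mul, sq]
    have hpos := normR_pos p
    rw [hn] at hrec
    have h1 := ih hP' κ hY
    have h2 := ih hP' (κ * (ClassGroup.mk0 (p ^ 2))⁻¹) (Y := Y / normR p ^ 2) (by positivity)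
    rw [Finset.prod_insert hpP, Finset.prod_insert hpP]
    set S := (siftedSet P κ Y).ncard
    set S' := (siftedSet P (κ * (ClassGroup.mk0 (p ^ 2))⁻¹) (Y / normR p ^ 2)).ncard
    set S'' := (siftedSet (insert p P) κ Y).ncard
    have hS : (S'' : ℝ) = S - S' := by rw [← hrec]; push_cast; ring
    set u := ∏ p ∈ P, (1 - 1 / normR p ^ 2)
    set w := ∏ p ∈ P, (1 + (1 / normR p ^ 2) ^ θ)
    have e1 : (S'' : ℝ) - ρ * Y * ((1 - 1 / normR p ^ 2) * u) =
        (S - ρ * Y * u) - (S' - ρ * (Y / normR p ^ 2) * u) := by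
      rw [hS]
      ring
    have e2 : B * Y ^ θ * ((1 + (1 / normR p ^ 2) ^ θ) * w) =
        B * Y ^ θ * w + B * (Y / normR p ^ 2) ^ θ * w := by
      rw [div_eq_mul_one_div Y, Real.mul_rpow hY.le (by positivity)]
      ring
    rw [e1, e2]
    exact (abs_sub _ _).trans (add_le_add h1 h2)

/-- The squarefree ideals of norm less than `Y` in the class `κ` that are divisible by all
`p ∈ Q`. -/
def sqfreeSet (Q : Finset (Ideal (𝓞 K))⁰) (κ : ClassGroup (𝓞 K)) (Y : ℝ) : Set (Ideal (𝓞 K))⁰ :=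
  {I | I ∈ classSet κ Y ∧ Squarefree (I : Ideal (𝓞 K)) ∧ ∀ p ∈ Q, (p : Ideal (𝓞 K)) ∣ I}

theorem finite_sqfreeSet (Q : Finset (Ideal (𝓞 K))⁰) (κ : ClassGroup (𝓞 K)) (Y : ℝ) :
    (sqfreeSet Q κ Y).Finite := (finite_classSet κ Y).subset fun _ h => h.1

variable (K) in
theorem finite_prime_normR_lt (Y : ℝ) :
    {p : (Ideal (𝓞 K))⁰ | Prime (p : Ideal (𝓞 K)) ∧ normR p < Y}.Finite :=
  (finite_absNorm_lt Y).subset fun _ hp => hp.2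

/-- Among ideals of norm less than `Y` only the primes of norm less than `Y` matter. -/
theorem siftedSet_eq_sqfreeSet (κ : ClassGroup (𝓞 K)) (Y : ℝ) :
    siftedSet (finite_prime_normR_lt K Y).toFinset κ Y = sqfreeSet ∅ κ Y := by
  ext I
  simp only [siftedSet, sqfreeSet, Set.mem_ofPred_eq, Set.Finite.mem_toFinset, Finset.notMem_empty,
    IsEmpty.forall_iff, implies_true, and_true]
  refine and_congr_right fun hI => ?_
  have hI0 : (I : Ideal (𝓞 K)) ≠ 0 := nonZeroDivisors.coe_ne_zero I
  rw [squarefree_iff_irreducible_sq_not_dvd_of_ne_zero hI0]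
  constructor
  · intro h p hp hd
    have hp' : Prime p := hp.prime
    rw [← sq] at hd
    have hle : normR ⟨p, mem_nonZeroDivisors_of_ne_zero hp'.ne_zero⟩ ≤ normR I :=
      normR_le_of_dvd (dvd_of_mul_right_dvd (by simpa [sq] using hd))
    exact h ⟨p, mem_nonZeroDivisors_of_ne_zero hp'.ne_zero⟩ ⟨hp', hle.trans_lt hI.1⟩ hd
  · intro h p hp hd
    rw [sq] at hd
    exact h p hp.1.irreducible hd

theorem prod_one_add_le_exp {Z θ : ℝ} (hθ : 3 / 4 ≤ θ)
    (hZ : ∀ P : Finset (Ideal (𝓞 K))⁰, ∑ I ∈ P, normR I ^ (-(3 / 2) : ℝ) ≤ Z)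
    (P : Finset (Ideal (𝓞 K))⁰) : ∏ p ∈ P, (1 + (1 / normR p ^ 2) ^ θ) ≤ Real.exp Z := by
  calc ∏ p ∈ P, (1 + (1 / normR p ^ 2) ^ θ)
      ≤ ∏ p ∈ P, Real.exp (normR p ^ (-(3 / 2) : ℝ)) := by
        refine Finset.prod_le_prod (fun p _ => by have := normR_pos p; positivity) fun p _ => ?_
        have hp := normR_pos p
        have h1 : (1 / normR p ^ 2) ^ θ ≤ normR p ^ (-(3 / 2) : ℝ) := by
          rw [one_div, ← Real.rpow_natCast, ← Real.rpow_neg hp.le, ← Real.rpow_mul hp.le]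
          exact Real.rpow_le_rpow_of_exponent_le (one_le_normR p) (by push_cast; linarith)
        have h2 := Real.add_one_le_exp (normR p ^ (-(3 / 2) : ℝ))
        linarith
    _ = Real.exp (∑ p ∈ P, normR p ^ (-(3 / 2) : ℝ)) := (Real.exp_sum _ _).symm
    _ ≤ Real.exp Z := Real.exp_le_exp.2 (hZ P)

theorem one_div_normR_sq_le (p : (Ideal (𝓞 K))⁰) : 1 / normR p ^ 2 ≤ normR p ^ (-(3 / 2) : ℝ) := by
  rw [one_div, ← Real.rpow_natCast, ← Real.rpow_neg (normR_pos p).le]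
  exact Real.rpow_le_rpow_of_exponent_le (one_le_normR p) (by norm_num)

theorem one_div_normR_sq_le_quarter {p : (Ideal (𝓞 K))⁰} (hp : Prime (p : Ideal (𝓞 K))) :
    1 / normR p ^ 2 ≤ 1 / 4 := by
  have := two_le_normR hp
  apply one_div_le_one_div_of_le (by norm_num)
  nlinarith

theorem one_sub_sum_le_prod_one_sub {ι : Type*} (P : Finset ι) {a : ι → ℝ}
    (h0 : ∀ i ∈ P, 0 ≤ a i) (h1 : ∀ i ∈ P, a i ≤ 1) :
    1 - ∑ i ∈ P, a i ≤ ∏ i ∈ P, (1 - a i) := by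
  classical
  induction P using Finset.induction_on with
  | empty => simp
  | insert i P hi ih =>
    rw [Finset.prod_insert hi, Finset.sum_insert hi]
    have hP0 : ∀ j ∈ P, 0 ≤ a j := fun j hj => h0 j (Finset.mem_insert_of_mem hj)
    have hP1 : ∀ j ∈ P, a j ≤ 1 := fun j hj => h1 j (Finset.mem_insert_of_mem hj)
    have h2 := ih hP0 hP1
    have h3 : ∏ j ∈ P, (1 - a j) ≤ 1 := Finset.prod_le_one
      (fun j hj => sub_nonneg.2 (hP1 j hj)) fun j hj => sub_le_self _ (hP0 j hj)
    have h4 := h0 i (Finset.mem_insert_self i P)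
    nlinarith

variable (K) in
/-- The partial Euler products of `1 / ζ_K(2)` converge to a positive limit, with a power saving. -/
theorem exists_eulerProduct_sub_le {Z : ℝ}
    (hZ : ∀ P : Finset (Ideal (𝓞 K))⁰, ∑ I ∈ P, normR I ^ (-(3 / 2) : ℝ) ≤ Z) :
    ∃ u : ℝ, 0 < u ∧ u ≤ 1 ∧ ∀ Y : ℝ, 0 < Y →
      |∏ p ∈ (finite_prime_normR_lt K Y).toFinset, (1 - 1 / normR p ^ 2) - u| ≤
        Z * Y ^ (-(1 / 2) : ℝ) := by
  classical
  -- The limit is the infimum of all finite products.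
  set S : Set ℝ := {x | ∃ P : Finset (Ideal (𝓞 K))⁰, (∀ p ∈ P, Prime (p : Ideal (𝓞 K))) ∧
    ∏ p ∈ P, (1 - 1 / normR p ^ 2) = x} with hS
  have hlow : ∀ x ∈ S, Real.exp (-(2 * Z)) ≤ x := by
    rintro x ⟨P, hP, rfl⟩
    calc Real.exp (-(2 * Z)) ≤ Real.exp (∑ p ∈ P, -(2 * normR p ^ (-(3 / 2) : ℝ))) := by
          rw [Real.exp_le_exp, Finset.sum_neg_distrib, ← Finset.mul_sum]
          linarith [hZ P]
      _ = ∏ p ∈ P, Real.exp (-(2 * normR p ^ (-(3 / 2) : ℝ))) := Real.exp_sum _ _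
      _ ≤ ∏ p ∈ P, (1 - 1 / normR p ^ 2) := by
          refine Finset.prod_le_prod (fun p _ => (Real.exp_pos _).le) fun p hp => ?_
          have h1 := one_div_normR_sq_le p
          have h2 := one_div_normR_sq_le_quarter (hP p hp)
          have h0 : 0 ≤ 1 / normR p ^ 2 := by have := normR_pos p; positivity
          set x := 1 / normR p ^ 2
          have h3 : Real.exp (-(2 * normR p ^ (-(3 / 2) : ℝ))) ≤ Real.exp (-(2 * x)) := by
            rw [Real.exp_le_exp]
            linarith
          refine h3.trans ?_
          have h4 : 1 + 2 * x ≤ Real.exp (2 * x) := by linarith [Real.add_one_le_exp (2 * x)]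
          rw [Real.exp_neg, inv_le_comm₀ (Real.exp_pos _) (by linarith)]
          refine le_trans ?_ h4
          rw [inv_le_iff_one_le_mul₀ (by linarith)]
          nlinarith
  have hbdd : BddBelow S := ⟨_, hlow⟩
  have hne : S.Nonempty := ⟨1, ∅, by simp, by simp⟩
  refine ⟨sInf S, (Real.exp_pos _).trans_le (le_csInf hne hlow),
    csInf_le hbdd ⟨∅, by simp, by simp⟩, fun Y hY => ?_⟩
  set PY := (finite_prime_normR_lt K Y).toFinset
  have hPY : ∀ p ∈ PY, Prime (p : Ideal (𝓞 K)) := fun p hp =>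
    ((finite_prime_normR_lt K Y).mem_toFinset.1 hp).1
  have hmem : ∏ p ∈ PY, (1 - 1 / normR p ^ 2) ∈ S := ⟨PY, hPY, rfl⟩
  rw [abs_of_nonneg (sub_nonneg.2 (csInf_le hbdd hmem)), sub_le_comm]
  refine le_csInf hne ?_
  have hfac : ∀ p : (Ideal (𝓞 K))⁰, Prime (p : Ideal (𝓞 K)) →
      0 ≤ 1 - 1 / normR p ^ 2 ∧ 1 - 1 / normR p ^ 2 ≤ 1 := fun p hp => by
    have h2 := one_div_normR_sq_le_quarter hp
    have h0 : 0 ≤ 1 / normR p ^ 2 := by have := normR_pos p; positivity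
    constructor <;> linarith
  rintro x ⟨P, hP, rfl⟩
  -- Compare the product over `P` with that over `P ∪ PY`.
  have h1 : ∏ p ∈ P ∪ PY, (1 - 1 / normR p ^ 2) ≤ ∏ p ∈ P, (1 - 1 / normR p ^ 2) := by
    rw [← Finset.prod_sdiff (Finset.subset_union_left : P ⊆ P ∪ PY)]
    refine mul_le_of_le_one_left (Finset.prod_nonneg fun p hp => (hfac p (hP p hp)).1) ?_
    refine Finset.prod_le_one (fun p hp => ?_) (fun p hp => ?_)
    · have : p ∈ PY := by simp at hp; tauto
      exact (hfac p (hPY p this)).1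
    · have : p ∈ PY := by simp at hp; tauto
      exact (hfac p (hPY p this)).2
  have hprod0 : 0 ≤ ∏ p ∈ PY, (1 - 1 / normR p ^ 2) :=
    Finset.prod_nonneg fun p hp => (hfac p (hPY p hp)).1
  have hprod1 : ∏ p ∈ PY, (1 - 1 / normR p ^ 2) ≤ 1 :=
    Finset.prod_le_one (fun p hp => (hfac p (hPY p hp)).1) fun p hp => (hfac p (hPY p hp)).2
  have hmemP : ∀ p ∈ (P ∪ PY) \ PY, p ∈ P ∧ Y ≤ normR p := by
    intro p hp
    rw [Finset.mem_sdiff, Finset.mem_union] at hp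
    have hpP : p ∈ P := hp.1.resolve_right hp.2
    refine ⟨hpP, not_lt.1 fun hlt => hp.2 ?_⟩
    exact (finite_prime_normR_lt K Y).mem_toFinset.2 ⟨hP p hpP, hlt⟩
  have h2 : 1 - Z * Y ^ (-(1 / 2) : ℝ) ≤ ∏ p ∈ (P ∪ PY) \ PY, (1 - 1 / normR p ^ 2) := by
    have h3 := one_sub_sum_le_prod_one_sub ((P ∪ PY) \ PY) (a := fun p => 1 / normR p ^ 2)
      (fun p hp => by have := normR_pos p; positivity)
      (fun p hp => by linarith [one_div_normR_sq_le_quarter (hP p (hmemP p hp).1)])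
    refine le_trans ?_ h3
    have h4 : ∑ p ∈ (P ∪ PY) \ PY, 1 / normR p ^ 2 ≤
        ∑ p ∈ (P ∪ PY) \ PY, normR p ^ (-(3 / 2) : ℝ) * Y ^ (-(1 / 2) : ℝ) := by
      refine Finset.sum_le_sum fun p hp => ?_
      have hpos := normR_pos p
      have : 1 / normR p ^ 2 = normR p ^ (-(3 / 2) : ℝ) * normR p ^ (-(1 / 2) : ℝ) := by
        rw [← Real.rpow_add hpos, one_div, ← Real.rpow_natCast, ← Real.rpow_neg hpos.le]
        norm_num
      rw [this]
      refine mul_le_mul_of_nonneg_left ?_ (by positivity)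
      exact Real.rpow_le_rpow_of_nonpos hY (hmemP p hp).2 (by norm_num)
    rw [← Finset.sum_mul] at h4
    have h5 := mul_le_mul_of_nonneg_right (hZ ((P ∪ PY) \ PY))
      (by positivity : 0 ≤ Y ^ (-(1 / 2) : ℝ))
    linarith
  have hZ0 : 0 ≤ Z := by simpa using hZ ∅
  have hY' : 0 ≤ Z * Y ^ (-(1 / 2) : ℝ) := by positivity
  refine le_trans ?_ h1
  rw [← Finset.prod_sdiff (Finset.subset_union_right : PY ⊆ P ∪ PY)]
  nlinarith

variable (K) in
/-- The number of squarefree ideals of norm less than `Y` in an ideal class is `s Y` up to a power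
saving. -/
theorem exists_abs_ncard_sqfreeSet_empty_sub_le : ∃ s B : ℝ, 0 < s ∧ 0 ≤ B ∧
    ∀ (κ : ClassGroup (𝓞 K)) (Y : ℝ), 0 < Y →
      |(sqfreeSet ∅ κ Y).ncard - s * Y| ≤ B * Y ^ errorExponent K := by
  obtain ⟨ρ, B, hρ, hB, h⟩ := exists_abs_ncard_classSet_sub_le K
  obtain ⟨Z, hZ0, hZ⟩ := exists_sum_normR_rpow_le (K := K)
  obtain ⟨u, hu0, hu1, hu⟩ := exists_eulerProduct_sub_le K hZ
  set θ := errorExponent K with hθ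
  have hθ1 : θ < 1 := errorExponent_lt_one
  have hθ0 : 3 / 4 ≤ θ := three_quarters_le_errorExponent
  refine ⟨ρ * u, B * Real.exp Z + ρ * Z + ρ, by positivity, by positivity, fun κ Y hY => ?_⟩
  have hYθ : 0 < Y ^ θ := Real.rpow_pos_of_pos hY _
  rcases le_or_gt Y 1 with hY1 | hY1
  · have he : sqfreeSet ∅ κ Y = ∅ :=
      Set.eq_empty_of_forall_notMem fun I hI => by
        have := hI.1
        rw [classSet_eq_empty hY1] at this
        exact this
    rw [he, Set.ncard_empty, Nat.cast_zero, zero_sub, abs_neg, abs_of_pos (by positivity)]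
    have h1 : Y ≤ Y ^ θ := by
      simpa using Real.rpow_le_rpow_of_exponent_ge hY hY1 hθ1.le
    have h2 : ρ * u * Y ≤ ρ * 1 * Y ^ θ := by gcongr
    have h3 : 0 ≤ (B * Real.exp Z + ρ * Z) * Y ^ θ := by positivity
    linarith
  have h1 := abs_ncard_siftedSet_sub_le h (finite_prime_normR_lt K Y).toFinset
    (fun p hp => ((finite_prime_normR_lt K Y).mem_toFinset.1 hp).1) κ hY
  rw [siftedSet_eq_sqfreeSet] at h1
  have h2 := mul_le_mul_of_nonneg_left (prod_one_add_le_exp hθ0 hZ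
    (finite_prime_normR_lt K Y).toFinset) (by positivity : 0 ≤ B * Y ^ θ)
  have h3 := mul_le_mul_of_nonneg_left (hu Y hY) (by positivity : 0 ≤ ρ * Y)
  set w := ∏ p ∈ (finite_prime_normR_lt K Y).toFinset, (1 - 1 / normR p ^ 2)
  have h4 : ρ * Y * (Z * Y ^ (-(1 / 2) : ℝ)) ≤ ρ * Z * Y ^ θ := by
    have : Y * Y ^ (-(1 / 2) : ℝ) ≤ Y ^ θ := by
      rw [mul_comm, ← Real.rpow_add_one hY.ne']
      exact Real.rpow_le_rpow_of_exponent_le hY1.le (by linarith)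
    calc ρ * Y * (Z * Y ^ (-(1 / 2) : ℝ)) = ρ * Z * (Y * Y ^ (-(1 / 2) : ℝ)) := by ring
      _ ≤ _ := by gcongr
  rw [← abs_of_pos (by positivity : 0 < ρ * Y), ← abs_mul, abs_of_pos (by positivity : 0 < ρ * Y)]
      at h3
  have h5 : 0 ≤ ρ * Y ^ θ := by positivity
  calc |((sqfreeSet ∅ κ Y).ncard : ℝ) - ρ * u * Y|
      = |((sqfreeSet ∅ κ Y).ncard - ρ * Y * w) + ρ * Y * (w - u)| := by ring_nf
    _ ≤ _ := (abs_add_le _ _).trans (add_le_add (h1.trans h2) (h3.trans h4))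
    _ ≤ _ := by linarith

/-- A squarefree ideal divisible by `Q` is divisible by `p` or becomes so after multiplication by
`p`, in which case it stays squarefree. -/
theorem ncard_sqfreeSet_insert [DecidableEq (Ideal (𝓞 K))⁰] {Q : Finset (Ideal (𝓞 K))⁰}
    {p : (Ideal (𝓞 K))⁰} (hQ : ∀ q ∈ Q, Prime (q : Ideal (𝓞 K))) (hp : Prime (p : Ideal (𝓞 K)))
    (hpQ : p ∉ Q) (κ : ClassGroup (𝓞 K)) (Y : ℝ) :
    (sqfreeSet (insert p Q) (κ * (ClassGroup.mk0 p)⁻¹) (Y / normR p)).ncard +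
      (sqfreeSet (insert p Q) κ Y).ncard =
      (sqfreeSet Q (κ * (ClassGroup.mk0 p)⁻¹) (Y / normR p)).ncard := by
  rw [← Set.ncard_inter_add_ncard_sdiff_eq_ncard
    (sqfreeSet Q (κ * (ClassGroup.mk0 p)⁻¹) (Y / normR p)) {I | (p : Ideal (𝓞 K)) ∣ I}
    (finite_sqfreeSet _ _ _)]
  congr 1
  · congr 1
    ext I
    simp only [sqfreeSet, Finset.mem_insert, forall_eq_or_imp, Set.mem_ofPred_eq, Set.mem_inter_iff]
    tauto
  · rw [← Set.ncard_image_of_injective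
      (sqfreeSet Q (κ * (ClassGroup.mk0 p)⁻¹) (Y / normR p) \ {I | (p : Ideal (𝓞 K)) ∣ I})
      (mul_right_injective p)]
    refine congrArg Set.ncard ?_
    have hdvd : ∀ J : (Ideal (𝓞 K))⁰, ∀ q ∈ Q, ((q : Ideal (𝓞 K)) ∣ ((p * J : (Ideal (𝓞 K))⁰) :
        Ideal (𝓞 K)) ↔
        (q : Ideal (𝓞 K)) ∣ J) := fun J q hq => by
      rw [Submonoid.coe_mul, (hQ q hq).dvd_mul]
      exact or_iff_right (not_dvd_of_prime_ne hp (hQ q hq) (by rintro rfl; exact hpQ hq))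
    ext I
    constructor
    · rintro ⟨hI, hsq, hd⟩
      obtain ⟨J, rfl⟩ := nonZeroDivisors_dvd_iff_dvd_coe.2 (hd p (Finset.mem_insert_self _ _))
      refine ⟨J, ⟨⟨mul_mem_classSet.1 hI, hsq.squarefree_of_dvd (by simp), fun q hq => ?_⟩, ?_⟩,
          rfl⟩
      · exact (hdvd J q hq).1 (hd q (Finset.mem_insert_of_mem hq))
      · intro hpJ
        exact hp.not_isUnit (hsq p (mul_dvd_mul_left _ hpJ))
    · rintro ⟨J, ⟨⟨hJ, hsq, hd⟩, hpJ⟩, rfl⟩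
      refine ⟨mul_mem_classSet.2 hJ, ?_, ?_⟩
      · rw [Submonoid.coe_mul, squarefree_mul_iff]
        exact ⟨(hp.irreducible.isRelPrime_iff_not_dvd).2 hpJ, hp.irreducible.squarefree, hsq⟩
      · intro q hq
        rcases Finset.mem_insert.1 hq with rfl | hq
        · simp
        · exact (hdvd J q hq).2 (hd q hq)

/-- For `Y ≤ 1`, where there is nothing to count, the main term is absorbed by the error term. -/
theorem abs_main_le_of_le_one {s B Y θ v : ℝ} (hs : 0 ≤ s) (hB : 0 ≤ B) (hY : 0 < Y) (hY1 : Y ≤ 1)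
    (hθ : θ ≤ 1) (hv0 : 0 ≤ v) (hv1 : v ≤ 1) (m : ℕ) :
    |s * Y * v| ≤ (B + s) * 2 ^ m * Y ^ θ := by
  have h1 : Y ≤ Y ^ θ := by
    simpa using Real.rpow_le_rpow_of_exponent_ge hY hY1 hθ
  have h2 : (1 : ℝ) ≤ 2 ^ m := one_le_pow₀ one_le_two
  rw [abs_of_nonneg (by positivity)]
  calc s * Y * v ≤ s * Y ^ θ * 1 := by gcongr
    _ = s * 1 * Y ^ θ := by ring
    _ ≤ (B + s) * 2 ^ m * Y ^ θ := by
      have : s ≤ B + s := by linarith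
      gcongr

theorem prod_density_nonneg (Q : Finset (Ideal (𝓞 K))⁰) : 0 ≤ ∏ p ∈ Q, 1 / (normR p + 1) :=
  Finset.prod_nonneg fun q _ => by have := normR_pos q; positivity

theorem prod_density_le_one (Q : Finset (Ideal (𝓞 K))⁰) : ∏ p ∈ Q, 1 / (normR p + 1) ≤ 1 :=
  Finset.prod_le_one (fun q _ => by have := normR_pos q; positivity) fun q _ => by
    have := normR_pos q
    rw [div_le_one (by linarith)]
    linarith

/-- One step of the recursion for the count `T` at `Y`, in terms of the counts `T'` and `T''` at
`Y / N`. The error terms add up since `1 + 2 ≤ 2 * 2 ^ (3 / 4)`. -/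
theorem abs_sub_le_of_rec {T T' T'' s E Y N w θ : ℝ} {m : ℕ} (hE : 0 ≤ E) (hN : 2 ≤ N) (hY : 0 < Y)
    (hθ : 3 / 4 ≤ θ) (hT : T' + T = T'') (h2 : |T'' - s * (Y / N) * w| ≤ E * 2 ^ m * (Y / N) ^ θ)
    (h1 : |T' - s * (Y / N) * (1 / (N + 1) * w)| ≤ E * 2 ^ (m + 1) * (Y / N) ^ θ) :
    |T - s * Y * (1 / (N + 1) * w)| ≤ E * 2 ^ (m + 1) * Y ^ θ := by
  have hpos : 0 < N := by linarith
  have hN1 : N + 1 ≠ 0 := by positivity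
  have e1 : T - s * Y * (1 / (N + 1) * w) = (T'' - s * (Y / N) * w) -
      (T' - s * (Y / N) * (1 / (N + 1) * w)) := by
    rw [← hT]
    field_simp
    ring
  rw [e1]
  refine (abs_sub _ _).trans ((add_le_add h2 h1).trans ?_)
  have h3 : (3 / 2 : ℝ) ≤ N ^ θ := by
    have ha : (3 / 2 : ℝ) ≤ 2 ^ (3 / 4 : ℝ) := by
      have h8 : ((2 : ℝ) ^ (3 / 4 : ℝ)) ^ 4 = 8 := by
        rw [← Real.rpow_natCast, ← Real.rpow_mul zero_le_two]
        norm_num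
      refine le_of_pow_le_pow_left₀ (n := 4) (by norm_num) (by positivity) ?_
      rw [h8]
      norm_num
    have hb : (2 : ℝ) ^ (3 / 4 : ℝ) ≤ 2 ^ θ := Real.rpow_le_rpow_of_exponent_le one_le_two hθ
    have hc : (2 : ℝ) ^ θ ≤ N ^ θ := Real.rpow_le_rpow zero_le_two hN (by linarith)
    linarith
  rw [Real.div_rpow hY.le hpos.le, ← add_mul, mul_div_assoc', div_le_iff₀ (by linarith)]
  have hYθ : 0 < Y ^ θ := Real.rpow_pos_of_pos hY _
  calc _ = E * 2 ^ m * Y ^ θ * 3 := by ring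
    _ ≤ E * 2 ^ m * Y ^ θ * (2 * N ^ θ) := by gcongr; linarith
    _ = _ := by ring

variable (K) in
/-- The squarefree ideals divisible by all `p ∈ Q` have density `∏ 1 / (N p + 1)` among all
squarefree ideals, with a power saving that is uniform in `Q`. -/
theorem exists_abs_ncard_sqfreeSet_sub_le : ∃ s B : ℝ, 0 < s ∧ 0 ≤ B ∧
    ∀ (Q : Finset (Ideal (𝓞 K))⁰), (∀ q ∈ Q, Prime (q : Ideal (𝓞 K))) →
      ∀ (κ : ClassGroup (𝓞 K)) (Y : ℝ), 0 < Y →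
      |(sqfreeSet Q κ Y).ncard - s * Y * ∏ p ∈ Q, 1 / (normR p + 1)| ≤
        B * 2 ^ Q.card * Y ^ errorExponent K := by
  classical
  obtain ⟨s, B, hs, hB, h⟩ := exists_abs_ncard_sqfreeSet_empty_sub_le K
  set θ := errorExponent K with hθ
  have hθ1 : θ < 1 := errorExponent_lt_one
  have hθ0 : 3 / 4 ≤ θ := three_quarters_le_errorExponent
  refine ⟨s, B + s, hs, by positivity, fun Q => ?_⟩
  induction Q using Finset.induction_on with
  | empty =>
    intro _ κ Y hY
    have hYθ : 0 < Y ^ θ := Real.rpow_pos_of_pos hY _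
    simp only [Finset.prod_empty, mul_one, Finset.card_empty, pow_zero]
    refine (h κ Y hY).trans ?_
    gcongr
    linarith
  | insert p Q hpQ ih =>
    intro hQ κ Y hY
    have hQ' : ∀ q ∈ Q, Prime (q : Ideal (𝓞 K)) := fun q hq => hQ q (Finset.mem_insert_of_mem hq)
    have hp := hQ p (Finset.mem_insert_self p Q)
    have hp2 := two_le_normR hp
    obtain ⟨m, hm⟩ : ∃ m : ℕ, Y ≤ 2 ^ m := by
      obtain ⟨m, hm⟩ := pow_unbounded_of_one_lt Y (one_lt_two : (1 : ℝ) < 2)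
      exact ⟨m, hm.le⟩
    -- The recursion expresses the count at `Y` by counts at `Y / N p ≤ Y / 2`.
    induction m generalizing κ Y with
    | zero =>
      have hY1 : Y ≤ 1 := by simpa using hm
      have he : sqfreeSet (insert p Q) κ Y = ∅ :=
        Set.eq_empty_of_forall_notMem fun I hI => by
          have := hI.1
          rw [classSet_eq_empty hY1] at this
          exact this
      rw [he, Set.ncard_empty, Nat.cast_zero, zero_sub, abs_neg]
      exact abs_main_le_of_le_one hs.le hB hY hY1 hθ1.le (prod_density_nonneg _)
          (prod_density_le_one _) _
    | succ m ihm =>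
      have hpos : 0 < normR p := normR_pos p
      have hY' : 0 < Y / normR p := by positivity
      have hYm : Y / normR p ≤ 2 ^ m := by
        rw [div_le_iff₀ hpos]
        calc Y ≤ 2 ^ m * 2 := by rw [← pow_succ]; exact hm
          _ ≤ _ := by gcongr
      rw [Finset.card_insert_of_notMem hpQ, Finset.prod_insert hpQ] at ihm ⊢
      refine abs_sub_le_of_rec (by positivity) hp2 hY hθ0 ?_
        (ih hQ' (κ * (ClassGroup.mk0 p)⁻¹) (Y / normR p) hY')
        (ihm (κ * (ClassGroup.mk0 p)⁻¹) (Y / normR p) hY' hYm)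
      exact_mod_cast ncard_sqfreeSet_insert hQ' hp hpQ κ Y

end sieve

end QuadMoments

/-! ### Characters as squarefree ideals with class and unit data -/

namespace QuadMoments

open Ideal
open scoped nonZeroDivisors

section characters

theorem signAt_smul {F : Type*} [Field F] {a : F} (ha : a ≠ 0) (s : AlgebraicClosure F)
    (σ : AlgebraicClosure F ≃ₐ[F] AlgebraicClosure F) :
    signAt (algebraMap F (AlgebraicClosure F) a * s) σ = signAt s σ := by
  have ha' : algebraMap F (AlgebraicClosure F) a ≠ 0 := by simpa using ha
  unfold signAt
  rw [map_mul, AlgEquiv.commutes]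
  have h := mul_right_inj' ha' (b := σ s) (c := s)
  split_ifs <;> tauto

theorem chi_sq_mul {F : Type*} [Field F] [CharZero F] {t : F} (ht : t ≠ 0) (e : F) :
    chi (t ^ 2 * e) = chi e := by
  have h : sqrtOf (t ^ 2 * e) ^ 2 = (algebraMap F (AlgebraicClosure F) t * sqrtOf e) ^ 2 := by
    rw [sqrtOf_sq, mul_pow, sqrtOf_sq, map_mul, map_pow]
  have h' : ∃ a : F, a ≠ 0 ∧ sqrtOf (t ^ 2 * e) = algebraMap F (AlgebraicClosure F) a * sqrtOf e :=
      by
    rcases sq_eq_sq_iff_eq_or_eq_neg.1 h with h | h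
    · exact ⟨t, ht, h⟩
    · exact ⟨-t, neg_ne_zero.2 ht, by rw [h, map_neg, neg_mul]⟩
  obtain ⟨a, ha, hs⟩ := h'
  ext σ
  change ((signAt (sqrtOf (t ^ 2 * e)) σ : ℤˣ) : ℤ) = ((signAt (sqrtOf e) σ : ℤˣ) : ℤ)
  rw [hs, signAt_smul ha]

variable {K : Type*} [Field K] [NumberField K]

theorem squarefreePart_of_squarefree {I : Ideal (𝓞 K)} (hI : Squarefree I) :
    squarefreePart I = I := by
  classical
  have hI0 : I ≠ 0 := hI.ne_zero
  have hnd := (UniqueFactorizationMonoid.squarefree_iff_nodup_normalizedFactors hI0).1 hI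
  unfold squarefreePart
  rw [Finset.filter_true_of_mem]
  · have h := UniqueFactorizationMonoid.prod_normalizedFactors_eq hI0
    rw [normalize_eq] at h
    conv_rhs => rw [← h]
    rw [Finset.prod_multiset_count]
    refine Finset.prod_congr rfl fun p hp => ?_
    rw [Multiset.count_eq_one_of_mem hnd (Multiset.mem_toFinset.1 hp), pow_one]
  · intro p hp
    rw [Multiset.count_eq_one_of_mem hnd (Multiset.mem_toFinset.1 hp)]
    exact odd_one

theorem squarefreePart_mul_sq {I J : Ideal (𝓞 K)} (hI : Squarefree I) (hJ : J ≠ 0) :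
    squarefreePart (I * J ^ 2) = I := by
  have h := squarefreePart_eq_of_sq (I := I * J ^ 2) (J := I) (A := 1) (B := J)
    (mul_ne_zero hI.ne_zero (pow_ne_zero 2 hJ)) hI.ne_zero one_ne_zero hJ (by ring)
  rw [h, squarefreePart_of_squarefree hI]

theorem exists_squarefree_mul_sq {I : Ideal (𝓞 K)} (hI : I ≠ 0) :
    ∃ A B : Ideal (𝓞 K), Squarefree A ∧ B ≠ 0 ∧ I = A * B ^ 2 := by
  induction I using UniqueFactorizationMonoid.induction_on_prime with
  | h₁ => exact absurd rfl hI
  | h₂ I hu =>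
    rw [isUnit_iff_eq_one] at hu
    exact ⟨1, 1, squarefree_one, one_ne_zero, by rw [hu, one_pow, one_mul]⟩
  | h₃ I p hI0 hp ih =>
    obtain ⟨A, B, hA, hB, rfl⟩ := ih hI0
    by_cases hpA : p ∣ A
    · obtain ⟨A', rfl⟩ := hpA
      exact ⟨A', p * B, hA.squarefree_of_dvd (dvd_mul_left _ _), mul_ne_zero hp.ne_zero hB, by ring⟩
    · refine ⟨p * A, B, ?_, hB, by ring⟩
      rw [squarefree_mul_iff]
      exact ⟨(hp.irreducible.isRelPrime_iff_not_dvd).2 hpA, hp.irreducible.squarefree, hA⟩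

theorem ideal_eq_of_sq_eq {I J : Ideal (𝓞 K)} (h : I ^ 2 = J ^ 2) : I = J :=
  pow_left_injective two_ne_zero h

/-- If `d = t ^ 2 * e` then the squarefree parts of `(d)` and `(e)` agree and the complementary
square roots lie in one ideal class. -/
theorem eq_and_mk0_eq_of_sq {d e : 𝓞 K} (hd : d ≠ 0) (he : e ≠ 0) {t : K}
    (h : (d : K) = t ^ 2 * e) {I I' J J' : (Ideal (𝓞 K))⁰} (hI : Squarefree (I : Ideal (𝓞 K)))
    (hI' : Squarefree (I' : Ideal (𝓞 K))) (hdI : span {d} = (I : Ideal (𝓞 K)) * (J : Ideal (𝓞 K)) ^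
        2)
    (heI : span {e} = (I' : Ideal (𝓞 K)) * (J' : Ideal (𝓞 K)) ^ 2) :
    I = I' ∧ ClassGroup.mk0 J = ClassGroup.mk0 J' := by
  obtain ⟨a, b, hb, rfl⟩ := IsFractionRing.div_surjective (A := 𝓞 K) t
  have hb0 : b ≠ 0 := nonZeroDivisors.ne_zero hb
  have hbK : algebraMap (𝓞 K) K b ≠ 0 := by simpa using hb0
  have hab : b ^ 2 * d = a ^ 2 * e := by
    apply FaithfulSMul.algebraMap_injective (𝓞 K) K
    rw [map_mul, map_mul, map_pow, map_pow]
    change _ * (d : K) = _ * (e : K)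
    rw [h]
    field_simp
  have ha0 : a ≠ 0 := by
    rintro rfl
    rw [zero_pow two_ne_zero, zero_mul] at hab
    exact mul_ne_zero (pow_ne_zero 2 hb0) hd hab
  have hspan : span {b} ^ 2 * span {d} = span {a} ^ 2 * (span {e} : Ideal (𝓞 K)) := by
    simp only [span_singleton_pow, span_singleton_mul_span_singleton, hab]
  have hII' : I = I' := by
    have h1 := squarefreePart_eq_of_sq (I := span {d}) (J := span {e}) (A := span {b})
      (B := span {a}) (by simpa [span_singleton_eq_bot]) (by simpa [span_singleton_eq_bot])
      (by simpa [span_singleton_eq_bot]) (by simpa [span_singleton_eq_bot]) hspan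
    rw [hdI, heI, squarefreePart_mul_sq hI (nonZeroDivisors.coe_ne_zero J),
      squarefreePart_mul_sq hI' (nonZeroDivisors.coe_ne_zero J')] at h1
    exact Subtype.ext h1
  refine ⟨hII', ?_⟩
  rw [hdI, heI, hII'] at hspan
  have h2 : (span {b} * (J : Ideal (𝓞 K))) ^ 2 = (span {a} * (J' : Ideal (𝓞 K))) ^ 2 := by
    refine mul_left_cancel₀ (nonZeroDivisors.coe_ne_zero I') ?_
    rw [mul_pow, mul_pow, mul_left_comm, hspan, mul_left_comm]
  exact ClassGroup.mk0_eq_mk0_iff.2 ⟨b, a, hb0, ha0, ideal_eq_of_sq_eq h2⟩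

variable (K) in
/-- The group of units modulo squares. -/
abbrev UnitsModSq : Type _ := (𝓞 K)ˣ ⧸ (powMonoidHom 2 : (𝓞 K)ˣ →* (𝓞 K)ˣ).range

instance finite_unitsModSq : Finite (UnitsModSq K) := by
  have : Group.FG (𝓞 K)ˣ := by
    rw [Group.fg_iff_monoid_fg]
    infer_instance
  refine CommGroup.finite_of_fg_isMulTorsion _ fun q => ?_
  induction q using QuotientGroup.induction_on with
  | H u =>
    refine isOfFinOrder_iff_pow_eq_one.2 ⟨2, two_pos, ?_⟩
    rw [← QuotientGroup.mk_pow, QuotientGroup.eq_one_iff]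
    exact ⟨u, rfl⟩

theorem exists_min_normR (κ : ClassGroup (𝓞 K)) : ∃ J : (Ideal (𝓞 K))⁰, ClassGroup.mk0 J = κ ∧
    ∀ J' : (Ideal (𝓞 K))⁰, ClassGroup.mk0 J' = κ → normR J ≤ normR J' := by
  obtain ⟨J, hJ, hmin⟩ := WellFounded.has_min
    (measure fun J : (Ideal (𝓞 K))⁰ => absNorm (J : Ideal (𝓞 K))).wf
    {J | ClassGroup.mk0 J = κ} (ClassGroup.mk0_surjective κ)
  refine ⟨J, hJ, fun J' hJ' => ?_⟩
  unfold normR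
  exact_mod_cast not_lt.1 (hmin J' hJ')

/-- An ideal of least norm in an ideal class. -/
noncomputable def minIdeal (κ : ClassGroup (𝓞 K)) : (Ideal (𝓞 K))⁰ := (exists_min_normR κ).choose

theorem mk0_minIdeal (κ : ClassGroup (𝓞 K)) : ClassGroup.mk0 (minIdeal κ) = κ :=
  (exists_min_normR κ).choose_spec.1

theorem normR_minIdeal_le {κ : ClassGroup (𝓞 K)} {J : (Ideal (𝓞 K))⁰} (hJ : ClassGroup.mk0 J = κ) :
    normR (minIdeal κ) ≤ normR J :=
  (exists_min_normR κ).choose_spec.2 J hJ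

/-- A generator of a principal ideal (an arbitrary element if the ideal is not principal). -/
noncomputable def gen (I : Ideal (𝓞 K)) : 𝓞 K :=
  Classical.epsilon fun d => span {d} = I

theorem span_gen {I : (Ideal (𝓞 K))⁰} (hI : ClassGroup.mk0 I = 1) : span {gen (I : Ideal (𝓞 K))} =
    (I : Ideal (𝓞 K)) := by
  have h := (ClassGroup.mk0_eq_one_iff (SetLike.coe_mem I)).1 hI
  exact Classical.epsilon_spec (p := fun d => span {d} = (I : Ideal (𝓞 K)))
    ⟨h.generator, h.span_singleton_generator⟩

/-- A unit that is a square in `K` is the square of a unit. -/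
theorem exists_unit_sq {v : (𝓞 K)ˣ} {t : K} (h : t ^ 2 = ((v : 𝓞 K) : K)) :
    ∃ w : (𝓞 K)ˣ, w ^ 2 = v := by
  obtain ⟨w, rfl⟩ := IsIntegrallyClosed.exists_algebraMap_eq_of_isIntegral_pow (R := 𝓞 K) (K := K)
      two_pos
    (x := t) (by rw [h]; exact isIntegral_algebraMap)
  have hw : w ^ 2 = v := by
    apply FaithfulSMul.algebraMap_injective (𝓞 K) K
    rw [map_pow, h]
  have hu : IsUnit w := (isUnit_pow_iff two_ne_zero).1 (hw ▸ v.isUnit)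
  exact ⟨hu.unit, Units.ext (by simpa using hw)⟩

/-- An integer `d` with `(d) = I * J ^ 2`, where `J` has least norm in the class `κ`; the unit that
it leaves open is prescribed modulo squares by `q`. -/
noncomputable def rep (q : UnitsModSq K) (κ : ClassGroup (𝓞 K)) (I : (Ideal (𝓞 K))⁰) : 𝓞 K :=
  (q.out : (𝓞 K)ˣ) * gen ((I * minIdeal κ ^ 2 : (Ideal (𝓞 K))⁰) : Ideal (𝓞 K))

theorem span_rep (q : UnitsModSq K) {κ : ClassGroup (𝓞 K)} {I : (Ideal (𝓞 K))⁰}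
    (h : ClassGroup.mk0 I = (κ ^ 2)⁻¹) :
    span {rep q κ I} = (I : Ideal (𝓞 K)) * (minIdeal κ : Ideal (𝓞 K)) ^ 2 := by
  rw [rep, span_singleton_mul_left_unit (Units.isUnit _), span_gen]
  · simp
  · rw [map_mul, map_pow, mk0_minIdeal, h, inv_mul_cancel]

theorem rep_ne_zero (q : UnitsModSq K) {κ : ClassGroup (𝓞 K)} {I : (Ideal (𝓞 K))⁰}
    (h : ClassGroup.mk0 I = (κ ^ 2)⁻¹) : rep q κ I ≠ 0 := by
  intro h0
  have := span_rep q h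
  rw [h0, span_singleton_eq_bot.2 rfl] at this
  exact mul_ne_zero (nonZeroDivisors.coe_ne_zero I)
    (pow_ne_zero 2 (nonZeroDivisors.coe_ne_zero (minIdeal κ))) this.symm

theorem D_chi_rep (q : UnitsModSq K) {κ : ClassGroup (𝓞 K)} {I : (Ideal (𝓞 K))⁰}
    (h : ClassGroup.mk0 I = (κ ^ 2)⁻¹) (hI : Squarefree (I : Ideal (𝓞 K))) :
    D (chi (rep q κ I : K)) = I := by
  rw [D_chi _ (rep_ne_zero q h), span_rep q h,
    squarefreePart_mul_sq hI (nonZeroDivisors.coe_ne_zero _)]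

theorem abs_norm_eq_normR {d : 𝓞 K} {I : (Ideal (𝓞 K))⁰} (h : span {d} = (I : Ideal (𝓞 K))) :
    |((Algebra.norm ℚ (d : K) : ℚ) : ℝ)| = normR I := by
  rw [normR, ← h, absNorm_span_singleton, ← Algebra.coe_norm_int]
  push_cast
  rw [Nat.cast_natAbs]
  push_cast
  rfl

/-- Distinct data `(q, κ, I)` give distinct characters. -/
theorem rep_injective {q q' : UnitsModSq K} {κ κ' : ClassGroup (𝓞 K)} {I I' : (Ideal (𝓞 K))⁰}
    (h : ClassGroup.mk0 I = (κ ^ 2)⁻¹) (h' : ClassGroup.mk0 I' = (κ' ^ 2)⁻¹)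
    (hI : Squarefree (I : Ideal (𝓞 K))) (hI' : Squarefree (I' : Ideal (𝓞 K)))
    (he : chi (rep q κ I : K) = chi (rep q' κ' I' : K)) : q = q' ∧ κ = κ' ∧ I = I' := by
  obtain ⟨t, ht⟩ := exists_sq_of_chi_eq (by simpa using rep_ne_zero q' h') he
  obtain ⟨hII, hκ⟩ := eq_and_mk0_eq_of_sq (rep_ne_zero q h) (rep_ne_zero q' h') ht hI hI'
    (span_rep q h) (span_rep q' h')
  rw [mk0_minIdeal, mk0_minIdeal] at hκ
  subst hκ hII
  refine ⟨?_, rfl, rfl⟩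
  -- Cancelling the generator leaves `q.out = t ^ 2 * q'.out`.
  have hg : ((gen ((I * minIdeal κ ^ 2 : (Ideal (𝓞 K))⁰) : Ideal (𝓞 K)) : 𝓞 K) : K) ≠ 0 := by
    intro h0
    refine rep_ne_zero q h ?_
    rw [rep, show gen _ = 0 from by simpa using h0, mul_zero]
  have hmul (a b : 𝓞 K) : ((a * b : 𝓞 K) : K) = a * b := map_mul (algebraMap (𝓞 K) K) a b
  have h2 : t ^ 2 = (((q'.out⁻¹ * q.out : (𝓞 K)ˣ) : 𝓞 K) : K) := by
    have hu : (((q'.out : (𝓞 K)ˣ) : 𝓞 K) : K) ≠ 0 := by simp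
    have h1 : (((q'.out⁻¹ * q.out : (𝓞 K)ˣ) : 𝓞 K) : K) * ((q'.out : (𝓞 K)ˣ) : 𝓞 K) =
        ((q.out : (𝓞 K)ˣ) : 𝓞 K) := by
      rw [← map_mul, ← Units.val_mul]
      congr 2
      rw [mul_comm, mul_inv_cancel_left]
    rw [rep, rep, hmul, hmul, ← mul_assoc] at ht
    have h3 := mul_right_cancel₀ hg ht
    refine mul_right_cancel₀ hu ?_
    rw [h1, ← h3]
  obtain ⟨w, hw⟩ := exists_unit_sq h2
  rw [← q.out_eq, ← q'.out_eq, eq_comm]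
  exact QuotientGroup.eq.2 ⟨w, hw⟩

/-- Every character `χ_d` is that of some `rep q κ I`, without an increase of the norm: if
`(d) = I * J ^ 2`, replace `J` by the ideal of least norm in its class. -/
theorem exists_chi_eq_chi_rep {d : 𝓞 K} (hd : d ≠ 0) :
    ∃ (q : UnitsModSq K) (κ : ClassGroup (𝓞 K)) (I : (Ideal (𝓞 K))⁰),
      ClassGroup.mk0 I = (κ ^ 2)⁻¹ ∧ Squarefree (I : Ideal (𝓞 K)) ∧
      chi (d : K) = chi (rep q κ I : K) ∧
      normR I * normR (minIdeal κ) ^ 2 ≤ |((Algebra.norm ℚ (d : K) : ℚ) : ℝ)| := by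
  obtain ⟨A, B, hA, hB, hAB⟩ := exists_squarefree_mul_sq (I := span {d})
    (by simpa [span_singleton_eq_bot])
  set I : (Ideal (𝓞 K))⁰ := ⟨A, mem_nonZeroDivisors_of_ne_zero hA.ne_zero⟩ with hI
  set J : (Ideal (𝓞 K))⁰ := ⟨B, mem_nonZeroDivisors_of_ne_zero hB⟩ with hJ
  have hspan : span {d} = ((I * J ^ 2 : (Ideal (𝓞 K))⁰) : Ideal (𝓞 K)) := by
    rw [hAB]
    rfl
  set κ := ClassGroup.mk0 J with hκ
  have hcl : ClassGroup.mk0 I = (κ ^ 2)⁻¹ := by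
    rw [eq_inv_iff_mul_eq_one, hκ, ← map_pow, ← map_mul,
      ClassGroup.mk0_eq_one_iff (SetLike.coe_mem _), ← hspan]
    exact ⟨d, rfl⟩
  obtain ⟨x, y, hx, hy, hxy⟩ := ClassGroup.mk0_eq_mk0_iff.1 (hκ.symm.trans (mk0_minIdeal κ).symm)
  have hnorm : normR I * normR (minIdeal κ) ^ 2 ≤ |((Algebra.norm ℚ (d : K) : ℚ) : ℝ)| := by
    rw [abs_norm_eq_normR hspan, normR_mul, sq J, normR_mul, ← sq]
    have h1 := normR_minIdeal_le (κ := κ) (J := J) rfl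
    have h2 := normR_pos I
    have h3 := normR_pos (minIdeal κ)
    gcongr
  set g := gen ((I * minIdeal κ ^ 2 : (Ideal (𝓞 K))⁰) : Ideal (𝓞 K)) with hg
  have hgspan : span {g} = (I : Ideal (𝓞 K)) * (minIdeal κ : Ideal (𝓞 K)) ^ 2 := by
    rw [hg, span_gen]
    · simp
    · rw [map_mul, map_pow, mk0_minIdeal, hcl, inv_mul_cancel]
  have hassoc : span {x ^ 2 * d} = span {y ^ 2 * g} := by
    have e1 : span {x ^ 2 * d} = (span {x} * (J : Ideal (𝓞 K))) ^ 2 * (I : Ideal (𝓞 K)) := by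
      rw [← span_singleton_mul_span_singleton, ← span_singleton_pow, hAB, mul_pow]
      ring
    have e2 : span {y ^ 2 * g} = (span {y} * (minIdeal κ : Ideal (𝓞 K))) ^ 2 * (I : Ideal (𝓞 K)) :=
        by
      rw [← span_singleton_mul_span_singleton, ← span_singleton_pow, hgspan, mul_pow]
      ring
    rw [e1, e2, hxy]
  obtain ⟨u, hu⟩ := (span_singleton_eq_span_singleton.1 hassoc).symm
  obtain ⟨w, hw⟩ : ∃ w : (𝓞 K)ˣ, u * w ^ 2 = (QuotientGroup.mk u : UnitsModSq K).out := by
    have h1 := QuotientGroup.eq.1 (QuotientGroup.out_eq' (QuotientGroup.mk u : UnitsModSq K)).symm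
    obtain ⟨w, hw⟩ := h1
    refine ⟨w, ?_⟩
    rw [← mul_inv_cancel_left u (Quotient.out _), ← hw]
    rfl
  refine ⟨QuotientGroup.mk u, κ, I, hcl, hA, ?_, hnorm⟩
  have hxK : (x : K) ≠ 0 := by simpa using hx
  have hyK : (y : K) ≠ 0 := by simpa using hy
  have hwK : (((w : (𝓞 K)ˣ) : 𝓞 K) : K) ≠ 0 := by simp
  have hd' : (d : K) = ((y : K) / (x * ((w : (𝓞 K)ˣ) : 𝓞 K))) ^ 2 * (rep (QuotientGroup.mk u) κ I :
      𝓞 K) := by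
    have h1 : (x : K) ^ 2 * d = y ^ 2 * g * ((u : (𝓞 K)ˣ) : 𝓞 K) := by
      exact_mod_cast congrArg (algebraMap (𝓞 K) K) hu.symm
    have h2 : ((rep (QuotientGroup.mk u) κ I : 𝓞 K) : K) =
        ((u : (𝓞 K)ˣ) : 𝓞 K) * (((w : (𝓞 K)ˣ) : 𝓞 K) : K) ^ 2 * g := by
      rw [rep, ← hw]
      push_cast
      rfl
    rw [h2]
    field_simp
    linear_combination h1
  rw [hd']
  exact chi_sq_mul (div_ne_zero hyK (mul_ne_zero hxK hwK)) _

end characters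

end QuadMoments

/-! ### The distribution of `D χ` -/

namespace QuadMoments

open Ideal
open scoped nonZeroDivisors

section density

variable {K : Type*} [Field K] [NumberField K]

noncomputable instance fintype_unitsModSq : Fintype (UnitsModSq K) := Fintype.ofFinite _

/-- The parameters `(q, κ, I)` of the characters `χ ∈ C(K, X)` with all `p ∈ Q` dividing `D χ`. -/
noncomputable def paramFinset (Q : Finset (Ideal (𝓞 K))⁰) (X : ℝ) :
    Finset (Σ _ : UnitsModSq K × ClassGroup (𝓞 K), (Ideal (𝓞 K))⁰) :=
  Finset.univ.sigma fun a => (finite_sqfreeSet Q (a.2 ^ 2)⁻¹ (X / normR (minIdeal a.2) ^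
      2)).toFinset

theorem mem_paramFinset {Q : Finset (Ideal (𝓞 K))⁰} {X : ℝ}
    {a : Σ _ : UnitsModSq K × ClassGroup (𝓞 K), (Ideal (𝓞 K))⁰} :
    a ∈ paramFinset Q X ↔ a.2 ∈ sqfreeSet Q (a.1.2 ^ 2)⁻¹ (X / normR (minIdeal a.1.2) ^ 2) := by
  simp [paramFinset]

theorem card_paramFinset (Q : Finset (Ideal (𝓞 K))⁰) (X : ℝ) :
    (paramFinset Q X).card = ∑ a : UnitsModSq K × ClassGroup (𝓞 K),
      (sqfreeSet Q (a.2 ^ 2)⁻¹ (X / normR (minIdeal a.2) ^ 2)).ncard := by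
  rw [paramFinset, Finset.card_sigma]
  exact Finset.sum_congr rfl fun a _ => (Set.ncard_eq_toFinset_card _ _).symm

theorem injOn_paramFinset (Q : Finset (Ideal (𝓞 K))⁰) (X : ℝ) :
    Set.InjOn (fun a : Σ _ : UnitsModSq K × ClassGroup (𝓞 K), (Ideal (𝓞 K))⁰ =>
      chi (rep a.1.1 a.1.2 a.2 : K)) (paramFinset Q X) := by
  rintro ⟨⟨q, κ⟩, I⟩ h ⟨⟨q', κ'⟩, I'⟩ h' he
  rw [Finset.mem_coe, mem_paramFinset] at h h'
  obtain ⟨rfl, rfl, rfl⟩ := rep_injective h.1.2 h'.1.2 h.2.1 h'.2.1 he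
  rfl

/-- The parametrization of `C(K, X)` by squarefree ideals: `D` of the character with parameters
`(q, κ, I)` is `I`, and the condition `|N d| < X` becomes `N I < X / N (minIdeal κ) ^ 2`. -/
theorem image_paramFinset (Q : Finset (Ideal (𝓞 K))⁰) (X : ℝ) :
    (fun a : Σ _ : UnitsModSq K × ClassGroup (𝓞 K), (Ideal (𝓞 K))⁰ =>
      chi (rep a.1.1 a.1.2 a.2 : K)) '' (paramFinset Q X : Set _) =
      {χ | χ ∈ C K X ∧ ∀ p ∈ Q, (p : Ideal (𝓞 K)) ∣ D χ} := by
  ext χ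
  constructor
  · rintro ⟨⟨⟨q, κ⟩, I⟩, h, rfl⟩
    rw [Finset.mem_coe, mem_paramFinset] at h
    obtain ⟨⟨hN, hcl⟩, hI, hQ⟩ := h
    refine ⟨⟨rep q κ I, rep_ne_zero q hcl, ?_, rfl⟩, ?_⟩
    · have hs : span {rep q κ I} = ((I * minIdeal κ ^ 2 : (Ideal (𝓞 K))⁰) : Ideal (𝓞 K)) := by
        rw [span_rep q hcl]
        rfl
      rw [abs_norm_eq_normR hs, normR_mul, sq (minIdeal κ), normR_mul, ← sq]
      have := normR_pos (minIdeal κ)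
      exact (lt_div_iff₀ (by positivity)).1 hN
    · intro p hp
      change _ ∣ D (chi (rep q κ I : K))
      rw [D_chi_rep q hcl hI]
      exact hQ p hp
  · rintro ⟨⟨d, hd, hN, rfl⟩, hQ⟩
    obtain ⟨q, κ, I, hcl, hI, hχ, hle⟩ := exists_chi_eq_chi_rep hd
    refine ⟨⟨⟨q, κ⟩, I⟩, ?_, hχ.symm⟩
    rw [Finset.mem_coe, mem_paramFinset]
    have := normR_pos (minIdeal κ)
    refine ⟨⟨(lt_div_iff₀ (by positivity)).2 (hle.trans_lt hN), hcl⟩, hI, fun p hp => ?_⟩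
    have h1 := hQ p hp
    rwa [hχ, D_chi_rep q hcl hI] at h1

variable (K) in
theorem finite_C (X : ℝ) : (C K X).Finite := by
  have h := image_paramFinset (K := K) ∅ X
  simp only [Finset.notMem_empty, IsEmpty.forall_iff, implies_true, and_true,
    Set.ofPred_mem_eq] at h
  rw [← h]
  exact (paramFinset ∅ X).finite_toSet.image _

theorem ncard_C_dvd (Q : Finset (Ideal (𝓞 K))⁰) (X : ℝ) :
    {χ | χ ∈ C K X ∧ ∀ p ∈ Q, (p : Ideal (𝓞 K)) ∣ D χ}.ncard = ∑ a : UnitsModSq K × ClassGroup (𝓞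
        K),
      (sqfreeSet Q (a.2 ^ 2)⁻¹ (X / normR (minIdeal a.2) ^ 2)).ncard := by
  rw [← image_paramFinset, (injOn_paramFinset Q X).ncard_image, Set.ncard_coe_finset,
    card_paramFinset]

variable (K) in
theorem exists_abs_ncard_C_dvd_sub_le : ∃ s B : ℝ, 0 < s ∧ 0 ≤ B ∧
    ∀ (Q : Finset (Ideal (𝓞 K))⁰), (∀ q ∈ Q, Prime (q : Ideal (𝓞 K))) → ∀ X : ℝ, 0 < X →
      |({χ | χ ∈ C K X ∧ ∀ p ∈ Q, (p : Ideal (𝓞 K)) ∣ D χ}.ncard : ℝ) -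
        s * X * ∏ p ∈ Q, 1 / (normR p + 1)| ≤ B * 2 ^ Q.card * X ^ errorExponent K := by
  obtain ⟨s, B, hs, hB, h⟩ := exists_abs_ncard_sqfreeSet_sub_le K
  set m : UnitsModSq K × ClassGroup (𝓞 K) → ℝ := fun a => normR (minIdeal a.2) ^ 2 with hm
  have hm1 : ∀ a, 1 ≤ m a := fun a => one_le_pow₀ (one_le_normR _)
  have hθ0 : 3 / 4 ≤ errorExponent K := three_quarters_le_errorExponent
  refine ⟨∑ a, s / m a, ∑ _a : UnitsModSq K × ClassGroup (𝓞 K), B, ?_,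
    Finset.sum_nonneg fun _ _ => hB, fun Q hQ X hX => ?_⟩
  · exact Finset.sum_pos (fun a _ => div_pos hs (by linarith [hm1 a])) Finset.univ_nonempty
  rw [ncard_C_dvd]
  push_cast
  rw [Finset.sum_mul, Finset.sum_mul, ← Finset.sum_sub_distrib, Finset.sum_mul, Finset.sum_mul]
  refine (Finset.abs_sum_le_sum_abs _ _).trans (Finset.sum_le_sum fun a _ => ?_)
  have ha := hm1 a
  have h1 := h Q hQ (a.2 ^ 2)⁻¹ (X / m a) (by positivity)
  have e : s / m a * X = s * (X / m a) := by ring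
  rw [e]
  refine h1.trans ?_
  have h2 : (X / m a) ^ errorExponent K ≤ X ^ errorExponent K :=
    Real.rpow_le_rpow (by positivity) (div_le_self hX.le ha) (by linarith)
  gcongr

variable (K) in
/-- The proportion of `χ ∈ C(K, X)` with all `p ∈ Q` dividing `D χ` is that of the model in which
`p` divides with probability `1 / (N p + 1)`, independently for distinct `p`. -/
theorem exists_abs_frequency_sub_le : ∃ A : ℝ, 0 ≤ A ∧
    ∀ (Q : Finset (Ideal (𝓞 K))⁰), (∀ q ∈ Q, Prime (q : Ideal (𝓞 K))) → ∀ X : ℝ, 0 < X →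
      |1 / ((C K X).ncard : ℝ) * ({χ | χ ∈ C K X ∧ ∀ p ∈ Q, (p : Ideal (𝓞 K)) ∣ D χ}.ncard : ℝ) -
        ∏ p ∈ Q, 1 / (normR p + 1)| ≤ A * X ^ (errorExponent K - 1) * 2 ^ Q.card := by
  obtain ⟨s, B, hs, hB, h⟩ := exists_abs_ncard_C_dvd_sub_le K
  refine ⟨4 * B / s, by positivity, fun Q hQ X hX => ?_⟩
  have h0 := h ∅ (by simp) X hX
  simp only [Finset.notMem_empty, IsEmpty.forall_iff, implies_true, and_true, Finset.prod_empty,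
    mul_one, Finset.card_empty, pow_zero, Set.ofPred_mem_eq] at h0
  have h1 := h Q hQ X hX
  have hle : ({χ | χ ∈ C K X ∧ ∀ p ∈ Q, (p : Ideal (𝓞 K)) ∣ D χ}.ncard : ℝ) ≤ (C K X).ncard := by
    exact_mod_cast Set.ncard_le_ncard (Set.sep_subset (C K X) _) (finite_C K X)
  have hw0 := prod_density_nonneg Q
  have hw1 := prod_density_le_one Q
  set θ := errorExponent K
  set w := ∏ p ∈ Q, 1 / (normR p + 1)
  set N := ((C K X).ncard : ℝ)
  set M := ({χ | χ ∈ C K X ∧ ∀ p ∈ Q, (p : Ideal (𝓞 K)) ∣ D χ}.ncard : ℝ)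
  have hM0 : 0 ≤ M := Nat.cast_nonneg _
  have hN0 : 0 ≤ N := Nat.cast_nonneg _
  have hXθ : 0 < X ^ θ := Real.rpow_pos_of_pos hX _
  have h2Q : (1 : ℝ) ≤ 2 ^ Q.card := one_le_pow₀ one_le_two
  have hexp : X ^ (θ - 1) = X ^ θ / X := by rw [Real.rpow_sub hX, Real.rpow_one]
  rw [hexp]
  rcases le_or_gt (2 * B * X ^ θ) (s * X) with hc | hc
  · have hNlow : s * X / 2 ≤ N := by
      have := (abs_le.1 h0).1
      linarith
    have hsX : 0 < s * X := by positivity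
    have hNpos : 0 < N := by linarith
    have e : 1 / N * M - w = (M - w * N) / N := by
      field_simp
    have h3 : |M - w * N| ≤ 2 * B * 2 ^ Q.card * X ^ θ := by
      have e2 : M - w * N = (M - s * X * w) - w * (N - s * X) := by ring
      have h4 : |w * (N - s * X)| ≤ 1 * (B * X ^ θ) := by
        rw [abs_mul, abs_of_nonneg hw0]
        exact mul_le_mul hw1 h0 (abs_nonneg _) zero_le_one
      have h5 : B * X ^ θ ≤ B * 2 ^ Q.card * X ^ θ := by
        have : 0 ≤ B * X ^ θ := by positivity
        nlinarith
      rw [e2]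
      refine (abs_sub _ _).trans ?_
      linarith
    rw [e, abs_div, abs_of_pos hNpos, div_le_iff₀ hNpos]
    calc |M - w * N| ≤ 2 * B * 2 ^ Q.card * X ^ θ := h3
      _ = 4 * B / s * (X ^ θ / X) * 2 ^ Q.card * (s * X / 2) := by
        field_simp
        ring
      _ ≤ _ := by gcongr
  · -- Here the error term exceeds the trivial bound.
    have h3 : |1 / N * M - w| ≤ 1 := by
      have h4 : 0 ≤ 1 / N * M := by positivity
      have h5 : 1 / N * M ≤ 1 := by
        rw [one_div_mul_eq_div]
        exact div_le_one_of_le₀ hle hN0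
      rw [abs_le]
      constructor <;> linarith
    refine h3.trans ?_
    have h6 : 1 ≤ 4 * B / s * (X ^ θ / X) := by
      rw [div_mul_div_comm, le_div_iff₀ (by positivity)]
      nlinarith
    nlinarith

end density

end QuadMoments

/-! ### Comparison of the moments with the independent model -/

namespace QuadMoments

open Ideal PowerSeries
open scoped nonZeroDivisors

section moments

variable {K : Type*} [Field K] [NumberField K]

/-- The density `1 / (N p + 1)` of the squarefree ideals divisible by `p`. -/
noncomputable def density (p : Ideal (𝓞 K)) : ℝ := 1 / ((absNorm p : ℝ) + 1)

theorem mem_primesBelow {z : ℝ} {p : Ideal (𝓞 K)} :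
    p ∈ primesBelow K z ↔ p.IsPrime ∧ p ≠ ⊥ ∧ (absNorm p : ℝ) < z := by
  rw [primesBelow, Set.Finite.mem_toFinset, Set.mem_ofPred_eq]

theorem prime_of_mem_primesBelow {z : ℝ} {p : Ideal (𝓞 K)} (hp : p ∈ primesBelow K z) : Prime p :=
  have h := mem_primesBelow.1 hp
  (prime_iff_isPrime h.2.1).2 h.1

theorem two_le_absNorm {p : Ideal (𝓞 K)} (hp : Prime p) : (2 : ℝ) ≤ absNorm p :=
  two_le_normR (p := ⟨p, mem_nonZeroDivisors_of_ne_zero hp.ne_zero⟩) hp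

theorem density_nonneg (p : Ideal (𝓞 K)) : 0 ≤ density p := by
  unfold density
  positivity

theorem density_le_third {p : Ideal (𝓞 K)} (hp : Prime p) : density p ≤ 1 / 3 := by
  have := two_le_absNorm hp
  exact one_div_le_one_div_of_le (by norm_num) (by linarith)

variable (K) in
/-- The proportion of `χ` with `Q` dividing `D χ`, for sets `Q` of primes among all ideals. -/
theorem exists_abs_frequency_ideal_sub_le : ∃ A : ℝ, 0 ≤ A ∧
    ∀ (Q : Finset (Ideal (𝓞 K))), (∀ q ∈ Q, Prime q) → ∀ X : ℝ, 0 < X →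
      |1 / ((C K X).ncard : ℝ) * ({χ | χ ∈ C K X ∧ ∀ p ∈ Q, p ∣ D χ}.ncard : ℝ) -
        ∏ p ∈ Q, density p| ≤ A * X ^ (errorExponent K - 1) * 2 ^ Q.card := by
  classical
  obtain ⟨A, hA, h⟩ := exists_abs_frequency_sub_le K
  refine ⟨A, hA, fun Q hQ X hX => ?_⟩
  obtain ⟨Q', rfl⟩ : ∃ Q' : Finset (Ideal (𝓞 K))⁰, Q'.map (Function.Embedding.subtype _) = Q :=
    ⟨Q.subtype _, Finset.subtype_map_of_mem fun q hq =>
      mem_nonZeroDivisors_of_ne_zero (hQ q hq).ne_zero⟩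
  have hQ' : ∀ q ∈ Q', Prime (q : Ideal (𝓞 K)) := fun q hq =>
    hQ q (Finset.mem_map_of_mem (Function.Embedding.subtype _) hq)
  have h1 := h Q' hQ' X hX
  rw [Finset.prod_map, Finset.card_map]
  simp only [Finset.forall_mem_map, Function.Embedding.subtype_apply]
  exact h1

/-- The variance of `g_p` in the model where the primes are independent. -/
noncomputable def primeVariance (f : Ideal (𝓞 K) → ℝ) (p : Ideal (𝓞 K)) : ℝ :=
  f p ^ 2 * (density p * (1 - density p))

theorem primeVariance_nonneg (f : Ideal (𝓞 K) → ℝ) {p : Ideal (𝓞 K)} (hp : Prime p) :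
    0 ≤ primeVariance f p := by
  have h1 := density_le_third hp
  have h0 := density_nonneg p
  have h2 : 0 ≤ 1 - density p := by linarith
  unfold primeVariance
  positivity

theorem primeVariance_le_one {f : Ideal (𝓞 K) → ℝ} {p : Ideal (𝓞 K)} (hp : Prime p)
    (hf : |f p| ≤ 1) : primeVariance f p ≤ 1 := by
  have h1 := density_le_third hp
  have h0 := density_nonneg p
  have h2 : f p ^ 2 ≤ 1 := by rw [← sq_abs]; exact pow_le_one₀ (abs_nonneg _) hf
  unfold primeVariance
  have h3 : density p * (1 - density p) ≤ 1 := by nlinarith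
  have h4 : 0 ≤ density p * (1 - density p) := mul_nonneg h0 (by linarith)
  exact mul_le_one₀ h2 h4 h3

/-- The variance `N / (N + 1)²` is at most `1 / N`, and differs from it by `O(1 / N²)`. -/
theorem primeVariance_le (f : Ideal (𝓞 K) → ℝ) {p : Ideal (𝓞 K)} (hp : Prime p) :
    primeVariance f p ≤ f p ^ 2 / absNorm p := by
  have h2 := two_le_absNorm hp
  unfold primeVariance density
  set N : ℝ := ((absNorm p : ℕ) : ℝ)
  have : 1 / (N + 1) * (1 - 1 / (N + 1)) ≤ 1 / N := by
    have e : 1 / (N + 1) * (1 - 1 / (N + 1)) = N / (N + 1) ^ 2 := by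
      field_simp
      ring
    rw [e, div_le_div_iff₀ (by positivity) (by positivity)]
    nlinarith
  calc f p ^ 2 * (1 / (N + 1) * (1 - 1 / (N + 1))) ≤ f p ^ 2 * (1 / N) := by gcongr
    _ = f p ^ 2 / N := by ring

theorem le_primeVariance_add {f : Ideal (𝓞 K) → ℝ} {p : Ideal (𝓞 K)} (hp : Prime p)
    (hf : |f p| ≤ 1) : f p ^ 2 / absNorm p ≤ primeVariance f p + 2 * (1 / (absNorm p : ℝ) ^ 2) := by
  have h2 := two_le_absNorm hp
  have hf2 : f p ^ 2 ≤ 1 := by rw [← sq_abs]; exact pow_le_one₀ (abs_nonneg _) hf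
  unfold primeVariance density
  set N : ℝ := ((absNorm p : ℕ) : ℝ)
  have h3 : 1 / N - 1 / (N + 1) * (1 - 1 / (N + 1)) ≤ 2 * (1 / N ^ 2) := by
    have e : 1 / N - 1 / (N + 1) * (1 - 1 / (N + 1)) = (2 * N + 1) / (N * (N + 1) ^ 2) := by
      field_simp
      ring
    rw [e, mul_one_div, div_le_div_iff₀ (by positivity) (by positivity)]
    nlinarith [mul_pos (by linarith : 0 < N) (by linarith : 0 < N)]
  have h4 : 0 ≤ 2 * (1 / N ^ 2) := by positivity
  have h5 : f p ^ 2 * (1 / N - 1 / (N + 1) * (1 - 1 / (N + 1))) ≤ 1 * (2 * (1 / N ^ 2)) :=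
    (mul_le_mul_of_nonneg_left h3 (sq_nonneg _)).trans (mul_le_mul_of_nonneg_right hf2 h4)
  have e2 : f p ^ 2 / N = f p ^ 2 * (1 / (N + 1) * (1 - 1 / (N + 1))) +
      f p ^ 2 * (1 / N - 1 / (N + 1) * (1 - 1 / (N + 1))) := by ring
  rw [e2]
  linarith

theorem sigma_sq (f : Ideal (𝓞 K) → ℝ) (z : ℝ) :
    sigma f z ^ 2 = ∑ p ∈ primesBelow K z, f p ^ 2 / (absNorm p : ℝ) :=
  Real.sq_sqrt (Finset.sum_nonneg fun p _ => by positivity)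

variable (K) in
theorem exists_sum_one_div_sq_le : ∃ Z : ℝ, 0 ≤ Z ∧ ∀ z : ℝ,
    ∑ p ∈ primesBelow K z, 1 / (absNorm p : ℝ) ^ 2 ≤ Z := by
  classical
  obtain ⟨Z, hZ0, hZ⟩ := exists_sum_normR_rpow_le (K := K)
  refine ⟨Z, hZ0, fun z => ?_⟩
  obtain ⟨Q, hQ⟩ : ∃ Q : Finset (Ideal (𝓞 K))⁰, Q.map (Function.Embedding.subtype _) = primesBelow K
      z :=
    ⟨(primesBelow K z).subtype _, Finset.subtype_map_of_mem fun q hq =>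
      mem_nonZeroDivisors_of_ne_zero (prime_of_mem_primesBelow hq).ne_zero⟩
  rw [← hQ, Finset.sum_map]
  exact (Finset.sum_le_sum fun p _ => one_div_normR_sq_le p).trans (hZ Q)

/-- The coefficients of the model generating function obey the recursion of nearly Gaussian moments.
-/
theorem exists_momentRecursion {f : Ideal (𝓞 K) → ℝ} {z : ℝ}
    (hf : ∀ p ∈ primesBelow K z, |f p| ≤ 1) :
    ∃ Λ : ℕ → ℝ, MomentRecursion (∑ p ∈ primesBelow K z, primeVariance f p)
      (fun n => coeff n (∏ p ∈ primesBelow K z, bernoulliEGF (f p) (density p))) Λ := by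
  have h0 : ∀ p ∈ primesBelow K z, coeff 0 (bernoulliEGF (f p) (density p)) = 1 := fun p _ => by
    rw [coeff_bernoulliEGF]
    simp
  obtain ⟨Λ, hd, hΛ0, hΛ1, hΛ⟩ := exists_derivative_prod_eq (primesBelow K z)
    (fun p => bernoulliEGF (f p) (density p)) (primeVariance f)
    (fun p hp => primeVariance_le_one (prime_of_mem_primesBelow hp) (hf p hp)) h0
    (fun p _ => by rw [coeff_bernoulliEGF, pow_one, pow_one, pow_one]; ring)
    (fun p _ => by rw [coeff_bernoulliEGF, primeVariance, Nat.factorial_two]; push_cast; ring)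
    (fun p hp n hn => abs_coeff_bernoulliEGF_le (hf p hp) (density_nonneg p)
      ((density_le_third (prime_of_mem_primesBelow hp)).trans (by norm_num)) hn)
  refine ⟨fun n => coeff n Λ, ?_, ?_, ?_, hΛ0, hΛ1, hΛ⟩
  · exact Finset.sum_nonneg fun p hp => primeVariance_nonneg f (prime_of_mem_primesBelow hp)
  · rw [coeff_zero_eq_constantCoeff_apply, map_prod]
    refine Finset.prod_eq_one fun p hp => ?_
    rw [← coeff_zero_eq_constantCoeff_apply, h0 p hp]
  · intro n
    have h1 := congrArg (coeff n) hd
    rw [coeff_derivative, coeff_mul,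
      Finset.Nat.sum_antidiagonal_eq_sum_range_succ (fun i j => coeff i Λ * coeff j _)] at h1
    rw [mul_comm, h1]

variable (K) in
/-- The moments agree with those of the model up to a power saving. -/
theorem exists_abs_moment_sub_le : ∃ A : ℝ, 0 ≤ A ∧
    ∀ f : Ideal (𝓞 K) → ℝ, (∀ p : Ideal (𝓞 K), p.IsPrime → p ≠ ⊥ → |f p| ≤ 1) →
      ∀ X z : ℝ, 0 < X → ∀ k : ℕ,
        |moment f X z k - k.factorial *
            coeff k (∏ p ∈ primesBelow K z, bernoulliEGF (f p) (density p))| ≤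
          A * (X ^ (errorExponent K - 1) * 3 ^ k * (primePi K z : ℝ) ^ k) := by
  classical
  obtain ⟨A, hA, h⟩ := exists_abs_frequency_ideal_sub_le K
  refine ⟨A, hA, fun f hf X z hX k => ?_⟩
  set W := (finite_C K X).toFinset with hW
  have hWc : (C K X).ncard = W.card := Set.ncard_eq_toFinset_card _ _
  have key := abs_average_pow_sub_le W (primesBelow K z) (fun p χ => p ∣ D χ) f density
    (R := A * X ^ (errorExponent K - 1))
    (fun p hp => hf p (mem_primesBelow.1 hp).1 (mem_primesBelow.1 hp).2.1)
    (fun p _ => density_nonneg p) (fun p hp => density_le_third (prime_of_mem_primesBelow hp))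
    (fun Q hQ => by
      have h1 := h Q (fun q hq => prime_of_mem_primesBelow (hQ hq)) X hX
      have h2 : {χ | χ ∈ C K X ∧ ∀ p ∈ Q, p ∣ D χ}.ncard =
          (W.filter fun χ => ∀ p ∈ Q, p ∣ D χ).card := by
        rw [← Set.ncard_coe_finset]
        congr 1
        ext χ
        simp [hW]
      rwa [hWc, h2] at h1) k
  have hm : moment f X z k = 1 / (W.card : ℝ) * ∑ χ ∈ W, (∑ p ∈ primesBelow K z,
      if p ∣ D χ then f p * (1 - density p) else -(density p * f p)) ^ k := by
    rw [moment, hWc, finsum_mem_eq_finite_toFinset_sum _ (finite_C K X)]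
    congr 1
    refine Finset.sum_congr rfl fun χ _ => ?_
    congr 1
    refine Finset.sum_congr rfl fun p _ => ?_
    unfold g density
    split_ifs
    · rfl
    · ring
  rw [hm]
  refine key.trans (le_of_eq ?_)
  rw [primePi]
  ring

end moments

end QuadMoments

theorem theorem4 :
    ∃ lam : ℕ → ℝ, (∀ n, lam n < 1) ∧
      ∀ (K : Type*) [Field K] [NumberField K], ∃ A : ℝ, 0 < A ∧
        ∀ f : Ideal (𝓞 K) → ℝ, QuadMoments.IsAdditive f →
          (∀ p : Ideal (𝓞 K), p.IsPrime → p ≠ ⊥ → |f p| ≤ 1) →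
          ∀ X z : ℝ, 1 < X → ∀ k : ℕ, (k : ℝ) ≤ QuadMoments.sigma f z ^ (2 / 3 : ℝ) →
            (QuadMoments.C K X).Finite ∧
            (Even k →
              |QuadMoments.moment f X z k - QuadMoments.c k * QuadMoments.sigma f z ^ k| ≤
                A * (QuadMoments.c k * QuadMoments.sigma f z ^ k *
                      ((k : ℝ) ^ 3 / QuadMoments.sigma f z ^ 2)
                    + X ^ (lam (Module.finrank ℚ K) - 1) * 3 ^ k *
                      (QuadMoments.primePi K z : ℝ) ^ k)) ∧
            (Odd k →
              |QuadMoments.moment f X z k| ≤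
                A * (QuadMoments.c k * QuadMoments.sigma f z ^ (k - 1) * (k : ℝ) ^ (3 / 2 : ℝ)
                    + X ^ (lam (Module.finrank ℚ K) - 1) * 3 ^ k *
                      (QuadMoments.primePi K z : ℝ) ^ k)) := by
  refine ⟨fun n => 1 - 1 / (4 * ((n : ℝ) + 1)), fun n => ?_, fun K _ _ => ?_⟩
  · have : 0 < 1 / (4 * ((n : ℝ) + 1)) := by positivity
    linarith
  obtain ⟨A₁, hA₁, h₁⟩ := QuadMoments.exists_abs_moment_sub_le K
  obtain ⟨Z, hZ0, hZ⟩ := QuadMoments.exists_sum_one_div_sq_le K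
  obtain ⟨A₂, hA₂, h₂⟩ := QuadMoments.MomentRecursion.exists_bound
    (B := 2 * Z) (by positivity)
  refine ⟨A₁ + A₂, by positivity, fun f _ hf X z hX k hk => ⟨QuadMoments.finite_C K X, ?_⟩⟩
  change (Even k → _ ≤ (A₁ + A₂) * (_ + X ^ (QuadMoments.errorExponent K - 1) * 3 ^ k *
    (QuadMoments.primePi K z : ℝ) ^ k)) ∧ (Odd k → _ ≤ (A₁ + A₂) * (_ +
      X ^ (QuadMoments.errorExponent K - 1) * 3 ^ k * (QuadMoments.primePi K z : ℝ) ^ k))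
  have hX0 : 0 < X := one_pos.trans hX
  have hfP : ∀ p ∈ QuadMoments.primesBelow K z, |f p| ≤ 1 := fun p hp =>
    hf p (QuadMoments.mem_primesBelow.1 hp).1 (QuadMoments.mem_primesBelow.1 hp).2.1
  obtain ⟨Λ, hΛ⟩ := QuadMoments.exists_momentRecursion hfP
  have hσ0 : 0 ≤ QuadMoments.sigma f z := Real.sqrt_nonneg _
  have hσ1 : ∑ p ∈ QuadMoments.primesBelow K z, QuadMoments.primeVariance f p ≤
      QuadMoments.sigma f z ^ 2 := by
    rw [QuadMoments.sigma_sq]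
    exact Finset.sum_le_sum fun p hp =>
      QuadMoments.primeVariance_le f (QuadMoments.prime_of_mem_primesBelow hp)
  have hσ2 : QuadMoments.sigma f z ^ 2 ≤
      ∑ p ∈ QuadMoments.primesBelow K z, QuadMoments.primeVariance f p + 2 * Z := by
    rw [QuadMoments.sigma_sq]
    refine (Finset.sum_le_sum fun p hp => QuadMoments.le_primeVariance_add
      (QuadMoments.prime_of_mem_primesBelow hp) (hfP p hp)).trans ?_
    rw [Finset.sum_add_distrib, ← Finset.mul_sum]
    linarith [hZ z]
  -- The moments of the model are close to Gaussian ones since its variance is `σ_f² + O(1)`.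
  obtain ⟨heven, hodd⟩ := h₂ _ _ _ Λ hΛ hσ0 hσ1 hσ2 k hk
  have hm := h₁ f hf X z hX0 k
  have hc := QuadMoments.c_pos k
  set E := X ^ (QuadMoments.errorExponent K - 1) * 3 ^ k * (QuadMoments.primePi K z : ℝ) ^ k
  have hE : 0 ≤ E := by positivity
  have combine : ∀ {a b M x : ℝ}, 0 ≤ M → |a - b| ≤ A₁ * E → |b - x| ≤ A₂ * M →
      |a - x| ≤ (A₁ + A₂) * (M + E) := fun {a b M x} hM hab hbx => by
    have h3 := abs_sub_le a b x
    have h4 : 0 ≤ A₁ * M := by positivity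
    have h5 : 0 ≤ A₂ * E := by positivity
    linarith
  refine ⟨fun hk2 => combine (by positivity) hm (heven hk2), fun hk2 => ?_⟩
  have h6 := hodd hk2
  rw [← sub_zero (_ * _)] at h6
  have h7 := combine (by positivity) hm h6
  rwa [sub_zero] at h7
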